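/- Let $(X,\mu)$ be a $\sigma$-finite measure space, $\mathcal B$ a complex Banach space, $1<p<\infty$, $0\le\psi<\pi/2$, and let $\{T_t:t\ge 0\}$ be a strongly continuous semigroup of bounded operators on $L^2(X)$ with the contraction property: $\|T_tf\|_q\le\|f\|_q$ for all $t\ge0$, $q\in[1,\infty]$ and $f\in L^2(X)\cap L^q(X)$. Each $T_t$ then extends uniquely to a bounded operator on $L^p(X)$, and this has a unique bounded $\mathcal B$-valued extension $\tilde T_t$ to the Bochner space $L^p(X,\mathcal B)$, i.e. $\tilde T_t(uf)=u\,T_tf$ for $u\in\mathcal B$, $f\in L^p(X)$. Let $-\tilde L$ be the generator of $\{\tilde T_t:t\ge0\}$ on $L^p(X,\mathcal B)$. Suppose that there are $K>0$ and $\omega<\pi/2-\psi$ such that $\tilde L$ has bounded imaginary powers $\tilde L^{iu}$ on $L^p(X,\mathcal B)$ with $$\|\tilde L^{iu}F\|_{L^p(X,\mathcal B)}\le Ke^{\omega|u|}\|F\|_{L^p(X,\mathcal B)}\qquad\forall F\in L^p(X,\mathcal B)\quad\forall u\in\mathbb R .$$ Here $\tilde L^{iu}$ is the bounded operator on $L^p(X,\mathcal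 B)$ (required to exist) which vanishes on $\ker\tilde L$ and satisfies $$\tilde L^{iu}F=\frac{1}{\Gamma(1-iu)\Gamma(1+iu)}\int_0^\infty s^{iu}(s+\tilde L)^{-2}\tilde LF\,ds\qquad\text{for } F\in\mathrm{Dom}(\tilde L)\cap\mathrm{Ran}(\tilde L).$$ Write $\Gamma_\varphi=\{z\in\mathbb C\setminus\{0\}:|\arg z|<\varphi\}$, let $\overline\Gamma_\psi$ be the closure of $\Gamma_\psi$ if $\psi>0$, and $\overline\Gamma_0=[0,\infty)$. Then there is $\epsilon>0$ such that $\{\tilde T_t:t\ge0\}$ has an analytic continuation $z\mapsto\tilde T_z$ to $\Gamma_{\psi+\epsilon}$, with values in the bounded operators on $L^p(X,\mathcal B)$, which is bounded in operator norm on $\Gamma_{\psi+\epsilon}$ (in particular on $\Gamma_\psi$); and there is a constant $C$ such that the maximal function $$\mathcal M^\psi_{\mathcal B}F=\sup\{|\tilde T_zF|_{\mathcal B}:z\in\overline\Gamma_\psi\}$$ (the supremum being taken in the lattice of measurable $[0,\infty]$-valued functions modulo null sets) satisfies $$\|\mathcal M^\psi_{\mathcal B}F\|_{L^p(X)}\le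 C\|F\|_{L^p(X,\mathcal B)}\qquad\forall F\in L^p(X,\mathcal B).$$ -/

import Mathlib

open MeasureTheory Filter Topology
open scoped NNReal ENNReal

noncomputable section

namespace VectorSemigroup

/-! ### Semigroups on `L²` and the contraction property -/

section Semigroup

variable {E : Type*} [NormedAddCommGroup E] [NormedSpace ℂ E]

/-- A strongly continuous one-parameter semigroup `{T_t : t ≥ 0}` of bounded operators. -/
structure IsStronglyContinuousSemigroup (T : ℝ≥0 → (E →L[ℂ] E)) : Prop where
  map_zero : T 0 = ContinuousLinearMap.id ℂ E
  map_add : ∀ s t : ℝ≥0, T (s + t) = (T s).comp (T t)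
  continuous : ∀ f : E, Continuous fun t : ℝ≥0 => T t f

end Semigroup

section Extension

variable {X : Type*} [MeasurableSpace X] {μ : Measure X}

/-- The contraction property: `‖T_t f‖_q ≤ ‖f‖_q` for all `t ≥ 0`, all `q ∈ [1, ∞]` and all
`f ∈ L² ∩ L^q`. -/
def HasContractionProperty (T : ℝ≥0 → (Lp ℂ 2 μ →L[ℂ] Lp ℂ 2 μ)) : Prop :=
  ∀ (t : ℝ≥0) (q : ℝ≥0∞), 1 ≤ q → ∀ f : Lp ℂ 2 μ, MemLp f q μ →
    eLpNorm (T t f) q μ ≤ eLpNorm f q μ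

variable {p : ℝ≥0∞} [Fact (1 ≤ p)]

/-- `S` is an extension to `L^p(X)` of the operator `T` on `L²(X)`: they agree on `L² ∩ L^p`.
For `p < ∞` there is at most one such bounded `S`, as `L² ∩ L^p` is dense in `L^p`. -/
def IsLpExtension (T : Lp ℂ 2 μ →L[ℂ] Lp ℂ 2 μ) (S : Lp ℂ p μ →L[ℂ] Lp ℂ p μ) : Prop :=
  ∀ (f : Lp ℂ 2 μ) (g : Lp ℂ p μ), f =ᵐ[μ] g → T f =ᵐ[μ] S g

open Classical in
/-- The bounded extension to `L^p(X)` of an operator `T` on `L²(X)` (`0` if there is none). -/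
def lpExtension (p : ℝ≥0∞) [Fact (1 ≤ p)] (T : Lp ℂ 2 μ →L[ℂ] Lp ℂ 2 μ) :
    Lp ℂ p μ →L[ℂ] Lp ℂ p μ :=
  if h : ∃ S : Lp ℂ p μ →L[ℂ] Lp ℂ p μ, IsLpExtension T S then h.choose else 0

variable {B : Type*} [NormedAddCommGroup B] [NormedSpace ℂ B]

/-- The elementary tensor `u f : x ↦ f(x) u` in `L^p(X, B)`, for `f ∈ L^p(X)` and `u ∈ B`. -/
def elemTensor (f : Lp ℂ p μ) (u : B) : Lp B p μ :=
  (ContinuousLinearMap.toSpanSingleton ℂ u).compLp f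

/-- `S` is a `B`-valued extension of `T`, that is, `S = T ⊗ I_B` on `L^p(X) ⊗ B` (by linearity it
is enough to look at elementary tensors). For `p < ∞` there is at most one such bounded `S`. -/
def IsTensorExtension (T : Lp ℂ p μ →L[ℂ] Lp ℂ p μ) (S : Lp B p μ →L[ℂ] Lp B p μ) : Prop :=
  ∀ (f : Lp ℂ p μ) (u : B), S (elemTensor f u) = elemTensor (T f) u

open Classical in
/-- The `B`-valued extension of `T` to `L^p(X, B)` (`0` if there is none). -/
def tensorExtension (B : Type*) [NormedAddCommGroup B] [NormedSpace ℂ B]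
    (T : Lp ℂ p μ →L[ℂ] Lp ℂ p μ) : Lp B p μ →L[ℂ] Lp B p μ :=
  if h : ∃ S : Lp B p μ →L[ℂ] Lp B p μ, IsTensorExtension T S then h.choose else 0

/-- The family `{T̃_t : t ≥ 0}` on `L^p(X, B)` obtained from a family `{T_t : t ≥ 0}` on `L²(X)`:
first extend each `T_t` to `L^p(X)`, then take the `B`-valued extension. -/
def vectorExtension (p : ℝ≥0∞) [Fact (1 ≤ p)] (B : Type*) [NormedAddCommGroup B]
    [NormedSpace ℂ B] (T : ℝ≥0 → (Lp ℂ 2 μ →L[ℂ] Lp ℂ 2 μ)) :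
    ℝ≥0 → (Lp B p μ →L[ℂ] Lp B p μ) :=
  fun t => tensorExtension B (lpExtension p (T t))

end Extension

/-! ### Generators, resolvents and imaginary powers -/

section ImaginaryPowers

variable {E : Type*} [NormedAddCommGroup E] [NormedSpace ℂ E]

/-- The domain of the generator: those `F` for which `lim_{t → 0+} (S_t F - F) / t` exists. -/
def generatorDomain (S : ℝ≥0 → (E →L[ℂ] E)) : Submodule ℂ E where
  carrier := {F | ∃ G : E, Tendsto (fun t : ℝ≥0 => (t : ℝ)⁻¹ • (S t F - F)) (𝓝[>] 0) (𝓝 G)}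
  add_mem' := by
    rintro F F' ⟨G, hG⟩ ⟨G', hG'⟩
    refine ⟨G + G', (hG.add hG').congr fun t => ?_⟩
    rw [map_add, ← smul_add]
    congr 1
    abel
  zero_mem' := ⟨0, by simp⟩
  smul_mem' := by
    rintro c F ⟨G, hG⟩
    refine ⟨c • G, (hG.const_smul c).congr fun t => ?_⟩
    rw [map_smul, ← smul_sub, smul_comm]

instance : (𝓝[>] (0 : ℝ≥0)).NeBot := nhdsGT_neBot 0

/-- The unbounded operator `L` for which `-L` is the generator of the semigroup `S`:
`L F = - lim_{t → 0+} (S_t F - F) / t`, with the domain where the limit exists. -/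
def negGenerator (S : ℝ≥0 → (E →L[ℂ] E)) : E →ₗ.[ℂ] E where
  domain := generatorDomain S
  toFun :=
    { toFun := fun F => - F.2.choose
      map_add' := by
        intro F F'
        have h := (F.2.choose_spec.add F'.2.choose_spec).congr fun t : ℝ≥0 =>
          show _ = (t : ℝ)⁻¹ • (S t ((F : E) + F') - ((F : E) + F')) by
            rw [map_add, ← smul_add]
            congr 1
            abel
        rw [← neg_add, neg_inj]
        exact tendsto_nhds_unique (F + F').2.choose_spec h
      map_smul' := by
        intro c F
        have h := (F.2.choose_spec.const_smul c).congr fun t : ℝ≥0 =>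
          show _ = (t : ℝ)⁻¹ • (S t (c • (F : E)) - c • (F : E)) by
            rw [map_smul, ← smul_sub, smul_comm]
        rw [RingHom.id_apply, smul_neg, neg_inj]
        exact tendsto_nhds_unique (c • F).2.choose_spec h }

/-- `R = (s + A)⁻¹`: a bounded two-sided inverse of `s + A : Dom(A) → E`. -/
def IsResolventAt (A : E →ₗ.[ℂ] E) (s : ℝ) (R : E →L[ℂ] E) : Prop :=
  (∀ G : E, ∃ F : A.domain, (F : E) = R G ∧ (s : ℂ) • (F : E) + A F = G) ∧
    ∀ F : A.domain, R ((s : ℂ) • (F : E) + A F) = F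

open Classical in
/-- The resolvent operator `(s + A)⁻¹` (`0` if `s + A` has no bounded inverse). -/
def resolventAt (A : E →ₗ.[ℂ] E) (s : ℝ) : E →L[ℂ] E :=
  if h : ∃ R : E →L[ℂ] E, IsResolventAt A s R then h.choose else 0

/-- The imaginary power `A^{iu} F` of a non-negative operator on `F ∈ Dom(A) ∩ Ran(A)`, by
Balakrishnan's formula (in the form given by Komatsu)
`A^{iu} F = (Γ(1 - iu) Γ(1 + iu))⁻¹ ∫_0^∞ s^{iu} (s + A)⁻² A F ds`.
For such `F` the integrand is absolutely integrable. For a positive number `A = a` one gets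
`a^{iu}`. -/
def imaginaryPowerFormula (A : E →ₗ.[ℂ] E) (u : ℝ) (F : A.domain) : E :=
  (Complex.Gamma (1 - Complex.I * u) * Complex.Gamma (1 + Complex.I * u))⁻¹ •
    ∫ s in Set.Ioi (0 : ℝ), ((s : ℂ) ^ (Complex.I * (u : ℂ))) •
      resolventAt A s (resolventAt A s (A F))

/-- `P = A^{iu}` as a bounded operator: it is given by the formula on `Dom(A) ∩ Ran(A)` and, with
the usual convention for operators that are not injective, it vanishes on `Ker(A)`.
(`P` is unique when `E` is the closure of `Ker(A) + Ran(A)`, because `Dom(A) ∩ Ran(A)` is dense in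
the closure of `Ran(A)` for a non-negative densely defined operator.) -/
def IsImaginaryPower (A : E →ₗ.[ℂ] E) (u : ℝ) (P : E →L[ℂ] E) : Prop :=
  (∀ F : A.domain, (F : E) ∈ Set.range A → P F = imaginaryPowerFormula A u F) ∧
    ∀ F : A.domain, A F = 0 → P F = 0

/-- `A` has bounded imaginary powers, with `‖A^{iu} F‖ ≤ K e^{ω |u|} ‖F‖` for all real `u` and
all `F`. -/
def HasBoundedImaginaryPowers (A : E →ₗ.[ℂ] E) (K ω : ℝ) : Prop :=
  ∀ u : ℝ, ∃ P : E →L[ℂ] E, IsImaginaryPower A u P ∧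
    ∀ F : E, ‖P F‖ ≤ K * Real.exp (ω * |u|) * ‖F‖

end ImaginaryPowers

/-! ### Sectors, analytic continuation, maximal functions -/

/-- The open sector `Γ_φ = {z ≠ 0 : |arg z| < φ}`. -/
def sector (φ : ℝ) : Set ℂ := {z | z ≠ 0 ∧ |z.arg| < φ}

/-- The closed sector, which contains `0`; for `φ = 0` it is the half-line `[0, ∞)`. -/
def closedSector (φ : ℝ) : Set ℂ := {z | z = 0 ∨ |z.arg| ≤ φ}

section Maximal

variable {E : Type*} [NormedAddCommGroup E] [NormedSpace ℂ E]

/-- `Tz` is a bounded analytic continuation of the family `{S_t : t ≥ 0}` to the sector `Γ_φ`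
(analytic for the operator norm). -/
structure IsBoundedAnalyticContinuation (S : ℝ≥0 → (E →L[ℂ] E)) (φ : ℝ)
    (Tz : ℂ → (E →L[ℂ] E)) : Prop where
  extends_family : ∀ t : ℝ≥0, Tz ((t : ℝ) : ℂ) = S t
  analytic : DifferentiableOn ℂ Tz (sector φ)
  bounded : ∃ M : ℝ, ∀ z ∈ sector φ, ‖Tz z‖ ≤ M

variable {X : Type*} [MeasurableSpace X] {μ : Measure X} {p : ℝ≥0∞} [Fact (1 ≤ p)]
  {B : Type*} [NormedAddCommGroup B] [NormedSpace ℂ B]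

/-- The class (modulo null sets) of the function `x ↦ |F(x)|_B`, with values in `[0, ∞]`. -/
def pointwiseNorm (F : Lp B p μ) : X →ₘ[μ] ℝ≥0∞ :=
  AEEqFun.comp (fun b : B => ‖b‖ₑ) continuous_enorm (F : X →ₘ[μ] B)

/-- `M = sup {|T_z F|_B : z in the closed sector of angle ψ}`. The functions `T_z F` are defined
modulo null sets only and the index set is uncountable, so the supremum is the one in the lattice
of classes of measurable `[0, ∞]`-valued functions: the least `M` with `|T_z F(x)|_B ≤ M(x)` for
almost every `x`, for every `z`. -/
def IsMaximalFunction (ψ : ℝ) (Tz : ℂ → (Lp B p μ →L[ℂ] Lp B p μ)) (F : Lp B p μ)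
    (M : X →ₘ[μ] ℝ≥0∞) : Prop :=
  IsLUB ((fun z => pointwiseNorm (Tz z F)) '' closedSector ψ) M

end Maximal

end VectorSemigroup

end

/-! Write L for L̃ and S_t for T̃_t. Two facts carry the proof.

The first is ergodic and uses no imaginary powers. S_t contracts both the L¹ and the L^∞ norm of
B-valued functions. For such operators Chacon's filling scheme (`measure_maximal_le`) bounds the
maximal function of the averages n⁻¹ ∑_{k<n} S_δ^k F in L^p, with a constant that does not depend on
δ (`eLpNorm_ergodicMaximal_le`). The same inequality replaces an interpolation theorem when S_t is
constructed on L^p(X, B).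

The second is a Mellin formula: for F in Dom(L) ∩ Ran(L), t S_t L F = (2π)⁻¹ ∫ t^{iu} Γ(1 - iu)
L^{iu} F du (`smul_orbit_eq_mellinRep`). Mellin inversion of the integral defining L^{iu} recovers
(s + L)⁻² L F, which is the Laplace transform of t S_t L F; uniqueness of the Laplace transform then
gives the formula. Since t S_t L F is minus the derivative of S_t F with respect to log t,
integration gives S_z F - S_{z'} F = ∫ (e^{iu log z'} - e^{iu log z}) Γ(1 - iu) / (2πiu) L^{iu} F
du. As Γ(1 - iu) decays like e^{-θ|u|} for every θ < π/2, the integral converges for complex z as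
long as ω + |arg z| < π/2. It defines the analytic continuation `sectorExtension` and yields the
pointwise bound |S_z F - S_{z'} F| ≤ |log z - log z'| g, with g = ∫ w(u) |L^{iu} F| du and ‖g‖_p ≤ J
‖F‖_p (`ae_norm_sectorExtension_sub_le`).

This Lipschitz bound in log z reduces the sector to averages. Every z ≠ 0 in the closed sector is
within 1 + ψ of a dyadic time 2^j in the metric |log z - log z'|. Moreover S_{nδ} F differs from the
mean of the S_{kδ} F, 1 ≤ k ≤ n, by at most n⁻¹ ∑ log(n/k) g ≤ g. Hence the maximal function is at
most an ergodic maximal function plus a multiple of g, plus |F| for z = 0.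

Identities known on Ker(L) and on Dom(L) ∩ Ran(L) hold everywhere because these span a dense
subspace (`mem_of_ker_of_domain_inter_range`). This needs mean ergodic convergence in L^p(X, B); as
B is arbitrary, reflexivity is not available, and the convergence is transferred from L²(X). -/

open MeasureTheory Filter Topology
open scoped NNReal ENNReal

noncomputable section

namespace VectorSemigroup

/-! ### Radial truncation of vectors -/

section Truncation

variable {B : Type*} [NormedAddCommGroup B] [NormedSpace ℂ B]

/-- Radial truncation of `x` to the closed ball of radius `r`. -/
def radialTrunc (r : ℝ) (x : B) : B := (min 1 (r / ‖x‖)) • x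

lemma norm_radialTrunc {r : ℝ} (hr : 0 ≤ r) (x : B) : ‖radialTrunc r x‖ = min r ‖x‖ := by
  rcases eq_or_ne x 0 with rfl | hx
  · simp [radialTrunc, hr]
  · have hx' : 0 < ‖x‖ := norm_pos_iff.2 hx
    rw [radialTrunc, norm_smul, Real.norm_of_nonneg (by positivity), min_mul_of_nonneg _ _ hx'.le,
      one_mul, div_mul_cancel₀ _ hx'.ne', min_comm]

/-- Cutting along the ray makes lengths add exactly: the lengths of the two pieces sum to ‖x‖. This
is what lets the scalar filling scheme run for vectors. -/
lemma norm_sub_radialTrunc {r : ℝ} (hr : 0 ≤ r) (x : B) :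
    ‖x - radialTrunc r x‖ = ‖x‖ - min r ‖x‖ := by
  rcases eq_or_ne x 0 with rfl | hx
  · simp [radialTrunc, hr]
  · have hx' : 0 < ‖x‖ := norm_pos_iff.2 hx
    have : x - radialTrunc r x = (1 - min 1 (r / ‖x‖)) • x := by
      rw [radialTrunc, sub_smul, one_smul]
    rw [this, norm_smul, Real.norm_of_nonneg (by simp), sub_mul, min_mul_of_nonneg _ _ hx'.le,
      one_mul, div_mul_cancel₀ _ hx'.ne', min_comm]

variable {X : Type*} [MeasurableSpace X] {μ : Measure X}

lemma aestronglyMeasurable_radialTrunc {c : X → ℝ} {f : X → B} (hc : AEStronglyMeasurable c μ)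
    (hf : AEStronglyMeasurable f μ) :
    AEStronglyMeasurable (fun x => radialTrunc (c x) (f x)) μ := by
  unfold radialTrunc
  have h : AEStronglyMeasurable (fun x => min 1 (c x / ‖f x‖)) μ :=
    ((aemeasurable_const (b := (1 : ℝ))).min
      (hc.aemeasurable.div hf.norm.aemeasurable)).aestronglyMeasurable
  exact h.smul hf

end Truncation

/-! ### Chacon's filling scheme and the passage from weak to strong type -/

section Chacon

variable {X : Type*} [MeasurableSpace X] {μ : Measure X} {q : ℝ≥0∞} [Fact (1 ≤ q)]
  {B : Type*} [NormedAddCommGroup B] [NormedSpace ℂ B]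

/-- A bounded operator on `L^q(X, B)` that is contractive for the `L¹` and `L^∞` norms. -/
structure IsL1LInftyContraction (T : Lp B q μ →L[ℂ] Lp B q μ) : Prop where
  lintegral_le : ∀ F : Lp B q μ, ∫⁻ x, ‖T F x‖ₑ ∂μ ≤ ∫⁻ x, ‖F x‖ₑ ∂μ
  bound : ∀ (F : Lp B q μ) {a : ℝ}, 0 ≤ a → (∀ᵐ x ∂μ, ‖F x‖ ≤ a) → ∀ᵐ x ∂μ, ‖T F x‖ ≤ a

omit [Fact (1 ≤ q)] in
-- A vessel over x of capacity a already holds c x. As much of G x as fits is deposited (D), and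
-- what remains (R) is nonzero only over full vessels.
lemma exists_fill_step {a : ℝ} (c : X → ℝ) (hc : AEStronglyMeasurable c μ)
    (hca : ∀ᵐ x ∂μ, 0 ≤ c x ∧ c x ≤ a) (G : Lp B q μ) :
    ∃ D R : Lp B q μ, R + D = G ∧ ∀ᵐ x ∂μ, ‖R x‖ + ‖D x‖ = ‖G x‖ ∧ c x + ‖D x‖ ≤ a ∧
      (R x ≠ 0 → c x + ‖D x‖ = a) := by
  have hm : MemLp (fun x => radialTrunc (a - c x) (G x)) q μ := by
    refine (Lp.memLp G).mono (aestronglyMeasurable_radialTrunc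
      (aestronglyMeasurable_const.sub hc) (Lp.aestronglyMeasurable G)) ?_
    filter_upwards [hca] with x hx
    rw [norm_radialTrunc (by linarith)]
    exact min_le_right _ _
  refine ⟨hm.toLp _, G - hm.toLp _, by abel, ?_⟩
  filter_upwards [hca, hm.coeFn_toLp, Lp.coeFn_sub G (hm.toLp _)] with x hx h1 h2
  rw [h2, Pi.sub_apply, h1, norm_radialTrunc (by linarith), norm_sub_radialTrunc (by linarith)]
  refine ⟨by ring, by linarith [min_le_left (a - c x) ‖G x‖], fun h => ?_⟩
  rw [← norm_ne_zero_iff, norm_sub_radialTrunc (by linarith)] at h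
  rcases le_total (a - c x) ‖G x‖ with h' | h'
  · rw [min_eq_left h']; ring
  · rw [min_eq_right h'] at h
    simp at h

/-- Iterated filling: the overflow R n is moved by T and poured again into the same vessels. -/
lemma exists_filling_scheme (T : Lp B q μ →L[ℂ] Lp B q μ) {a : ℝ} (ha : 0 ≤ a) (F : Lp B q μ) :
    ∃ D R : ℕ → Lp B q μ, R 0 + D 0 = F ∧ (∀ n, R (n + 1) + D (n + 1) = T (R n)) ∧
      (∀ᵐ x ∂μ, ‖R 0 x‖ + ‖D 0 x‖ = ‖F x‖) ∧
      (∀ n, ∀ᵐ x ∂μ, ‖R (n + 1) x‖ + ‖D (n + 1) x‖ = ‖T (R n) x‖) ∧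
      ∀ n, ∀ᵐ x ∂μ, ∑ i ∈ Finset.range (n + 1), ‖D i x‖ ≤ a ∧
        (R n x ≠ 0 → ∑ i ∈ Finset.range (n + 1), ‖D i x‖ = a) := by
  let P : (X → ℝ) → Prop := fun c => AEStronglyMeasurable c μ ∧ ∀ᵐ x ∂μ, 0 ≤ c x ∧ c x ≤ a
  have step := fun (c : {c // P c}) (G : Lp B q μ) => exists_fill_step c.1 c.2.1 c.2.2 G
  choose D R hDR h using step
  have hP : ∀ (c : {c // P c}) (G : Lp B q μ), P (fun x => c.1 x + ‖D c G x‖) := by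
    intro c G
    refine ⟨c.2.1.add (Lp.aestronglyMeasurable _).norm, ?_⟩
    filter_upwards [h c G, c.2.2] with x hx hc
    exact ⟨add_nonneg hc.1 (norm_nonneg _), hx.2.1⟩
  let c0 : {c // P c} := ⟨fun _ => 0, aestronglyMeasurable_const, by simp [ha]⟩
  -- The state before step n consists of the level reached so far and the function about to be
  -- poured.
  let s : ℕ → {c // P c} × Lp B q μ := fun n => Nat.rec (c0, F)
    (fun _ s => (⟨_, hP s.1 s.2⟩, T (R s.1 s.2))) n
  have hs : ∀ n, s (n + 1) = (⟨_, hP (s n).1 (s n).2⟩, T (R (s n).1 (s n).2)) := fun n => rfl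
  have hsum : ∀ n, ∀ x, (s n).1.1 x = ∑ i ∈ Finset.range n, ‖D (s i).1 (s i).2 x‖ := by
    intro n x
    induction n with
    | zero => simp [s, c0]
    | succ n ih => rw [Finset.sum_range_succ, ← ih, hs]
  refine ⟨fun n => D (s n).1 (s n).2, fun n => R (s n).1 (s n).2, hDR _ _, fun n => ?_, ?_,
    fun n => ?_, fun n => ?_⟩
  · exact hDR (s (n + 1)).1 (s (n + 1)).2
  · filter_upwards [h (s 0).1 (s 0).2] with x hx using hx.1
  · filter_upwards [h (s (n + 1)).1 (s (n + 1)).2] with x hx using hx.1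
  · filter_upwards [h (s n).1 (s n).2] with x hx
    rw [Finset.sum_range_succ, ← hsum]
    exact hx.2

/-- **Chacon's maximal inequality** for vector-valued `L¹`-`L^∞` contractions. -/
lemma measure_maximal_le {T : Lp B q μ →L[ℂ] Lp B q μ} (hT : IsL1LInftyContraction T)
    {a : ℝ} (ha : 0 < a) (F : Lp B q μ) (N : ℕ) :
    ENNReal.ofReal (a / 2) *
        μ {x | ∃ n ≤ N, n * a < ‖(∑ k ∈ Finset.range n, (T ^ k) F : Lp B q μ) x‖} ≤
      ∫⁻ x in {x | ENNReal.ofReal (a / 2) < ‖F x‖ₑ}, ‖F x‖ₑ ∂μ := by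
  obtain ⟨D, R, h0, h1, h0', h1', h2⟩ := exists_filling_scheme T ha.le F
  set f : X → B := ⇑F with hf
  -- the averages
  have avg : ∀ n, ∃ H : Lp B q μ, (∑ k ∈ Finset.range n, (T ^ k) F) =
      (∑ k ∈ Finset.range n, R k) + H ∧ ∀ᵐ x ∂μ, ‖H x‖ ≤ n * a := by
    intro n
    induction n with
    | zero =>
      refine ⟨0, by simp, ?_⟩
      filter_upwards [Lp.coeFn_zero B q μ] with x hx
      simpa using hx
    | succ n ih =>
      obtain ⟨H, hH, hb⟩ := ih
      have hTH := hT.bound H (a := n * a) (by positivity) hb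
      -- Applying T and adding F turns each T (R k) into R (k+1) + D (k+1). The new bounded part
      -- consists of all deposits so far, at most a in norm, and T H, at most n a.
      refine ⟨(∑ i ∈ Finset.range (n + 1), D i) + T H, ?_, ?_⟩
      · rw [Finset.sum_range_succ']
        have : ∑ k ∈ Finset.range n, (T ^ (k + 1)) F = T (∑ k ∈ Finset.range n, (T ^ k) F) := by
          rw [map_sum]
          refine Finset.sum_congr rfl fun k _ => ?_
          rw [pow_succ']; rfl
        rw [this, hH, map_add, map_sum, Finset.sum_congr rfl fun k _ => (h1 k).symm,
          Finset.sum_add_distrib, pow_zero, one_apply_eq_self, ← h0,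
          Finset.sum_range_succ' R, Finset.sum_range_succ' D]
        abel
      · filter_upwards [hTH, h2 n, Lp.coeFn_add (∑ i ∈ Finset.range (n + 1), D i) (T H),
          Lp.coeFn_finsetSum (Finset.range (n + 1)) D] with x h3 h4 h5 h6
        rw [h5, Pi.add_apply, h6]
        refine (norm_add_le _ _).trans ?_
        have h7 : ‖(∑ i ∈ Finset.range (n + 1), (D i : X → B)) x‖ ≤ a := by
          rw [Finset.sum_apply]
          exact (norm_sum_le _ _).trans h4.1
        push_cast
        linarith
  choose H hH hHb using avg
  -- Since H n is bounded by n a, an average exceeding a forces some R k with k < n to be nonzero.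
  set e : Set X := {x | ∃ n < N + 1, R n x ≠ 0} with he
  have hsub : ∀ᵐ x ∂μ, x ∈ {x | ∃ n ≤ N, n * a < ‖(∑ k ∈ Finset.range n, (T ^ k) F : Lp B q μ) x‖}
      → x ∈ e := by
    have h5 : ∀ᵐ x ∂μ, ∀ n, (∑ k ∈ Finset.range n, (T ^ k) F : Lp B q μ) x =
        (∑ k ∈ Finset.range n, R k x) + H n x := by
      rw [ae_all_iff]
      intro n
      rw [hH n]
      filter_upwards [Lp.coeFn_add (∑ i ∈ Finset.range n, R i) (H n),
        Lp.coeFn_finsetSum (Finset.range n) R] with x h5 h6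
      rw [h5, Pi.add_apply, h6, Finset.sum_apply]
    filter_upwards [h5, ae_all_iff.2 hHb] with x h5 h6
    rintro ⟨n, hn, hx⟩
    by_contra hxe
    simp only [he, Set.mem_ofPred_eq, not_exists, not_and, not_not] at hxe
    rw [h5 n, Finset.sum_eq_zero fun k hk => hxe k (by
      have := Finset.mem_range.1 hk; omega), zero_add] at hx
    exact absurd (h6 n) (not_le.2 hx)
  refine (mul_le_mul_right (measure_mono_ae hsub) _).trans ?_
  -- Lengths of R and D add up and T contracts L¹, so all later deposits are paid for by R 0.
  have hmass : ∀ n, ∫⁻ x, ‖R n x‖ₑ ∂μ + ∑ i ∈ Finset.range n, ∫⁻ x, ‖D (i + 1) x‖ₑ ∂μ ≤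
      ∫⁻ x, ‖R 0 x‖ₑ ∂μ := by
    intro n
    induction n with
    | zero => simp
    | succ n ih =>
      refine le_trans ?_ ih
      rw [Finset.sum_range_succ, add_comm (Finset.sum _ _), ← add_assoc]
      gcongr
      rw [← lintegral_add_left' (Lp.aestronglyMeasurable _).enorm]
      refine le_trans (le_of_eq (lintegral_congr_ae ?_)) (hT.lintegral_le (R n))
      filter_upwards [h1' n] with x hx
      rw [← ofReal_norm, ← ofReal_norm, ← ofReal_norm, ← hx,
        ENNReal.ofReal_add (norm_nonneg _) (norm_nonneg _)]
  have hmeas : NullMeasurableSet {x | ENNReal.ofReal (a / 2) < ‖f x‖ₑ} μ :=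
    nullMeasurableSet_lt aemeasurable_const (Lp.aestronglyMeasurable F).enorm
  have hemeas : NullMeasurableSet e μ := by
    have : e = ⋃ n ∈ Finset.range (N + 1), {x | R n x ≠ 0} := by
      ext x; simp [he]
    rw [this]
    refine NullMeasurableSet.biUnion (Finset.countable_toSet _) fun n _ => ?_
    exact (nullMeasurableSet_eq_fun (Lp.aestronglyMeasurable (R n)).norm.aemeasurable
      (aemeasurable_const (b := (0 : ℝ)))).compl.congr (by
        refine Eventually.of_forall fun x => ?_
        simp [Set.compl_def])
  rw [← lintegral_indicator₀ hmeas]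
  set g : X → ℝ≥0∞ := {x | ENNReal.ofReal (a / 2) < ‖f x‖ₑ}.indicator fun x => ‖f x‖ₑ
  have hg : AEMeasurable g μ := (Lp.aestronglyMeasurable F).enorm.indicator₀ hmeas
  have hmono : ∀ᵐ x ∂μ, ∀ n < N + 1, R n x ≠ 0 → a ≤ ∑ i ∈ Finset.range (N + 1), ‖D i x‖ := by
    filter_upwards [ae_all_iff.2 h2] with x hx n hn hR
    rw [← (hx n).2 hR]
    exact Finset.sum_le_sum_of_subset_of_nonneg (by
      intro i hi; simp only [Finset.mem_range] at hi ⊢; omega) fun _ _ _ => norm_nonneg _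
  -- The threshold a/2 splits the cases. If ‖F x‖ > a/2, then F x pays alone: either R 0 x = 0, or
  -- the first deposit has length a. Otherwise R 0 x = 0 and the first deposit is at most a/2, so on
  -- e the later ones must contribute at least a/2.
  have key : ∀ᵐ x ∂μ, e.indicator (fun _ => ENNReal.ofReal (a / 2)) x + ‖R 0 x‖ₑ ≤
      g x + ∑ i ∈ Finset.range N, ‖D (i + 1) x‖ₑ := by
    filter_upwards [hmono, h2 0, h0'] with x hx1 hx2 hx3
    simp only [zero_add, Finset.sum_range_one] at hx2
    by_cases hF : a / 2 < ‖f x‖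
    · have hgx : g x = ENNReal.ofReal ‖f x‖ := by
        simp only [g]
        rw [Set.indicator_of_mem, ofReal_norm]
        rw [Set.mem_ofPred_eq, ← ofReal_norm]
        exact (ENNReal.ofReal_lt_ofReal_iff (by linarith)).2 hF
      refine le_trans ?_ le_self_add
      have : e.indicator (fun _ => ENNReal.ofReal (a / 2)) x ≤ ENNReal.ofReal (a / 2) :=
        Set.indicator_le_self' (fun _ _ => zero_le) x
      refine (add_le_add_left this _).trans ?_
      rw [hgx, ← ofReal_norm, ← ENNReal.ofReal_add (by linarith) (norm_nonneg _)]
      refine ENNReal.ofReal_le_ofReal ?_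
      by_cases hR : R 0 x = 0
      · rw [hR, norm_zero]; linarith
      · have := hx2.2 hR; linarith
    · have hR : R 0 x = 0 := by
        by_contra hR
        have := hx2.2 hR
        have := norm_nonneg (R 0 x)
        linarith
      rw [hR, enorm_zero, add_zero]
      refine le_trans ?_ le_add_self
      by_cases hxe : x ∈ e
      · rw [Set.indicator_of_mem hxe]
        obtain ⟨n, hn, hRn⟩ := hxe
        have h3 := hx1 n hn hRn
        rw [Finset.sum_range_succ'] at h3
        simp_rw [← ofReal_norm]
        rw [← ENNReal.ofReal_sum_of_nonneg fun _ _ => norm_nonneg _]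
        refine ENNReal.ofReal_le_ofReal ?_
        rw [hR, norm_zero, zero_add] at hx3
        linarith
      · rw [Set.indicator_of_notMem hxe]; exact zero_le
  by_cases hfin : ∫⁻ x, g x ∂μ = ∞
  · rw [hfin]; exact le_top
  -- F need not be integrable, but R 0 lives where ‖F‖ ≥ a and is dominated by g. Finiteness is
  -- needed to cancel the integral of R 0.
  have hR0 : ∫⁻ x, ‖R 0 x‖ₑ ∂μ ≠ ∞ := by
    refine ne_top_of_le_ne_top hfin (lintegral_mono_ae ?_)
    filter_upwards [h2 0, h0'] with x hx2 hx3
    simp only [zero_add, Finset.sum_range_one] at hx2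
    by_cases hR : R 0 x = 0
    · rw [hR, enorm_zero]; exact zero_le
    have h4 := hx2.2 hR
    have h5 := norm_nonneg (R 0 x)
    simp only [g]
    rw [Set.indicator_of_mem]
    · rw [← ofReal_norm, ← ofReal_norm]
      exact ENNReal.ofReal_le_ofReal (by linarith)
    · rw [Set.mem_ofPred_eq, ← ofReal_norm]
      exact (ENNReal.ofReal_lt_ofReal_iff (by linarith)).2 (by linarith)
  have int := lintegral_mono_ae key
  rw [lintegral_add_right' _ (Lp.aestronglyMeasurable _).enorm, lintegral_add_left' hg,
    lintegral_finsetSum' _ fun i _ => (Lp.aestronglyMeasurable _).enorm,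
    lintegral_indicator_const₀ hemeas] at int
  refine (ENNReal.add_le_add_iff_right hR0).1 (int.trans ?_)
  gcongr
  exact le_add_self.trans (hmass N)

/-- A Marcinkiewicz-type passage from weak-type to strong-type bounds. -/
lemma lintegral_rpow_le_of_weak {f m : X → ℝ≥0∞} (hf : AEMeasurable f μ) (hm : AEMeasurable m μ)
    (hf' : ∀ᵐ x ∂μ, f x ≠ ∞) (hm' : ∀ᵐ x ∂μ, m x ≠ ∞)
    (h : ∀ a : ℝ, 0 < a → ENNReal.ofReal (a / 2) * μ {x | ENNReal.ofReal a < m x} ≤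
      ∫⁻ x in {x | ENNReal.ofReal (a / 2) < f x}, f x ∂μ) {r : ℝ} (hr : 1 < r) :
    ∫⁻ x, m x ^ r ∂μ ≤ ENNReal.ofReal (2 ^ r * (r / (r - 1))) * ∫⁻ x, f x ^ r ∂μ := by
  have hr0 : 0 < r := by linarith
  -- The weak inequality reads (t/2) μ{m > t} ≤ ν{2f > t}. It compares the layer-cake formula for m
  -- (exponent r, measure μ) with the one for 2f (exponent r - 1, measure ν).
  set ν := μ.withDensity f with hν
  have hac : ν ≪ μ := withDensity_absolutelyContinuous _ _
  have e1 : ∫⁻ x, m x ^ r ∂μ = ∫⁻ x, ENNReal.ofReal ((m x).toReal ^ r) ∂μ := by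
    refine lintegral_congr_ae ?_
    filter_upwards [hm'] with x hx
    rw [← ENNReal.ofReal_rpow_of_nonneg ENNReal.toReal_nonneg hr0.le, ENNReal.ofReal_toReal hx]
  have e2 : ∫⁻ x, ENNReal.ofReal ((2 * (f x).toReal) ^ (r - 1)) ∂ν =
      ENNReal.ofReal (2 ^ (r - 1)) * ∫⁻ x, f x ^ r ∂μ := by
    have hmeas : AEMeasurable (fun x => ENNReal.ofReal ((2 * (f x).toReal) ^ (r - 1))) μ :=
      ((hf.ennreal_toReal.const_mul 2).pow_const _).ennreal_ofReal
    rw [hν, lintegral_withDensity_eq_lintegral_mul₀ hf hmeas, ← lintegral_const_mul'' _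
      (hf.pow_const _)]
    refine lintegral_congr_ae ?_
    filter_upwards [hf'] with x hx
    rw [Pi.mul_apply, Real.mul_rpow (by norm_num) ENNReal.toReal_nonneg,
      ENNReal.ofReal_mul (by positivity),
      ← ENNReal.ofReal_rpow_of_nonneg ENNReal.toReal_nonneg (by linarith), ENNReal.ofReal_toReal hx,
      mul_left_comm]
    congr 1
    conv_rhs => rw [show r = 1 + (r - 1) by ring, ENNReal.rpow_add_of_nonneg _ _ (by norm_num)
      (by linarith), ENNReal.rpow_one]
  rw [e1, lintegral_rpow_eq_lintegral_meas_lt_mul μ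
    (Eventually.of_forall fun _ => ENNReal.toReal_nonneg) hm.ennreal_toReal hr0]
  have e3 := lintegral_rpow_eq_lintegral_meas_lt_mul ν (f := fun x => 2 * (f x).toReal)
    (Eventually.of_forall fun _ => by positivity)
    ((hf.ennreal_toReal.const_mul 2).mono_ac hac) (show 0 < r - 1 by linarith)
  have e4 : ∫⁻ t in Set.Ioi (0 : ℝ), μ {x | t < (m x).toReal} * ENNReal.ofReal (t ^ (r - 1)) ≤
      ∫⁻ t in Set.Ioi (0 : ℝ), 2 * (ν {x | t < 2 * (f x).toReal} *
        ENNReal.ofReal (t ^ (r - 1 - 1))) := by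
    refine setLIntegral_mono' measurableSet_Ioi fun t ht => ?_
    have ht : 0 < t := ht
    have h1 : μ {x | t < (m x).toReal} ≤ μ {x | ENNReal.ofReal t < m x} := by
      refine measure_mono fun x hx => ?_
      simp only [Set.mem_ofPred_eq] at hx ⊢
      exact ((ENNReal.lt_ofReal_iff_toReal_lt ENNReal.ofReal_ne_top).2
        (by rwa [ENNReal.toReal_ofReal ht.le])).trans_le ENNReal.ofReal_toReal_le
    have hns : NullMeasurableSet {x | ENNReal.ofReal (t / 2) < f x} μ :=
      nullMeasurableSet_lt aemeasurable_const hf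
    have h2 : ∫⁻ x in {x | ENNReal.ofReal (t / 2) < f x}, f x ∂μ ≤
        ν {x | t < 2 * (f x).toReal} := by
      rw [← withDensity_apply₀ f hns]
      refine measure_mono_ae ?_
      filter_upwards [hac.ae_le hf'] with x hx hx'
      have := (ENNReal.ofReal_lt_iff_lt_toReal (by positivity) hx).1 hx'
      show t < 2 * (f x).toReal
      linarith
    have h3 := (h t ht).trans h2
    have h4 : ENNReal.ofReal (t ^ (r - 1)) = 2 * ENNReal.ofReal (t / 2) *
        ENNReal.ofReal (t ^ (r - 1 - 1)) := by
      rw [← ENNReal.ofReal_ofNat, ← ENNReal.ofReal_mul (by norm_num),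
        ← ENNReal.ofReal_mul (by positivity)]
      congr 1
      rw [Real.rpow_sub_one ht.ne' (r - 1)]
      field_simp
    calc μ {x | t < (m x).toReal} * ENNReal.ofReal (t ^ (r - 1))
        ≤ μ {x | ENNReal.ofReal t < m x} * ENNReal.ofReal (t ^ (r - 1)) := by gcongr
      _ = 2 * ((ENNReal.ofReal (t / 2) * μ {x | ENNReal.ofReal t < m x}) *
          ENNReal.ofReal (t ^ (r - 1 - 1))) := by rw [h4]; ring
      _ ≤ _ := by gcongr
  refine (mul_le_mul_right e4 _).trans ?_
  rw [lintegral_const_mul' _ _ (by norm_num)]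
  rw [e2] at e3
  have hr1 : ENNReal.ofReal (r - 1) ≠ 0 := by simpa using hr
  have e5 : ∫⁻ t in Set.Ioi (0 : ℝ), ν {x | t < 2 * (f x).toReal} *
      ENNReal.ofReal (t ^ (r - 1 - 1)) = ENNReal.ofReal ((r - 1)⁻¹) *
        (ENNReal.ofReal (2 ^ (r - 1)) * ∫⁻ x, f x ^ r ∂μ) := by
    rw [e3, ← mul_assoc, ← ENNReal.ofReal_mul (by rw [inv_nonneg]; linarith),
      inv_mul_cancel₀ (by linarith), ENNReal.ofReal_one, one_mul]
  rw [e5]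
  simp only [← mul_assoc]
  refine le_of_eq ?_
  congr 1
  rw [← ENNReal.ofReal_ofNat, ← ENNReal.ofReal_mul hr0.le, ← ENNReal.ofReal_mul (by positivity),
    ← ENNReal.ofReal_mul (by have : 0 ≤ (r - 1)⁻¹ := by { rw [inv_nonneg]; linarith }
                             positivity)]
  congr 1
  rw [Real.rpow_sub_one (by norm_num)]
  field_simp

end Chacon

/-! ### The maximal ergodic theorem in L^r -/

section Maximal

variable {X : Type*} [MeasurableSpace X] {μ : Measure X} {q : ℝ≥0∞} [Fact (1 ≤ q)]
  {B : Type*} [NormedAddCommGroup B] [NormedSpace ℂ B]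

/-- The maximal function of the ergodic averages `n⁻¹ ∑_{k < n} T^k F`, for `1 ≤ n ≤ N`. -/
def ergodicMaximal (T : Lp B q μ →L[ℂ] Lp B q μ) (F : Lp B q μ) (N : ℕ) (x : X) : ℝ≥0∞ :=
  (Finset.Icc 1 N).sup fun n => ‖(∑ k ∈ Finset.range n, (T ^ k) F : Lp B q μ) x‖ₑ / n

lemma aemeasurable_ergodicMaximal (T : Lp B q μ →L[ℂ] Lp B q μ) (F : Lp B q μ) (N : ℕ) :
    AEMeasurable (ergodicMaximal T F N) μ := by
  unfold ergodicMaximal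
  have : (fun x => (Finset.Icc 1 N).sup fun n =>
      ‖(∑ k ∈ Finset.range n, (T ^ k) F : Lp B q μ) x‖ₑ / n) = (Finset.Icc 1 N).sup fun n x =>
      ‖(∑ k ∈ Finset.range n, (T ^ k) F : Lp B q μ) x‖ₑ / (n : ℝ≥0∞) := by
    ext x; rw [Finset.sup_apply]
  rw [this]
  exact Finset.sup_induction (p := fun g : X → ℝ≥0∞ => AEMeasurable g μ) aemeasurable_const
    (fun _ h _ h' => h.sup h') fun n _ => (Lp.aestronglyMeasurable _).enorm.div_const _

/-- The maximal ergodic theorem in `L^r`, for `r > 1`. -/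
lemma lintegral_ergodicMaximal_le {T : Lp B q μ →L[ℂ] Lp B q μ} (hT : IsL1LInftyContraction T)
    (F : Lp B q μ) (N : ℕ) {r : ℝ} (hr : 1 < r) :
    ∫⁻ x, ergodicMaximal T F N x ^ r ∂μ ≤
      ENNReal.ofReal (2 ^ r * (r / (r - 1))) * ∫⁻ x, ‖F x‖ₑ ^ r ∂μ := by
  refine lintegral_rpow_le_of_weak (Lp.aestronglyMeasurable F).enorm
    (aemeasurable_ergodicMaximal T F N) (Eventually.of_forall fun x => enorm_ne_top)
    (Eventually.of_forall fun x => ?_) (fun a ha => ?_) hr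
  · refine ne_of_lt ((Finset.sup_lt_iff (by simp)).2 fun n hn => ?_)
    refine ENNReal.div_lt_top enorm_ne_top ?_
    have := (Finset.mem_Icc.1 hn).1
    simp only [ne_eq, Nat.cast_eq_zero]
    omega
  · refine le_trans ?_ (measure_maximal_le hT ha F N)
    refine mul_le_mul_right (measure_mono fun x hx => ?_) _
    obtain ⟨n, hn, hx⟩ := Finset.lt_sup_iff.1 (show ENNReal.ofReal a < ergodicMaximal T F N x from hx)
    refine ⟨n, (Finset.mem_Icc.1 hn).2, ?_⟩
    have hn1 := (Finset.mem_Icc.1 hn).1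
    rw [ENNReal.lt_div_iff_mul_lt (by simp) (by simp), ← ofReal_norm, ← ENNReal.ofReal_natCast,
      ← ENNReal.ofReal_mul ha.le, ENNReal.ofReal_lt_ofReal_iff_of_nonneg (by positivity)] at hx
    linarith

/-- The constant in the `L^r` maximal inequality. -/
def maximalConst (r : ℝ) : ℝ≥0∞ := ENNReal.ofReal (2 ^ r * (r / (r - 1))) ^ r⁻¹

lemma maximalConst_ne_top {r : ℝ} (hr : 1 < r) : maximalConst r ≠ ∞ :=
  ENNReal.rpow_ne_top_of_nonneg (by rw [inv_nonneg]; linarith) ENNReal.ofReal_ne_top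

lemma eLpNorm_ergodicMaximal_le {T : Lp B q μ →L[ℂ] Lp B q μ} (hT : IsL1LInftyContraction T)
    (F : Lp B q μ) (N : ℕ) {p : ℝ≥0∞} (hp1 : 1 < p) (hp : p < ∞) :
    eLpNorm (ergodicMaximal T F N) p μ ≤ maximalConst p.toReal * eLpNorm F p μ := by
  have hr : 1 < p.toReal := by
    rw [← ENNReal.toReal_one]; exact (ENNReal.toReal_lt_toReal (by simp) hp.ne).2 hp1
  have hr0 : 0 < p.toReal := by linarith
  rw [eLpNorm_eq_lintegral_rpow_enorm_toReal (by positivity) hp.ne,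
    eLpNorm_eq_lintegral_rpow_enorm_toReal (by positivity) hp.ne]
  simp only [enorm_eq_self, one_div]
  rw [maximalConst, ← ENNReal.mul_rpow_of_nonneg _ _ (by positivity)]
  gcongr
  exact lintegral_ergodicMaximal_le hT F N hr

/-- An `L¹`-`L^∞` contraction is bounded for the `L^p` norm. -/
lemma IsL1LInftyContraction.eLpNorm_le {T : Lp B q μ →L[ℂ] Lp B q μ}
    (hT : IsL1LInftyContraction T) (F : Lp B q μ) {p : ℝ≥0∞} (hp1 : 1 < p) (hp : p < ∞) :
    eLpNorm (T F) p μ ≤ (2 * maximalConst p.toReal + 1) * eLpNorm F p μ := by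
  -- T F = (F + T F) - F, and F + T F is twice an average of length 2, so the maximal theorem alone
  -- bounds T on L^p.
  have h1 : ∀ᵐ x ∂μ, ‖T F x‖ₑ ≤ ‖2 * ergodicMaximal T F 2 x + ‖F x‖ₑ‖ₑ := by
    filter_upwards [Lp.coeFn_add F (T F)] with x hx
    rw [enorm_eq_self]
    have h2 : ‖(F + T F : Lp B q μ) x‖ₑ / 2 ≤ ergodicMaximal T F 2 x := by
      have := Finset.le_sup (s := Finset.Icc 1 2)
        (f := fun n => ‖(∑ k ∈ Finset.range n, (T ^ k) F : Lp B q μ) x‖ₑ / (n : ℝ≥0∞))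
        (b := 2) (by simp)
      have h5 : ∑ k ∈ Finset.range 2, (T ^ k) F = F + T F := by
        simp [Finset.sum_range_succ]
      simp only [h5, Nat.cast_ofNat] at this
      exact this
    have h3 : ‖T F x‖ₑ ≤ ‖(F + T F : Lp B q μ) x‖ₑ + ‖F x‖ₑ := by
      rw [hx, Pi.add_apply]
      calc ‖T F x‖ₑ = ‖F x + T F x - F x‖ₑ := by congr 1; abel
        _ ≤ _ := enorm_sub_le
    refine h3.trans ?_
    gcongr
    rwa [mul_comm, ← ENNReal.div_le_iff (by norm_num) (by norm_num)]
  refine (eLpNorm_mono_enorm_ae h1).trans ?_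
  refine (eLpNorm_add_le (((aemeasurable_ergodicMaximal T F 2).const_mul 2).aestronglyMeasurable)
    ((Lp.aestronglyMeasurable F).enorm.aestronglyMeasurable) hp1.le).trans ?_
  rw [add_mul, one_mul, eLpNorm_enorm]
  gcongr
  have h4 : eLpNorm (fun x => 2 * ergodicMaximal T F 2 x) p μ ≤
      2 * eLpNorm (ergodicMaximal T F 2) p μ := by
    have := eLpNorm_le_nnreal_smul_eLpNorm_of_ae_le_mul' (c := 2) (p := p) (μ := μ)
      (f := fun x => 2 * ergodicMaximal T F 2 x) (g := ergodicMaximal T F 2)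
      (Eventually.of_forall fun x => by simp [enorm_eq_self])
    simpa [two_mul, two_smul] using this
  refine h4.trans ?_
  rw [mul_assoc]
  gcongr
  exact eLpNorm_ergodicMaximal_le hT F 2 hp1 hp

end Maximal

/-! ### Comparing operators and functions across different L^q spaces -/

section Consistency

variable {X : Type*} [MeasurableSpace X] {μ : Measure X}
  {E E' : Type*} [NormedAddCommGroup E] [NormedSpace ℂ E] [NormedAddCommGroup E'] [NormedSpace ℂ E']
  {q₁ q₂ r₁ r₂ : ℝ≥0∞} [Fact (1 ≤ q₁)] [Fact (1 ≤ q₂)] [Fact (1 ≤ r₁)] [Fact (1 ≤ r₂)]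

omit [NormedSpace ℂ E] in
-- Both convergences imply convergence in measure, where limits are unique up to null sets.
lemma ae_eq_of_tendsto_Lp {ι : Type*} {l : Filter ι} [l.NeBot] [l.IsCountablyGenerated]
    {f : ι → Lp E q₁ μ} {g : ι → Lp E q₂ μ} {F : Lp E q₁ μ}
    {G : Lp E q₂ μ} (hf : Tendsto f l (𝓝 F)) (hg : Tendsto g l (𝓝 G))
    (h : ∀ n, f n =ᵐ[μ] g n) : F =ᵐ[μ] G :=
  tendstoInMeasure_ae_unique (tendstoInMeasure_of_tendsto_Lp hf)
    ((tendstoInMeasure_of_tendsto_Lp hg).congr_left fun n => (h n).symm)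

/-- Operators on different `L^q` spaces that agree on indicator functions agree on all common
functions. -/
lemma ae_eq_of_indicator (hq₁ : q₁ ≠ ∞) (hq₂ : q₂ ≠ ∞)
    (S₁ : Lp E q₁ μ →L[ℂ] Lp E' r₁ μ) (S₂ : Lp E q₂ μ →L[ℂ] Lp E' r₂ μ)
    (h : ∀ (s : Set X) (hs : MeasurableSet s) (hμs : μ s ≠ ∞) (c : E),
      S₁ (indicatorConstLp q₁ hs hμs c) =ᵐ[μ] S₂ (indicatorConstLp q₂ hs hμs c))
    {f : X → E} (hf₁ : MemLp f q₁ μ) (hf₂ : MemLp f q₂ μ) :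
    S₁ (hf₁.toLp f) =ᵐ[μ] S₂ (hf₂.toLp f) := by
  have hq₁0 : q₁ ≠ 0 := (zero_lt_one.trans_le (Fact.out : 1 ≤ q₁)).ne'
  have hq₂0 : q₂ ≠ 0 := (zero_lt_one.trans_le (Fact.out : 1 ≤ q₂)).ne'
  have simple : ∀ (g : SimpleFunc X E) (h₁ : MemLp g q₁ μ) (h₂ : MemLp g q₂ μ),
      S₁ (h₁.toLp g) =ᵐ[μ] S₂ (h₂.toLp g) := by
    intro g
    induction g using SimpleFunc.induction with
    | @const c s hs =>
      intro h₁ h₂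
      classical
      have hμs : c ≠ 0 → μ s ≠ ∞ := fun hc =>
        (SimpleFunc.measure_lt_top_of_memLp_indicator hq₁0 hq₁ hc hs h₁).ne
      have hfun : ⇑(SimpleFunc.piecewise s hs (SimpleFunc.const X c) (SimpleFunc.const X 0)) =
          s.indicator fun _ => c := by
        rw [SimpleFunc.coe_piecewise, SimpleFunc.coe_const, SimpleFunc.coe_const]
        exact Set.piecewise_eq_indicator
      generalize ⇑(SimpleFunc.piecewise s hs (SimpleFunc.const X c) (SimpleFunc.const X 0)) = g
        at hfun h₁ h₂
      subst hfun
      by_cases hc : c = 0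
      · subst hc
        have e₁ : h₁.toLp _ = 0 :=
          ((MemLp.toLp_eq_toLp_iff h₁ MemLp.zero).2 (by simp; rfl)).trans (MemLp.toLp_zero _)
        have e₂ : h₂.toLp _ = 0 :=
          ((MemLp.toLp_eq_toLp_iff h₂ MemLp.zero).2 (by simp; rfl)).trans (MemLp.toLp_zero _)
        rw [e₁, e₂, map_zero, map_zero]
        exact (Lp.coeFn_zero _ _ _).trans (Lp.coeFn_zero _ _ _).symm
      · exact h s hs (hμs hc) c
    | @add f g hfg hf hg =>
      intro h₁ h₂
      have h₁' := h₁
      have h₂' := h₂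
      rw [SimpleFunc.coe_add, memLp_add_of_disjoint hfg f.stronglyMeasurable
        g.stronglyMeasurable] at h₁' h₂'
      have e₁ : h₁.toLp _ = h₁'.1.toLp _ + h₁'.2.toLp _ := by
        rw [← MemLp.toLp_add]; rfl
      have e₂ : h₂.toLp _ = h₂'.1.toLp _ + h₂'.2.toLp _ := by
        rw [← MemLp.toLp_add]; rfl
      rw [e₁, e₂, map_add, map_add]
      exact (Lp.coeFn_add _ _).trans (((hf _ _).add (hg _ _)).trans (Lp.coeFn_add _ _).symm)
  borelize E
  let f' := hf₁.1.mk f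
  have hff' : f =ᵐ[μ] f' := hf₁.1.ae_eq_mk
  have hf₁' : MemLp f' q₁ μ := hf₁.ae_eq hff'
  have hf₂' : MemLp f' q₂ μ := hf₂.ae_eq hff'
  have e₁ : hf₁.toLp f = hf₁'.toLp f' := (MemLp.toLp_eq_toLp_iff _ _).2 hff'
  have e₂ : hf₂.toLp f = hf₂'.toLp f' := (MemLp.toLp_eq_toLp_iff _ _).2 hff'
  rw [e₁, e₂]
  have f'meas : Measurable f' := hf₁.1.measurable_mk
  have : TopologicalSpace.SeparableSpace (Set.range f' ∪ {0} : Set E) :=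
    StronglyMeasurable.separableSpace_range_union_singleton hf₁.1.stronglyMeasurable_mk
  -- The same simple functions approximate f' in both spaces at once.
  exact ae_eq_of_tendsto_Lp
    ((S₁.continuous.tendsto _).comp (SimpleFunc.tendsto_approxOn_range_Lp hq₁ f'meas hf₁'))
    ((S₂.continuous.tendsto _).comp (SimpleFunc.tendsto_approxOn_range_Lp hq₂ f'meas hf₂'))
    fun n => simple _ _ _

lemma clm_ext_indicator (hq₁ : q₁ ≠ ∞) {S₁ S₂ : Lp E q₁ μ →L[ℂ] Lp E' r₁ μ}
    (h : ∀ (s : Set X) (hs : MeasurableSet s) (hμs : μ s ≠ ∞) (c : E),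
      S₁ (indicatorConstLp q₁ hs hμs c) = S₂ (indicatorConstLp q₁ hs hμs c)) : S₁ = S₂ := by
  ext1 f
  have := ae_eq_of_indicator hq₁ hq₁ S₁ S₂ (fun s hs hμs c => by rw [h s hs hμs c])
    (Lp.memLp f) (Lp.memLp f)
  simpa using Lp.ext this

omit [NormedSpace ℂ E] in
lemma isClosed_ae_norm_le (a : ℝ) : IsClosed {F : Lp E q₁ μ | ∀ᵐ x ∂μ, ‖F x‖ ≤ a} := by
  refine IsSeqClosed.isClosed fun f F hf hF => ?_
  obtain ⟨ns, -, hns⟩ := (tendstoInMeasure_of_tendsto_Lp hF).exists_seq_tendsto_ae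
  filter_upwards [hns, ae_all_iff.2 hf] with x hx h1
  exact le_of_tendsto hx.norm (Eventually.of_forall fun n => h1 _)

/-- A function all of whose images under functionals of norm at most one are bounded by `a` is
bounded by `a`. -/
lemma ae_norm_le_of_forall_dual {f : X → E} (hf : AEStronglyMeasurable f μ) {a : ℝ}
    (h : ∀ φ : E →L[ℂ] ℂ, ‖φ‖ ≤ 1 → ∀ᵐ x ∂μ, ‖φ (f x)‖ ≤ a) : ∀ᵐ x ∂μ, ‖f x‖ ≤ a := by
  obtain ⟨g, hg, hfg⟩ := hf
  obtain ⟨c, hc, hgc⟩ := hg.isSeparable_range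
  choose φ hφ1 hφ2 using fun y : E => exists_dual_vector'' ℂ y
  -- Only the norming functionals of points of the countable set c, whose closure contains the range
  -- of g, are used; the union of the exceptional sets is therefore null.
  have h1 : ∀ᵐ x ∂μ, ∀ y ∈ c, ‖φ y (f x)‖ ≤ a :=
    (ae_ball_iff hc).2 fun y _ => h _ (hφ1 y)
  filter_upwards [h1, hfg] with x hx hxg
  rw [hxg] at hx ⊢
  refine le_of_forall_pos_le_add fun ε hε => ?_
  obtain ⟨y, hy, hyx⟩ := Metric.mem_closure_iff.1 (hgc (Set.mem_range_self x)) (ε / 2) (by linarith)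
  rw [dist_eq_norm] at hyx
  have h2 : ‖g x‖ ≤ ‖y‖ + ‖g x - y‖ := by
    calc ‖g x‖ = ‖y + (g x - y)‖ := by congr 1; abel
      _ ≤ _ := norm_add_le _ _
  have h3 : ‖y‖ ≤ ‖φ y (g x)‖ + ‖g x - y‖ := by
    calc ‖y‖ = ‖φ y y‖ := by rw [hφ2]; simp
      _ = ‖φ y (g x) - φ y (g x - y)‖ := by rw [map_sub]; congr 1; abel
      _ ≤ ‖φ y (g x)‖ + ‖φ y (g x - y)‖ := norm_sub_le _ _
      _ ≤ _ := by
        gcongr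
        exact ((φ y).le_of_opNorm_le (hφ1 y) _).trans (by rw [one_mul])
  have := hx y hy
  linarith

end Consistency

/-! ### Elementary tensors -/

section Tensor

variable {X : Type*} [MeasurableSpace X] {μ : Measure X} {q : ℝ≥0∞} [Fact (1 ≤ q)]
  {B : Type*} [NormedAddCommGroup B] [NormedSpace ℂ B]

omit [Fact (1 ≤ q)] in
lemma coeFn_elemTensor (f : Lp ℂ q μ) (u : B) : elemTensor f u =ᵐ[μ] fun x => f x • u :=
  ContinuousLinearMap.coeFn_compLp' _ _

variable (μ q) in
/-- `f ↦ u f` as a bounded operator. -/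
def tensorLeft (u : B) : Lp ℂ q μ →L[ℂ] Lp B q μ :=
  (ContinuousLinearMap.toSpanSingleton ℂ u).compLpL q μ

lemma tensorLeft_apply (f : Lp ℂ q μ) (u : B) : tensorLeft μ q u f = elemTensor f u := rfl

/-- `u ↦ u f` as a bounded operator. -/
def tensorRight (f : Lp ℂ q μ) : B →L[ℂ] Lp B q μ :=
  LinearMap.mkContinuous
    { toFun := fun u => elemTensor f u
      map_add' := by
        intro u v
        refine Lp.ext ?_
        filter_upwards [coeFn_elemTensor f u, coeFn_elemTensor f v, coeFn_elemTensor f (u + v),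
          Lp.coeFn_add (elemTensor f u) (elemTensor f v)] with x h1 h2 h3 h4
        rw [h3, h4, Pi.add_apply, h1, h2, smul_add]
      map_smul' := by
        intro c u
        refine Lp.ext ?_
        filter_upwards [coeFn_elemTensor f u, coeFn_elemTensor f (c • u),
          Lp.coeFn_smul c (elemTensor f u)] with x h1 h2 h3
        rw [RingHom.id_apply, h2, h3, Pi.smul_apply, h1, smul_comm] }
    ‖f‖ (fun u => by
      refine ((ContinuousLinearMap.toSpanSingleton ℂ u).norm_compLp_le f).trans ?_
      rw [ContinuousLinearMap.norm_toSpanSingleton, mul_comm])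

lemma norm_tensorRight_le (f : Lp ℂ q μ) : ‖(tensorRight f : B →L[ℂ] Lp B q μ)‖ ≤ ‖f‖ :=
  LinearMap.mkContinuous_norm_le _ (norm_nonneg _) _

omit [Fact (1 ≤ q)] in
lemma elemTensor_indicatorConstLp {s : Set X} (hs : MeasurableSet s) (hμs : μ s ≠ ∞) (c : ℂ)
    (u : B) : elemTensor (indicatorConstLp q hs hμs c) u = indicatorConstLp q hs hμs (c • u) := by
  refine Lp.ext ?_
  filter_upwards [coeFn_elemTensor (indicatorConstLp q hs hμs c) u,
    indicatorConstLp_coeFn (p := q) (hs := hs) (hμs := hμs) (c := c),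
    indicatorConstLp_coeFn (p := q) (hs := hs) (hμs := hμs) (c := c • u)] with x h1 h2 h3
  rw [h1, h2, h3]
  by_cases hx : x ∈ s <;> simp [hx]

omit [Fact (1 ≤ q)] in
lemma smul_indicatorConstLp {s : Set X} (hs : MeasurableSet s) (hμs : μ s ≠ ∞) (c : ℂ)
    (u : B) : c • (indicatorConstLp q hs hμs u) = indicatorConstLp q hs hμs (c • u) := by
  refine Lp.ext ?_
  filter_upwards [Lp.coeFn_smul c (indicatorConstLp q hs hμs u),
    indicatorConstLp_coeFn (p := q) (hs := hs) (hμs := hμs) (c := u),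
    indicatorConstLp_coeFn (p := q) (hs := hs) (hμs := hμs) (c := c • u)] with x h1 h2 h3
  rw [h1, h3, Pi.smul_apply, h2]
  by_cases hx : x ∈ s <;> simp [hx]

omit [Fact (1 ≤ q)] in
lemma compLp_indicatorConstLp {E F : Type*} [NormedAddCommGroup E] [NormedSpace ℂ E]
    [NormedAddCommGroup F] [NormedSpace ℂ F] (φ : E →L[ℂ] F)
    {s : Set X} (hs : MeasurableSet s) (hμs : μ s ≠ ∞) (c : E) :
    φ.compLp (indicatorConstLp q hs hμs c) = indicatorConstLp q hs hμs (φ c) := by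
  refine Lp.ext ?_
  filter_upwards [φ.coeFn_compLp (indicatorConstLp q hs hμs c),
    indicatorConstLp_coeFn (p := q) (hs := hs) (hμs := hμs) (c := c),
    indicatorConstLp_coeFn (p := q) (hs := hs) (hμs := hμs) (c := φ c)] with x h1 h2 h3
  rw [h1, h2, h3]
  by_cases hx : x ∈ s <;> simp [hx]

end Tensor

/-! ### Extension from L²(X) to L^p(X, B) -/

section Extension

variable {X : Type*} [MeasurableSpace X] {μ : Measure X} {q p : ℝ≥0∞} [Fact (1 ≤ q)] [Fact (1 ≤ p)]
  {B : Type*} [NormedAddCommGroup B] [NormedSpace ℂ B] {T : Lp ℂ 2 μ →L[ℂ] Lp ℂ 2 μ}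

/-- `T` contracts every `L^q` norm, `1 ≤ q ≤ ∞`. -/
def IsLqContraction (T : Lp ℂ 2 μ →L[ℂ] Lp ℂ 2 μ) : Prop :=
  ∀ q : ℝ≥0∞, 1 ≤ q → ∀ f : Lp ℂ 2 μ, MemLp f q μ → eLpNorm (T f) q μ ≤ eLpNorm f q μ

/-- `S = T ⊗ I` on indicator functions of sets of finite measure. -/
def ExtendsOnIndicators (T : Lp ℂ 2 μ →L[ℂ] Lp ℂ 2 μ) (S : Lp B q μ →L[ℂ] Lp B q μ) : Prop :=
  ∀ (s : Set X) (hs : MeasurableSet s) (hμs : μ s ≠ ∞) (c : B),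
    S (indicatorConstLp q hs hμs c) =ᵐ[μ] fun x => T (indicatorConstLp 2 hs hμs 1) x • c

lemma ExtendsOnIndicators.self : ExtendsOnIndicators T T := by
  intro s hs hμs c
  have : indicatorConstLp 2 hs hμs c = c • indicatorConstLp 2 hs hμs (1 : ℂ) := by
    rw [smul_indicatorConstLp, smul_eq_mul, mul_one]
  rw [this, map_smul]
  filter_upwards [Lp.coeFn_smul c (T (indicatorConstLp 2 hs hμs (1 : ℂ)))] with x hx
  rw [hx, Pi.smul_apply, smul_eq_mul, smul_eq_mul, mul_comm]

lemma ExtendsOnIndicators.eq (hq : q ≠ ∞) {S S' : Lp B q μ →L[ℂ] Lp B q μ}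
    (h : ExtendsOnIndicators T S) (h' : ExtendsOnIndicators T S') : S = S' :=
  clm_ext_indicator hq fun s hs hμs c => Lp.ext ((h s hs hμs c).trans (h' s hs hμs c).symm)

/-- Extensions to different spaces agree on common functions. -/
lemma ExtendsOnIndicators.ae_eq (hq : q ≠ ∞) (hp : p ≠ ∞) {S : Lp B q μ →L[ℂ] Lp B q μ}
    {S' : Lp B p μ →L[ℂ] Lp B p μ} (h : ExtendsOnIndicators T S) (h' : ExtendsOnIndicators T S')
    (F : Lp B q μ) (G : Lp B p μ) (hFG : F =ᵐ[μ] G) : S F =ᵐ[μ] S' G := by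
  have hF : MemLp F p μ := (Lp.memLp G).ae_eq hFG.symm
  have := ae_eq_of_indicator hq hp S S'
    (fun s hs hμs c => (h s hs hμs c).trans (h' s hs hμs c).symm) (Lp.memLp F) hF
  rw [Lp.toLp_coeFn] at this
  rwa [show hF.toLp F = G from Lp.ext (hF.coeFn_toLp.trans hFG)] at this

omit [Fact (1 ≤ q)] in
lemma IsLqContraction.memLp_indicator (hT : IsLqContraction T) (hq : 1 ≤ q)
    {s : Set X} (hs : MeasurableSet s) (hμs : μ s ≠ ∞) :
    MemLp (T (indicatorConstLp 2 hs hμs (1 : ℂ))) q μ := by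
  have h : MemLp (indicatorConstLp 2 hs hμs (1 : ℂ)) q μ :=
    (memLp_indicator_const q hs (1 : ℂ) (Or.inr hμs)).ae_eq indicatorConstLp_coeFn.symm
  exact ⟨Lp.aestronglyMeasurable _, (hT q hq _ h).trans_lt h.2⟩

open Classical in
/-- The image of the indicator function of `s`, as an element of `L^q`. -/
def indicatorImage (q : ℝ≥0∞) (T : Lp ℂ 2 μ →L[ℂ] Lp ℂ 2 μ) (s : Set X) : Lp ℂ q μ :=
  if h : ∃ (hs : MeasurableSet s) (hμs : μ s ≠ ∞),
      MemLp (T (indicatorConstLp 2 hs hμs (1 : ℂ))) q μ then h.choose_spec.choose_spec.toLp _ else 0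

omit [Fact (1 ≤ q)] in
lemma IsLqContraction.coeFn_indicatorImage (hT : IsLqContraction T) (hq : 1 ≤ q)
    {s : Set X} (hs : MeasurableSet s) (hμs : μ s ≠ ∞) :
    indicatorImage q T s =ᵐ[μ] T (indicatorConstLp 2 hs hμs (1 : ℂ)) := by
  have h : ∃ (hs : MeasurableSet s) (hμs : μ s ≠ ∞),
      MemLp (T (indicatorConstLp 2 hs hμs (1 : ℂ))) q μ := ⟨hs, hμs, hT.memLp_indicator hq hs hμs⟩
  rw [indicatorImage, dif_pos h]
  exact MemLp.coeFn_toLp _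

/-- On L¹ every Banach space B is allowed: s ↦ (u ↦ u T1_s) is an additive set function with norm at
most μ(s), because T contracts L¹, and `L1.setToL1` extends it to an operator. -/
lemma IsLqContraction.dominated (hT : IsLqContraction T) : DominatedFinMeasAdditive μ
    (fun s => (tensorRight (indicatorImage 1 T s) : B →L[ℂ] Lp B 1 μ).restrictScalars ℝ) 1 := by
  refine ⟨fun s t hs ht hμs hμt hst => ?_, fun s hs hμs => ?_⟩
  · have hμst : μ (s ∪ t) ≠ ∞ := measure_union_ne_top hμs hμt
    have h : indicatorImage 1 T (s ∪ t) = indicatorImage 1 T s + indicatorImage 1 T t := by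
      refine Lp.ext ?_
      have e := indicatorConstLp_disjoint_union (p := 2) hs ht hμs hμt hst (1 : ℂ)
      have e' := congrArg T e
      rw [map_add] at e'
      filter_upwards [hT.coeFn_indicatorImage le_rfl hs hμs,
        hT.coeFn_indicatorImage le_rfl ht hμt,
        hT.coeFn_indicatorImage le_rfl (hs.union ht) hμst,
        Lp.coeFn_add (indicatorImage 1 T s) (indicatorImage 1 T t),
        Lp.coeFn_add (T (indicatorConstLp 2 hs hμs (1 : ℂ)))
          (T (indicatorConstLp 2 ht hμt (1 : ℂ)))] with x h1 h2 h3 h4 h5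
      rw [h3, h4, Pi.add_apply, h1, h2, e', h5, Pi.add_apply]
    ext1 u
    change elemTensor (indicatorImage 1 T (s ∪ t)) u =
      elemTensor (indicatorImage 1 T s) u + elemTensor (indicatorImage 1 T t) u
    rw [h, ← tensorLeft_apply, map_add]
    rfl
  · rw [ContinuousLinearMap.norm_restrictScalars]
    refine (norm_tensorRight_le _).trans ?_
    have hμs' := hμs.ne
    have h : MemLp (indicatorConstLp 2 hs hμs' (1 : ℂ)) 1 μ :=
      (memLp_indicator_const 1 hs (1 : ℂ) (Or.inr hμs')).ae_eq indicatorConstLp_coeFn.symm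
    rw [Lp.norm_def, eLpNorm_congr_ae (hT.coeFn_indicatorImage le_rfl hs hμs'), one_mul,
      Measure.real]
    refine ENNReal.toReal_mono hμs' ((hT 1 le_rfl _ h).trans ?_)
    rw [eLpNorm_congr_ae indicatorConstLp_coeFn, eLpNorm_indicator_const hs one_ne_zero (by simp)]
    simp

omit [Fact (1 ≤ p)] [NormedSpace ℂ B] in
lemma memLp_of_memLp_one_of_bound {f : X → B} (hf : MemLp f 1 μ) {a : ℝ}
    (ha : ∀ᵐ x ∂μ, ‖f x‖ ≤ a) (hp1 : 1 ≤ p) (hp : p ≠ ∞) : MemLp f p μ := by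
  have hr : 1 ≤ p.toReal := by
    rw [← ENNReal.toReal_one]; exact ENNReal.toReal_mono hp hp1
  refine ⟨hf.1, (eLpNorm_lt_top_iff_lintegral_rpow_enorm_lt_top
    (zero_lt_one.trans_le hp1).ne' hp).2 ?_⟩
  have h1 : ∫⁻ x, ‖f x‖ₑ ∂μ < ∞ := by
    rw [← eLpNorm_one_eq_lintegral_enorm]; exact hf.2
  refine lt_of_le_of_lt (lintegral_mono_ae (g := fun x =>
    ENNReal.ofReal a ^ (p.toReal - 1) * ‖f x‖ₑ) ?_) ?_
  · filter_upwards [ha] with x hx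
    conv_lhs => rw [show p.toReal = (p.toReal - 1) + 1 by ring,
      ENNReal.rpow_add_of_nonneg _ _ (by linarith) (by norm_num), ENNReal.rpow_one]
    have hx' : ‖f x‖ₑ ≤ ENNReal.ofReal a := by
      rw [← ofReal_norm]; exact ENNReal.ofReal_le_ofReal hx
    exact mul_le_mul_left (ENNReal.rpow_le_rpow hx' (by linarith)) _
  · rw [lintegral_const_mul' _ _ (ENNReal.rpow_ne_top_of_nonneg (by linarith)
      ENNReal.ofReal_ne_top)]
    exact ENNReal.mul_lt_top (ENNReal.rpow_lt_top_of_nonneg (by linarith)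
      ENNReal.ofReal_ne_top) h1

variable [CompleteSpace B]

lemma IsLqContraction.exists_L1_extension (hT : IsLqContraction T) :
    ∃ S : Lp B 1 μ →L[ℂ] Lp B 1 μ, (∀ F, ‖S F‖ ≤ ‖F‖) ∧ ExtendsOnIndicators T S := by
  have hsmul : ∀ (c : ℂ) (s : Set X) (u : B),
      (tensorRight (indicatorImage 1 T s) : B →L[ℂ] Lp B 1 μ).restrictScalars ℝ (c • u) =
        c • (tensorRight (indicatorImage 1 T s) : B →L[ℂ] Lp B 1 μ).restrictScalars ℝ u :=
    fun c s u => (tensorRight (indicatorImage 1 T s)).map_smul c u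
  refine ⟨L1.setToL1' ℂ hT.dominated hsmul, fun F => ?_, fun s hs hμs c => ?_⟩
  · rw [← L1.setToL1_eq_setToL1' hT.dominated hsmul]
    exact (L1.norm_setToL1_le_mul_norm hT.dominated zero_le_one F).trans (by rw [one_mul])
  · rw [← L1.setToL1_eq_setToL1' hT.dominated hsmul, L1.setToL1_indicatorConstLp hT.dominated]
    refine (coeFn_elemTensor (indicatorImage 1 T s) c).trans ?_
    filter_upwards [hT.coeFn_indicatorImage le_rfl hs hμs] with x hx
    rw [hx]

/-- The L^∞ bound reduces to scalars. A functional φ of norm at most one intertwines S with the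
scalar extension, and φ ∘ F lies in L¹ ∩ L^∞, hence in L², where the scalar extension is T itself.
-/
lemma IsLqContraction.isL1LInftyContraction_L1 (hT : IsLqContraction T)
    {S : Lp B 1 μ →L[ℂ] Lp B 1 μ} (hS : ExtendsOnIndicators T S) : IsL1LInftyContraction S := by
  have hS1 : ∀ F, ‖S F‖ ≤ ‖F‖ := by
    obtain ⟨S', h1, h2⟩ := hT.exists_L1_extension (B := B)
    rwa [hS.eq ENNReal.one_ne_top h2]
  refine ⟨fun F => ?_, fun F a ha hF => ?_⟩
  · have := hS1 F
    rw [Lp.norm_def, Lp.norm_def, ENNReal.toReal_le_toReal (Lp.eLpNorm_ne_top _)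
      (Lp.eLpNorm_ne_top _), eLpNorm_one_eq_lintegral_enorm, eLpNorm_one_eq_lintegral_enorm] at this
    exact this
  · obtain ⟨Sc, -, hSc⟩ := hT.exists_L1_extension (B := ℂ)
    refine ae_norm_le_of_forall_dual (Lp.aestronglyMeasurable _) fun φ hφ => ?_
    have comm : (φ.compLpL 1 μ).comp S = Sc.comp (φ.compLpL 1 μ) := by
      refine clm_ext_indicator ENNReal.one_ne_top fun s hs hμs c => Lp.ext ?_
      change φ.compLp (S _) =ᵐ[μ] Sc (φ.compLp _)
      rw [compLp_indicatorConstLp]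
      filter_upwards [φ.coeFn_compLp (S (indicatorConstLp 1 hs hμs c)), hS s hs hμs c,
        hSc s hs hμs (φ c)] with x h1 h2 h3
      rw [h1, h2, h3, map_smul]
    have comm' : φ.compLp (S F) = Sc (φ.compLp F) := congrArg (fun A => A F) comm
    have hb : ∀ᵐ x ∂μ, ‖φ.compLp F x‖ ≤ a := by
      filter_upwards [φ.coeFn_compLp F, hF] with x h1 h2
      rw [h1]
      exact (φ.le_of_opNorm_le hφ _).trans (by rwa [one_mul])
    have hinf : MemLp (φ.compLp F) ∞ μ :=
      memLp_top_of_bound (Lp.aestronglyMeasurable _) a hb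
    have h2 : MemLp (φ.compLp F) 2 μ :=
      memLp_of_memLp_one_of_bound (Lp.memLp (φ.compLp F)) hb (by norm_num) (by simp)
    have e := hSc.ae_eq ENNReal.one_ne_top (by simp) .self (φ.compLp F) (h2.toLp _)
      h2.coeFn_toLp.symm
    have hinf' : MemLp (h2.toLp _) ∞ μ := hinf.ae_eq h2.coeFn_toLp.symm
    have h3 : eLpNorm (T (h2.toLp _)) ∞ μ ≤ ENNReal.ofReal a := by
      refine (hT ∞ le_top _ hinf').trans ?_
      rw [eLpNorm_congr_ae h2.coeFn_toLp]
      exact eLpNormEssSup_le_of_ae_bound hb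
    have h4 : ∀ᵐ x ∂μ, ‖T (h2.toLp _) x‖ₑ ≤ ENNReal.ofReal a := by
      filter_upwards [enorm_ae_le_eLpNormEssSup (T (h2.toLp _)) μ] with x hx
      exact hx.trans h3
    filter_upwards [h4, e, φ.coeFn_compLp (S F)] with x h5 h6 h7
    rw [← h7, comm', h6]
    rwa [← ofReal_norm, ENNReal.ofReal_le_ofReal_iff ha] at h5

/-- The constant in the `L^p` bounds of `L¹`-`L^∞` contractions. -/
def lpConst (p : ℝ≥0∞) : ℝ≥0∞ := 2 * maximalConst p.toReal + 1

omit [Fact (1 ≤ p)] in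
lemma lpConst_ne_top (hp1 : 1 < p) (hp : p < ∞) : lpConst p ≠ ∞ := by
  have hr : 1 < p.toReal := by
    rw [← ENNReal.toReal_one]; exact (ENNReal.toReal_lt_toReal (by simp) hp.ne).2 hp1
  exact ENNReal.add_ne_top.2 ⟨ENNReal.mul_ne_top (by simp) (maximalConst_ne_top hr), by simp⟩

variable (B) in
-- The dense subspace L¹ ∩ L^p is invariant under the L¹ extension, which is bounded there in the
-- L^p norm by the maximal theorem.
lemma IsLqContraction.exists_Lp_extension (hT : IsLqContraction T) (hp1 : 1 < p) (hp : p < ∞) :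
    ∃ S : Lp B p μ →L[ℂ] Lp B p μ, ExtendsOnIndicators T S := by
  obtain ⟨S₁, -, hS₁⟩ := hT.exists_L1_extension (B := B)
  have hc := hT.isL1LInftyContraction_L1 hS₁
  have hmem : ∀ F : Lp B 1 μ, MemLp F p μ → MemLp (S₁ F) p μ := fun F hF =>
    ⟨Lp.aestronglyMeasurable _, (hc.eLpNorm_le F hp1 hp).trans_lt
      (ENNReal.mul_lt_top (lpConst_ne_top hp1 hp).lt_top hF.2)⟩
  let V : Submodule ℂ (Lp B 1 μ) :=
    { carrier := {F | MemLp F p μ}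
      add_mem' := fun {F G} hF hG => (hF.add hG).ae_eq (Lp.coeFn_add F G).symm
      zero_mem' := (MemLp.zero (ε := B)).ae_eq (Lp.coeFn_zero B 1 μ).symm
      smul_mem' := fun c F hF => (hF.const_smul c).ae_eq (Lp.coeFn_smul c F).symm }
  let e : V →ₗ[ℂ] Lp B p μ :=
    { toFun := fun F => F.2.toLp _
      map_add' := fun F G => by
        rw [← MemLp.toLp_add, MemLp.toLp_eq_toLp_iff]
        exact Lp.coeFn_add (F : Lp B 1 μ) G
      map_smul' := fun c F => by
        rw [RingHom.id_apply, ← MemLp.toLp_const_smul, MemLp.toLp_eq_toLp_iff]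
        exact Lp.coeFn_smul c (F : Lp B 1 μ) }
  let f : V →ₗ[ℂ] V := (S₁ : Lp B 1 μ →ₗ[ℂ] Lp B 1 μ).restrict fun F hF => hmem F hF
  have hind : ∀ {s : Set X} (hs : MeasurableSet s) (hμs : μ s ≠ ∞) (c : B),
      ∃ v : V, (v : Lp B 1 μ) = indicatorConstLp 1 hs hμs c ∧ e v = indicatorConstLp p hs hμs c := by
    intro s hs hμs c
    have hm : MemLp (indicatorConstLp 1 hs hμs c) p μ :=
      (memLp_indicator_const p hs c (Or.inr hμs)).ae_eq indicatorConstLp_coeFn.symm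
    exact ⟨⟨_, hm⟩, rfl, Lp.ext (hm.coeFn_toLp.trans
      (indicatorConstLp_coeFn.trans indicatorConstLp_coeFn.symm))⟩
  have hdense : DenseRange e := by
    have : ∀ F : Lp B p μ, F ∈ (LinearMap.range e).topologicalClosure := by
      intro F
      refine Lp.induction hp.ne (motive := fun F => F ∈ (LinearMap.range e).topologicalClosure)
        ?_ ?_ ?_ F
      · intro c s hs hμs
        obtain ⟨v, -, hv⟩ := hind hs hμs.ne c
        rw [Lp.simpleFunc.coe_indicatorConst, ← hv]
        exact subset_closure (LinearMap.mem_range_self e v)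
      · intro f g hf hg _ h1 h2
        exact add_mem h1 h2
      · exact (LinearMap.range e).isClosed_topologicalClosure
    intro F
    exact this F
  have hnorm : ∀ v, ‖e.comp f v‖ ≤ (lpConst p).toReal * ‖e v‖ := by
    intro v
    change ‖(hmem v v.2).toLp _‖ ≤ _ * ‖v.2.toLp _‖
    rw [Lp.norm_toLp, Lp.norm_toLp, ← ENNReal.toReal_mul]
    exact ENNReal.toReal_mono (ENNReal.mul_ne_top (lpConst_ne_top hp1 hp) v.2.2.ne)
      (hc.eLpNorm_le _ hp1 hp)
  refine ⟨(e.comp f).extendOfNorm e, fun s hs hμs c => ?_⟩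
  obtain ⟨v, hv1, hv2⟩ := hind hs hμs c
  rw [← hv2, LinearMap.extendOfNorm_eq hdense ⟨_, hnorm⟩]
  refine (MemLp.coeFn_toLp (hmem v v.2)).trans ?_
  rw [hv1]
  exact hS₁ s hs hμs c

lemma IsLqContraction.isL1LInftyContraction (hT : IsLqContraction T) (hp : p < ∞)
    {S : Lp B p μ →L[ℂ] Lp B p μ} (hS : ExtendsOnIndicators T S) : IsL1LInftyContraction S := by
  obtain ⟨S₁, -, hS₁⟩ := hT.exists_L1_extension (B := B)
  have hc := hT.isL1LInftyContraction_L1 hS₁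
  refine ⟨fun F => ?_, fun F a ha hF => ?_⟩
  · by_cases h : ∫⁻ x, ‖F x‖ₑ ∂μ = ∞
    · rw [h]; exact le_top
    have hm : MemLp F 1 μ :=
      ⟨Lp.aestronglyMeasurable _, by rw [eLpNorm_one_eq_lintegral_enorm]; exact Ne.lt_top h⟩
    have e := hS₁.ae_eq ENNReal.one_ne_top hp.ne hS (hm.toLp _) F hm.coeFn_toLp
    have e1 : ∫⁻ x, ‖S F x‖ₑ ∂μ = ∫⁻ x, ‖S₁ (hm.toLp _) x‖ₑ ∂μ :=
      lintegral_congr_ae (e.symm.fun_comp fun b => ‖b‖ₑ)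
    have e2 : ∫⁻ x, ‖F x‖ₑ ∂μ = ∫⁻ x, ‖hm.toLp _ x‖ₑ ∂μ :=
      lintegral_congr_ae (hm.coeFn_toLp.symm.fun_comp fun b => ‖b‖ₑ)
    rw [e1, e2]
    exact hc.lintegral_le _
  -- F need not be in L¹. Restricting it to sets of finite measure keeps the bound a and makes it
  -- integrable, so the result on L¹ applies; the bound survives the limit in L^p.
  · have happ : ∀ n : ℕ, ∃ s : Set X, MeasurableSet s ∧ μ s < ∞ ∧
        eLpNorm (sᶜ.indicator F) p μ < ENNReal.ofReal (1 / (n + 1)) := fun n =>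
      (Lp.memLp F).exists_eLpNorm_indicator_compl_lt hp.ne (by simp; positivity)
    choose s hs hμs hsF using happ
    have hm : ∀ n, MemLp ((s n).indicator F) p μ := fun n => (Lp.memLp F).indicator (hs n)
    have hb : ∀ n, ∀ᵐ x ∂μ, ‖(s n).indicator F x‖ ≤ (s n).indicator (fun _ => a) x := by
      intro n
      filter_upwards [hF] with x hx
      by_cases hxs : x ∈ s n <;> simp [hxs, hx]
    have hm1 : ∀ n, MemLp ((s n).indicator F) 1 μ := fun n =>
      (memLp_indicator_const 1 (hs n) a (Or.inr (hμs n).ne)).mono' (hm n).1 (hb n)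
    have hlim : Tendsto (fun n => (hm n).toLp _) atTop (𝓝 F) := by
      rw [Lp.tendsto_Lp_iff_tendsto_eLpNorm']
      have h0 : Tendsto (fun n : ℕ => ENNReal.ofReal (1 / ((n : ℝ) + 1))) atTop (𝓝 0) := by
        rw [← ENNReal.ofReal_zero]
        exact ENNReal.tendsto_ofReal tendsto_one_div_add_atTop_nhds_zero_nat
      refine tendsto_of_tendsto_of_tendsto_of_le_of_le tendsto_const_nhds h0
        (fun _ => zero_le) fun n => le_of_eq_of_le ?_ (hsF n).le
      rw [← eLpNorm_neg]
      refine eLpNorm_congr_ae ?_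
      filter_upwards [(hm n).coeFn_toLp] with x hx
      rw [Pi.neg_apply, Pi.sub_apply, hx]
      by_cases hxs : x ∈ s n <;> simp [hxs]
    refine (isClosed_ae_norm_le (q₁ := p) a).mem_of_tendsto ((S.continuous.tendsto _).comp hlim)
      (Eventually.of_forall fun n => ?_)
    have e := hS₁.ae_eq ENNReal.one_ne_top hp.ne hS ((hm1 n).toLp _) ((hm n).toLp _)
      ((hm1 n).coeFn_toLp.trans (hm n).coeFn_toLp.symm)
    have hb1 : ∀ᵐ x ∂μ, ‖(hm1 n).toLp _ x‖ ≤ a := by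
      filter_upwards [(hm1 n).coeFn_toLp, hb n] with x h1 h2
      rw [h1]
      exact h2.trans (Set.indicator_le_self' (fun _ _ => ha) x)
    filter_upwards [e, hc.bound _ ha hb1] with x h1 h2
    change ‖S ((hm n).toLp _) x‖ ≤ a
    rwa [← h1]

omit [CompleteSpace B] in
lemma IsL1LInftyContraction.norm_apply_le {S : Lp B p μ →L[ℂ] Lp B p μ}
    (hS : IsL1LInftyContraction S) (hp1 : 1 < p) (hp : p < ∞) (F : Lp B p μ) :
    ‖S F‖ ≤ (lpConst p).toReal * ‖F‖ := by
  rw [Lp.norm_def, Lp.norm_def, ← ENNReal.toReal_mul]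
  exact ENNReal.toReal_mono (ENNReal.mul_ne_top (lpConst_ne_top hp1 hp) (Lp.eLpNorm_ne_top _))
    (hS.eLpNorm_le _ hp1 hp)

omit [CompleteSpace B] in
lemma IsLqContraction.isLpExtension_lpExtension (hT : IsLqContraction T) (hp1 : 1 < p)
    (hp : p < ∞) : IsLpExtension T (lpExtension p T) := by
  have h : ∃ S : Lp ℂ p μ →L[ℂ] Lp ℂ p μ, IsLpExtension T S := by
    obtain ⟨S, hS⟩ := hT.exists_Lp_extension ℂ hp1 hp
    exact ⟨S, fun f g hfg => ExtendsOnIndicators.self.ae_eq (by simp) hp.ne hS f g hfg⟩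
  rw [lpExtension, dif_pos h]
  exact h.choose_spec

omit [CompleteSpace B] in
lemma IsLpExtension.extendsOnIndicators {S : Lp ℂ p μ →L[ℂ] Lp ℂ p μ} (h : IsLpExtension T S) :
    ExtendsOnIndicators T S := by
  intro s hs hμs c
  refine (h (indicatorConstLp 2 hs hμs c) (indicatorConstLp p hs hμs c)
    (indicatorConstLp_coeFn.trans indicatorConstLp_coeFn.symm)).symm.trans ?_
  exact ExtendsOnIndicators.self s hs hμs c

variable (B) in
-- Existence shows that `tensorExtension` does not take its default value 0. It is checked on
-- indicators, where both sides are multiples of the same image.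
lemma IsLqContraction.isTensorExtension (hT : IsLqContraction T) (hp1 : 1 < p) (hp : p < ∞) :
    IsTensorExtension (lpExtension p T) (tensorExtension B (lpExtension p T)) := by
  have hS := (hT.isLpExtension_lpExtension hp1 hp).extendsOnIndicators
  have h : ∃ S : Lp B p μ →L[ℂ] Lp B p μ, IsTensorExtension (lpExtension p T) S := by
    obtain ⟨S, hS'⟩ := hT.exists_Lp_extension B hp1 hp
    refine ⟨S, fun f u => ?_⟩
    have : S.comp (tensorLeft μ p u) = (tensorLeft μ p u).comp (lpExtension p T) := by
      refine clm_ext_indicator hp.ne fun s hs hμs c => Lp.ext ?_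
      change S (elemTensor _ u) =ᵐ[μ] elemTensor (lpExtension p T _) u
      rw [elemTensor_indicatorConstLp]
      filter_upwards [hS' s hs hμs (c • u), hS s hs hμs c,
        coeFn_elemTensor (lpExtension p T (indicatorConstLp p hs hμs c)) u] with x h1 h2 h3
      rw [h1, h3, h2, smul_assoc]
    exact congrArg (fun A => A f) this
  rw [tensorExtension, dif_pos h]
  exact h.choose_spec

variable (B) in
lemma IsLqContraction.extendsOnIndicators_tensorExtension (hT : IsLqContraction T) (hp1 : 1 < p)
    (hp : p < ∞) : ExtendsOnIndicators T (tensorExtension B (lpExtension p T)) := by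
  intro s hs hμs c
  have h1 := hT.isTensorExtension B hp1 hp (indicatorConstLp p hs hμs 1) c
  rw [elemTensor_indicatorConstLp, one_smul] at h1
  rw [h1]
  have hS := (hT.isLpExtension_lpExtension hp1 hp).extendsOnIndicators s hs hμs 1
  filter_upwards [coeFn_elemTensor (lpExtension p T (indicatorConstLp p hs hμs 1)) c, hS]
    with x h2 h3
  rw [h2, h3, smul_eq_mul, mul_one]

end Extension

/-! ### From L² convergence to L^p convergence under L¹ and L^∞ bounds -/

section Interpolation

variable {X : Type*} [MeasurableSpace X] {μ : Measure X} {p : ℝ≥0∞}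
  {B : Type*} [NormedAddCommGroup B]

/-- Below δ = ε^{1/(r-1)} the factor x^{r-1} is at most ε; above δ one has x²/δ² ≥ 1 and x^r ≤
|b|^r. This treats exponents below and above 2 alike. -/
lemma exists_rpow_le_linear_add_sq {r : ℝ} (hr : 1 < r) {b ε : ℝ} (hε : 0 < ε) :
    ∃ C : ℝ, 0 ≤ C ∧ ∀ x, 0 ≤ x → x ≤ b → x ^ r ≤ ε * x + C * x ^ 2 := by
  set δ := ε ^ (1 / (r - 1)) with hδ
  have hδ0 : 0 < δ := by positivity
  refine ⟨|b| ^ r / δ ^ 2, by positivity, fun x hx hxb => ?_⟩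
  rcases le_or_gt x δ with h | h
  · have h1 : x ^ r = x ^ (r - 1) * x := by
      rcases hx.eq_or_lt with rfl | hx
      · rw [Real.zero_rpow (by linarith), mul_zero]
      · rw [Real.rpow_sub_one hx.ne']; field_simp
    have h2 : x ^ (r - 1) ≤ ε := by
      calc x ^ (r - 1) ≤ δ ^ (r - 1) := Real.rpow_le_rpow hx h (by linarith)
        _ = ε := by
          rw [hδ, ← Real.rpow_mul hε.le, one_div, inv_mul_cancel₀ (by linarith), Real.rpow_one]
    rw [h1]
    have : 0 ≤ |b| ^ r / δ ^ 2 * x ^ 2 := by positivity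
    nlinarith
  · have h1 : x ^ r ≤ |b| ^ r := Real.rpow_le_rpow hx (hxb.trans (le_abs_self b)) (by linarith)
    have h2 : 1 ≤ x ^ 2 / δ ^ 2 := by
      rw [one_le_div (by positivity)]
      exact pow_le_pow_left₀ hδ0.le h.le 2
    calc x ^ r ≤ |b| ^ r := h1
      _ ≤ |b| ^ r * (x ^ 2 / δ ^ 2) := le_mul_of_one_le_right (by positivity) h2
      _ = |b| ^ r / δ ^ 2 * x ^ 2 := by ring
      _ ≤ _ := le_add_of_nonneg_left (by positivity)

/-- Convergence to zero in `L²` together with bounds in `L¹` and `L^∞` gives convergence to zero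
in `L^p`, for `1 < p < ∞`. -/
lemma tendsto_eLpNorm_zero_of_bounds {κ : Type*} {l : Filter κ} {g : κ → X → B}
    (hg : ∀ k, AEStronglyMeasurable (g k) μ) {A : ℝ≥0∞} (hA : A ≠ ∞)
    (h1 : ∀ k, eLpNorm (g k) 1 μ ≤ A) {b : ℝ} (hb : ∀ k, ∀ᵐ x ∂μ, ‖g k x‖ ≤ b)
    (h2 : Tendsto (fun k => eLpNorm (g k) 2 μ) l (𝓝 0)) (hp1 : 1 < p) (hp : p < ∞) :
    Tendsto (fun k => eLpNorm (g k) p μ) l (𝓝 0) := by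
  have hr : 1 < p.toReal := by
    rw [← ENNReal.toReal_one]; exact (ENNReal.toReal_lt_toReal (by simp) hp.ne).2 hp1
  have hr0 : 0 < p.toReal := by linarith
  have key : Tendsto (fun k => ∫⁻ x, ‖g k x‖ₑ ^ p.toReal ∂μ) l (𝓝 0) := by
    rw [ENNReal.tendsto_nhds_zero]
    intro η hη
    -- The linear term meets only the uniform L¹ bound A, so its coefficient must be small; the
    -- quadratic term tends to 0 whatever its coefficient.
    obtain ⟨ε, hε, hεη⟩ : ∃ ε : ℝ, 0 < ε ∧ ENNReal.ofReal ε * A ≤ η / 2 := by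
      rcases eq_or_ne η ∞ with rfl | hη'
      · exact ⟨1, one_pos, by simp [ENNReal.top_div]⟩
      have hη2 : 0 < (η / 2).toReal := ENNReal.toReal_pos (by simpa using hη.ne')
        (ENNReal.div_ne_top hη' (by simp))
      refine ⟨(η / 2).toReal / (A.toReal + 1), by positivity, ?_⟩
      rw [← ENNReal.ofReal_toReal hA, ← ENNReal.ofReal_mul (by positivity)]
      rw [ENNReal.ofReal_toReal hA]
      refine (ENNReal.ofReal_le_ofReal (q := (η / 2).toReal) ?_).trans ENNReal.ofReal_toReal_le
      rw [div_mul_eq_mul_div, div_le_iff₀ (by positivity)]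
      nlinarith [ENNReal.toReal_nonneg (a := A)]
    obtain ⟨C, hC, hxC⟩ := exists_rpow_le_linear_add_sq hr (b := b) hε
    have h3 : Tendsto (fun k => ENNReal.ofReal C * (eLpNorm (g k) 2 μ) ^ 2) l (𝓝 0) := by
      have := ENNReal.Tendsto.const_mul (a := ENNReal.ofReal C) (ENNReal.Tendsto.pow (n := 2) h2)
        (Or.inr ENNReal.ofReal_ne_top)
      simpa using this
    have hη2 : 0 < η / 2 := ENNReal.half_pos hη.ne'
    filter_upwards [(ENNReal.tendsto_nhds_zero.1 h3) (η / 2) hη2] with k hk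
    have e2 : (eLpNorm (g k) 2 μ) ^ 2 = ∫⁻ x, ‖g k x‖ₑ ^ 2 ∂μ := by
      rw [eLpNorm_eq_lintegral_rpow_enorm_toReal (by simp) (by simp), ← ENNReal.rpow_natCast,
        ← ENNReal.rpow_mul]
      simp
    calc ∫⁻ x, ‖g k x‖ₑ ^ p.toReal ∂μ
        ≤ ∫⁻ x, (ENNReal.ofReal ε * ‖g k x‖ₑ + ENNReal.ofReal C * ‖g k x‖ₑ ^ 2) ∂μ := by
          refine lintegral_mono_ae ?_
          filter_upwards [hb k] with x hx
          rw [← ofReal_norm, ENNReal.ofReal_rpow_of_nonneg (norm_nonneg _) hr0.le,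
            ← ENNReal.ofReal_pow (norm_nonneg _), ← ENNReal.ofReal_mul hε.le,
            ← ENNReal.ofReal_mul hC, ← ENNReal.ofReal_add (by positivity) (by positivity)]
          exact ENNReal.ofReal_le_ofReal (hxC _ (norm_nonneg _) hx)
      _ = ENNReal.ofReal ε * ∫⁻ x, ‖g k x‖ₑ ∂μ + ENNReal.ofReal C * ∫⁻ x, ‖g k x‖ₑ ^ 2 ∂μ := by
          rw [lintegral_add_left' ((hg k).enorm.const_mul _),
            lintegral_const_mul' _ _ ENNReal.ofReal_ne_top,
            lintegral_const_mul' _ _ ENNReal.ofReal_ne_top]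
      _ ≤ η / 2 + η / 2 := by
          gcongr
          · rw [← eLpNorm_one_eq_lintegral_enorm]
            exact (mul_le_mul_right (h1 k) _).trans hεη
          · rwa [← e2]
      _ = η := ENNReal.add_halves η
  have := (ENNReal.continuous_rpow_const (y := 1 / p.toReal)).tendsto 0 |>.comp key
  rw [ENNReal.zero_rpow_of_pos (by positivity)] at this
  refine this.congr fun k => ?_
  rw [eLpNorm_eq_lintegral_rpow_enorm_toReal (by positivity) hp.ne]
  rfl

end Interpolation

/-! ### Products, averages and limits of the extensions -/

section Convergence

variable {X : Type*} [MeasurableSpace X] {μ : Measure X} {p : ℝ≥0∞} [Fact (1 ≤ p)]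
  {B : Type*} [NormedAddCommGroup B] [NormedSpace ℂ B]
  {T T' : Lp ℂ 2 μ →L[ℂ] Lp ℂ 2 μ} {S S' : Lp B p μ →L[ℂ] Lp B p μ}

lemma IsLqContraction.comp (hT : IsLqContraction T) (hT' : IsLqContraction T') :
    IsLqContraction (T.comp T') := fun q hq f hf =>
  (hT q hq _ ⟨Lp.aestronglyMeasurable _, (hT' q hq f hf).trans_lt hf.2⟩).trans (hT' q hq f hf)

lemma IsLqContraction.one : IsLqContraction (1 : Lp ℂ 2 μ →L[ℂ] Lp ℂ 2 μ) :=
  fun _ _ _ _ => le_rfl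

lemma IsLqContraction.pow (hT : IsLqContraction T) (n : ℕ) : IsLqContraction (T ^ n) := by
  induction n with
  | zero => exact .one
  | succ n ih => rw [pow_succ]; exact ih.comp hT

lemma ExtendsOnIndicators.one : ExtendsOnIndicators (1 : Lp ℂ 2 μ →L[ℂ] Lp ℂ 2 μ)
    (1 : Lp B p μ →L[ℂ] Lp B p μ) := by
  intro s hs hμs c
  rw [one_apply_eq_self]
  filter_upwards [indicatorConstLp_coeFn (p := p) (hs := hs) (hμs := hμs) (c := c),
    indicatorConstLp_coeFn (p := 2) (hs := hs) (hμs := hμs) (c := (1 : ℂ))] with x h1 h2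
  rw [h1, one_apply_eq_self, h2]
  by_cases hx : x ∈ s <;> simp [hx]

/-- Needed for products: S' sends an indicator to a tensor whose scalar factor T'1_s is no longer an
indicator. -/
lemma ExtendsOnIndicators.apply_elemTensor (hT : IsLqContraction T) (hp1 : 1 < p) (hp : p < ∞)
    (hS : ExtendsOnIndicators T S) {f : Lp ℂ 2 μ} {g : Lp ℂ p μ} (hfg : f =ᵐ[μ] g) (c : B) :
    S (elemTensor g c) =ᵐ[μ] fun x => T f x • c := by
  obtain ⟨V, hV⟩ := hT.exists_Lp_extension ℂ hp1 hp
  have : S.comp (tensorLeft μ p c) = (tensorLeft μ p c).comp V := by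
    refine clm_ext_indicator hp.ne fun s hs hμs a => Lp.ext ?_
    change S (elemTensor _ c) =ᵐ[μ] elemTensor (V _) c
    rw [elemTensor_indicatorConstLp]
    filter_upwards [hS s hs hμs (a • c), hV s hs hμs a,
      coeFn_elemTensor (V (indicatorConstLp p hs hμs a)) c] with x h1 h2 h3
    rw [h1, h3, h2, smul_assoc]
  have h := congrArg (fun A => A g) this
  change S (elemTensor g c) = elemTensor (V g) c at h
  rw [h]
  filter_upwards [coeFn_elemTensor (V g) c,
    ExtendsOnIndicators.self.ae_eq (by simp) hp.ne hV f g hfg] with x h1 h2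
  rw [h1, h2]

lemma ExtendsOnIndicators.comp (hT : IsLqContraction T) (hT' : IsLqContraction T') (hp1 : 1 < p)
    (hp : p < ∞) (hS : ExtendsOnIndicators T S) (hS' : ExtendsOnIndicators T' S') :
    ExtendsOnIndicators (T.comp T') (S.comp S') := by
  intro s hs hμs c
  have h := hT'.coeFn_indicatorImage hp1.le hs hμs
  have h1 : S' (indicatorConstLp p hs hμs c) = elemTensor (indicatorImage p T' s) c := by
    refine Lp.ext ?_
    filter_upwards [hS' s hs hμs c, h, coeFn_elemTensor (indicatorImage p T' s) c] with x h1 h2 h3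
    rw [h1, h3, h2]
  rw [ContinuousLinearMap.comp_apply, h1]
  exact hS.apply_elemTensor hT hp1 hp h.symm c

lemma ExtendsOnIndicators.pow (hT : IsLqContraction T) (hp1 : 1 < p)
    (hp : p < ∞) (hS : ExtendsOnIndicators T S) (n : ℕ) : ExtendsOnIndicators (T ^ n) (S ^ n) := by
  induction n with
  | zero => exact .one
  | succ n ih => rw [pow_succ, pow_succ]; exact ih.comp (hT.pow n) hT hp1 hp hS

/-- The ergodic average `n⁻¹ ∑_{k < n} T^k`. -/
def ergodicAverage {E : Type*} [NormedAddCommGroup E] [NormedSpace ℂ E] (T : E →L[ℂ] E) (n : ℕ) :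
    E →L[ℂ] E := (n : ℂ)⁻¹ • ∑ k ∈ Finset.range n, T ^ k

lemma ergodicAverage_apply {E : Type*} [NormedAddCommGroup E] [NormedSpace ℂ E] (T : E →L[ℂ] E)
    (n : ℕ) (F : E) : ergodicAverage T n F = (n : ℂ)⁻¹ • ∑ k ∈ Finset.range n, (T ^ k) F := by
  rw [ergodicAverage, smul_apply, sum_apply]

lemma ae_ergodicAverage {q : ℝ≥0∞} [Fact (1 ≤ q)] (T : Lp B q μ →L[ℂ] Lp B q μ) (n : ℕ)
    (F : Lp B q μ) :
    ergodicAverage T n F =ᵐ[μ] fun x => (n : ℂ)⁻¹ • ∑ k ∈ Finset.range n, (T ^ k) F x := by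
  rw [ergodicAverage_apply]
  filter_upwards [Lp.coeFn_smul (n : ℂ)⁻¹ (∑ k ∈ Finset.range n, (T ^ k) F),
    Lp.coeFn_finsetSum (Finset.range n) fun k => (T ^ k) F] with x h1 h2
  rw [h1, Pi.smul_apply, h2, Finset.sum_apply]

lemma IsLqContraction.ergodicAverage (hT : IsLqContraction T) (n : ℕ) :
    IsLqContraction (ergodicAverage T n) := by
  intro q hq f hf
  have h1 := ae_ergodicAverage T n f
  have h2 : (fun x => (n : ℂ)⁻¹ • ∑ k ∈ Finset.range n, (T ^ k) f x) =
      (n : ℂ)⁻¹ • ∑ k ∈ Finset.range n, ((T ^ k) f : X → ℂ) := by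
    ext x; simp
  rw [eLpNorm_congr_ae h1, h2]
  refine eLpNorm_const_smul_le.trans ?_
  rcases Nat.eq_zero_or_pos n with rfl | hn
  · simp
  have h3 : eLpNorm (∑ k ∈ Finset.range n, ((T ^ k) f : X → ℂ)) q μ ≤ n * eLpNorm f q μ := by
    refine (eLpNorm_sum_le (fun k _ => Lp.aestronglyMeasurable _) hq).trans ?_
    refine (Finset.sum_le_sum fun k _ => hT.pow k q hq f hf).trans ?_
    simp
  have h4 : ‖(n : ℂ)⁻¹‖ₑ = (n : ℝ≥0∞)⁻¹ := by
    rw [enorm_inv (by exact_mod_cast hn.ne'), ← ofReal_norm]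
    simp
  rw [h4]
  calc (n : ℝ≥0∞)⁻¹ * _ ≤ (n : ℝ≥0∞)⁻¹ * (n * eLpNorm f q μ) := by gcongr
    _ = eLpNorm f q μ := by
      rw [← mul_assoc, ENNReal.inv_mul_cancel (by exact_mod_cast hn.ne') (by simp), one_mul]

lemma ExtendsOnIndicators.ergodicAverage (hT : IsLqContraction T) (hp1 : 1 < p)
    (hp : p < ∞) (hS : ExtendsOnIndicators T S) (n : ℕ) :
    ExtendsOnIndicators (ergodicAverage T n) (ergodicAverage S n) := by
  intro s hs hμs c
  have h : ∀ᵐ x ∂μ, ∀ k, (S ^ k) (indicatorConstLp p hs hμs c) x =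
      (T ^ k) (indicatorConstLp 2 hs hμs 1) x • c :=
    ae_all_iff.2 fun k => hS.pow hT hp1 hp k s hs hμs c
  filter_upwards [ae_ergodicAverage T n (indicatorConstLp 2 hs hμs 1),
    ae_ergodicAverage S n (indicatorConstLp p hs hμs c), h] with x h1 h2 h3
  rw [h1, h2, smul_assoc, Finset.sum_smul]
  simp_rw [h3]

/-- `L²` convergence of `L^q` contractions implies convergence of their vector-valued extensions. -/
lemma tendsto_sub_of_tendsto_L2 {κ : Type*} {l : Filter κ} {U U' : κ → Lp ℂ 2 μ →L[ℂ] Lp ℂ 2 μ}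
    {W W' : κ → Lp B p μ →L[ℂ] Lp B p μ} (hU : ∀ k, IsLqContraction (U k))
    (hU' : ∀ k, IsLqContraction (U' k)) (hW : ∀ k, ExtendsOnIndicators (U k) (W k))
    (hW' : ∀ k, ExtendsOnIndicators (U' k) (W' k)) {C : ℝ} (hC : ∀ k F, ‖W k F‖ ≤ C * ‖F‖)
    (hC' : ∀ k F, ‖W' k F‖ ≤ C * ‖F‖)
    (h : ∀ f, Tendsto (fun k => U k f - U' k f) l (𝓝 0)) (hp1 : 1 < p) (hp : p < ∞)
    (F : Lp B p μ) : Tendsto (fun k => W k F - W' k F) l (𝓝 0) := by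
  refine Lp.induction hp.ne (motive := fun F => Tendsto (fun k => W k F - W' k F) l (𝓝 0))
    ?_ ?_ ?_ F
  · intro c s hs hμs'
    have hμs := hμs'.ne
    rw [Lp.simpleFunc.coe_indicatorConst]
    set f := indicatorConstLp 2 hs hμs (1 : ℂ) with hf
    have hm : ∀ q, MemLp f q μ := fun q =>
      (memLp_indicator_const q hs (1 : ℂ) (Or.inr hμs)).ae_eq indicatorConstLp_coeFn.symm
    have hfinf : eLpNorm f ∞ μ ≤ 1 := by
      refine (eLpNormEssSup_le_of_ae_bound (C := 1) ?_).trans (by simp)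
      filter_upwards [indicatorConstLp_coeFn (p := 2) (hs := hs) (hμs := hμs) (c := (1 : ℂ))]
        with x hx
      rw [hf, hx]
      by_cases hxs : x ∈ s <;> simp [hxs]
    have bd : ∀ V : Lp ℂ 2 μ →L[ℂ] Lp ℂ 2 μ, IsLqContraction V → ∀ᵐ x ∂μ, ‖V f x‖ ≤ 1 := by
      intro V hV
      filter_upwards [enorm_ae_le_eLpNormEssSup (V f) μ] with x hx
      have := hx.trans ((hV ∞ le_top f (hm _)).trans hfinf)
      rwa [← ofReal_norm, ENNReal.ofReal_le_one] at this
    -- On an indicator all the operators share the L^∞ bound 1 and the L¹ bound of f, so the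
    -- interpolation lemma applies.
    have lim : Tendsto (fun k => eLpNorm (U k f - U' k f : Lp ℂ 2 μ) p μ) l (𝓝 0) := by
      refine tendsto_eLpNorm_zero_of_bounds (fun k => Lp.aestronglyMeasurable _)
        (A := 2 * eLpNorm f 1 μ) (ENNReal.mul_ne_top (by simp) (hm 1).2.ne) (fun k => ?_) (b := 2)
        (fun k => ?_) ?_ hp1 hp
      · rw [eLpNorm_congr_ae (Lp.coeFn_sub _ _)]
        refine (eLpNorm_sub_le (Lp.aestronglyMeasurable _) (Lp.aestronglyMeasurable _)
          le_rfl).trans ?_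
        rw [two_mul]
        exact add_le_add (hU k 1 le_rfl f (hm 1)) (hU' k 1 le_rfl f (hm 1))
      · filter_upwards [Lp.coeFn_sub (U k f) (U' k f), bd _ (hU k), bd _ (hU' k)] with x h1 h2 h3
        rw [h1, Pi.sub_apply]
        exact (norm_sub_le _ _).trans (by linarith)
      · have := (continuous_enorm.tendsto _).comp (h f)
        rw [enorm_zero] at this
        exact this.congr fun k => Lp.enorm_def _
    rw [tendsto_zero_iff_norm_tendsto_zero]
    have lim' := (ENNReal.tendsto_toReal ENNReal.zero_ne_top).comp lim
    have lim'' := lim'.const_mul ‖c‖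
    rw [ENNReal.toReal_zero, mul_zero] at lim''
    refine squeeze_zero (fun _ => norm_nonneg _) (fun k => ?_) lim''
    have hae : (W k (indicatorConstLp p hs hμs c) - W' k (indicatorConstLp p hs hμs c) : Lp B p μ)
        =ᵐ[μ] fun x => (U k f - U' k f : Lp ℂ 2 μ) x • c := by
      filter_upwards [Lp.coeFn_sub (W k (indicatorConstLp p hs hμs c))
        (W' k (indicatorConstLp p hs hμs c)), Lp.coeFn_sub (U k f) (U' k f), hW k s hs hμs c,
        hW' k s hs hμs c] with x h1 h2 h3 h4
      rw [h1, h2, Pi.sub_apply, Pi.sub_apply, h3, h4, sub_smul]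
    have hfin : eLpNorm (U k f - U' k f : Lp ℂ 2 μ) p μ ≠ ∞ := by
      rw [eLpNorm_congr_ae (Lp.coeFn_sub _ _)]
      refine ((eLpNorm_sub_le (Lp.aestronglyMeasurable _) (Lp.aestronglyMeasurable _)
          hp1.le).trans_lt ?_).ne
      exact ENNReal.add_lt_top.2 ⟨((hU k p hp1.le f (hm p)).trans_lt (hm p).2),
        ((hU' k p hp1.le f (hm p)).trans_lt (hm p).2)⟩
    rw [Lp.norm_def, eLpNorm_congr_ae hae, Function.comp_apply, ← toReal_enorm c,
      ← ENNReal.toReal_mul]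
    refine ENNReal.toReal_mono (ENNReal.mul_ne_top enorm_ne_top hfin) ?_
    have := eLpNorm_le_nnreal_smul_eLpNorm_of_ae_le_mul (c := ‖c‖₊) (p := p) (μ := μ)
      (f := fun x => (U k f - U' k f : Lp ℂ 2 μ) x • c) (g := (U k f - U' k f : Lp ℂ 2 μ))
      (Eventually.of_forall fun x => by rw [nnnorm_smul, mul_comm])
    rwa [ENNReal.smul_def, smul_eq_mul, ← enorm_eq_nnnorm] at this
  · intro f g hf hg _ h1 h2
    have := h1.add h2
    rw [add_zero] at this
    refine this.congr fun k => ?_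
    rw [map_add, map_add]; abel
  · refine IsSeqClosed.isClosed fun G G₀ hG hlim => ?_
    rw [Set.mem_ofPred_eq, Metric.tendsto_nhds]
    intro ε hε
    obtain ⟨n, hn⟩ : ∃ n, (2 * |C|) * ‖G₀ - G n‖ < ε / 2 := by
      have h0 : Tendsto (fun n => (2 * |C|) * ‖G₀ - G n‖) atTop (𝓝 0) := by
        have := ((tendsto_const_nhds (x := G₀)).sub hlim).norm.const_mul (2 * |C|)
        simpa using this
      exact (h0.eventually_lt_const (by linarith)).exists
    filter_upwards [(Metric.tendsto_nhds.1 (hG n)) (ε / 2) (by linarith)] with k hk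
    rw [dist_zero_right] at hk ⊢
    have e : W k G₀ - W' k G₀ = (W k (G₀ - G n) - W' k (G₀ - G n)) + (W k (G n) - W' k (G n)) := by
      simp only [map_sub]; abel
    have b1 := hC k (G₀ - G n)
    have b2 := hC' k (G₀ - G n)
    have b3 := mul_le_mul_of_nonneg_right (le_abs_self C) (norm_nonneg (G₀ - G n))
    rw [e]
    refine (norm_add_le _ _).trans_lt ?_
    have := norm_sub_le (W k (G₀ - G n)) (W' k (G₀ - G n))
    linarith

end Convergence

/-! ### The vector-valued semigroup and the mean ergodic theorem -/

section Semigroup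

variable {X : Type*} [MeasurableSpace X] {μ : Measure X} {p : ℝ≥0∞} [Fact (1 ≤ p)]
  {B : Type*} [NormedAddCommGroup B] [NormedSpace ℂ B] [CompleteSpace B]
  {T : ℝ≥0 → Lp ℂ 2 μ →L[ℂ] Lp ℂ 2 μ}

lemma extendsOnIndicators_vectorExtension (hTc : HasContractionProperty T) (hp1 : 1 < p)
    (hp : p < ∞) (t : ℝ≥0) : ExtendsOnIndicators (T t) (vectorExtension p B T t) :=
  IsLqContraction.extendsOnIndicators_tensorExtension B (hTc t) hp1 hp

lemma isL1LInftyContraction_vectorExtension (hTc : HasContractionProperty T) (hp1 : 1 < p)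
    (hp : p < ∞) (t : ℝ≥0) : IsL1LInftyContraction (vectorExtension p B T t) :=
  IsLqContraction.isL1LInftyContraction (hTc t) hp (extendsOnIndicators_vectorExtension hTc hp1 hp t)

lemma norm_vectorExtension_apply_le (hTc : HasContractionProperty T) (hp1 : 1 < p)
    (hp : p < ∞) (t : ℝ≥0) (F : Lp B p μ) :
    ‖vectorExtension p B T t F‖ ≤ (lpConst p).toReal * ‖F‖ :=
  (isL1LInftyContraction_vectorExtension hTc hp1 hp t).norm_apply_le hp1 hp F

variable (B) in
-- Everything is inherited from L²(X): the algebra by uniqueness on indicators, strong continuity by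
-- `tendsto_sub_of_tendsto_L2`.
lemma isStronglyContinuousSemigroup_vectorExtension (hT : IsStronglyContinuousSemigroup T)
    (hTc : HasContractionProperty T) (hp1 : 1 < p) (hp : p < ∞) :
    IsStronglyContinuousSemigroup (vectorExtension p B T) := by
  have hS := extendsOnIndicators_vectorExtension (B := B) hTc hp1 hp
  refine ⟨?_, fun s t => ?_, fun F => ?_⟩
  · have h0 := hS 0
    rw [hT.map_zero] at h0
    exact h0.eq hp.ne .one
  · have h0 := hS (s + t)
    rw [hT.map_add] at h0
    exact h0.eq hp.ne ((hS s).comp (hTc s) (hTc t) hp1 hp (hS t))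
  · rw [continuous_iff_continuousAt]
    intro t₀
    have := tendsto_sub_of_tendsto_L2 (l := 𝓝 t₀) (U := T) (U' := fun _ => T t₀)
      (fun t => hTc t) (fun _ => hTc t₀) hS (fun _ => hS t₀)
      (norm_vectorExtension_apply_le hTc hp1 hp)
      (fun _ => norm_vectorExtension_apply_le hTc hp1 hp t₀) (fun f => by
        have := ((hT.continuous f).tendsto t₀).sub_const (T t₀ f)
        rwa [sub_self] at this) hp1 hp F
    exact tendsto_sub_nhds_zero_iff.1 this

lemma norm_ergodicAverage_apply_le {E : Type*} [NormedAddCommGroup E] [NormedSpace ℂ E]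
    {S : E →L[ℂ] E} {C : ℝ} (hC : ∀ k F, ‖(S ^ k) F‖ ≤ C * ‖F‖) (n : ℕ) (F : E) :
    ‖ergodicAverage S n F‖ ≤ C * ‖F‖ := by
  have hC0 : 0 ≤ C * ‖F‖ := (norm_nonneg _).trans (hC 0 F)
  rcases Nat.eq_zero_or_pos n with rfl | hn
  · simpa [ergodicAverage] using hC0
  rw [ergodicAverage_apply, norm_smul, norm_inv, Complex.norm_natCast, inv_mul_le_iff₀ (by positivity)]
  refine (norm_sum_le _ _).trans ((Finset.sum_le_sum fun k _ => hC k F).trans ?_)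
  simp

/-- Mean ergodic theorem in `L^p(X, B)`. -/
lemma exists_tendsto_ergodicAverage {T : Lp ℂ 2 μ →L[ℂ] Lp ℂ 2 μ} (hT : IsLqContraction T)
    {S : Lp B p μ →L[ℂ] Lp B p μ} (hS : ExtendsOnIndicators T S) (hp1 : 1 < p) (hp : p < ∞)
    (F : Lp B p μ) : ∃ Q, Tendsto (fun n => ergodicAverage S n F) atTop (𝓝 Q) := by
  have hC : ∀ n F, ‖ergodicAverage S n F‖ ≤ (lpConst p).toReal * ‖F‖ := fun n F =>
    norm_ergodicAverage_apply_le (fun k F =>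
      ((hT.pow k).isL1LInftyContraction hp (hS.pow hT hp1 hp k)).norm_apply_le hp1 hp F) n F
  have hT1 : ‖T‖ ≤ 1 := by
    refine ContinuousLinearMap.opNorm_le_bound _ zero_le_one fun f => ?_
    rw [one_mul, Lp.norm_def, Lp.norm_def]
    exact ENNReal.toReal_mono (Lp.eLpNorm_ne_top _) (hT 2 (by norm_num) f (Lp.memLp f))
  -- Von Neumann's theorem is used in the Hilbert space L²(X) only. What passes to L^p(X, B) is the
  -- Cauchy property, by comparing two averages along pairs of indices.
  have hL2 : ∀ f, ∃ Q, Tendsto (fun n => ergodicAverage T n f) atTop (𝓝 Q) := by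
    intro f
    refine ⟨_, (T.tendsto_birkhoffAverage_orthogonalProjection hT1 f).congr fun n => ?_⟩
    rw [ergodicAverage_apply, birkhoffAverage, birkhoffSum]
    congr 1
    refine Finset.sum_congr rfl fun k _ => ?_
    exact (congrFun (FunLike.coe_pow_eq_iterate T k) f).symm
  refine cauchySeq_tendsto_of_complete ?_
  rw [cauchySeq_iff_tendsto_dist_atTop_0]
  have := tendsto_sub_of_tendsto_L2 (l := (atTop : Filter (ℕ × ℕ)))
    (U := fun z => ergodicAverage T z.1) (U' := fun z => ergodicAverage T z.2)
    (W := fun z => ergodicAverage S z.1) (W' := fun z => ergodicAverage S z.2)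
    (fun z => hT.ergodicAverage z.1) (fun z => hT.ergodicAverage z.2)
    (fun z => hS.ergodicAverage hT hp1 hp z.1) (fun z => hS.ergodicAverage hT hp1 hp z.2)
    (fun z => hC z.1) (fun z => hC z.2) (fun f => by
      obtain ⟨Q, hQ⟩ := hL2 f
      rw [← prod_atTop_atTop_eq]
      have := (hQ.comp (tendsto_fst (f := (atTop : Filter ℕ)) (g := (atTop : Filter ℕ)))).sub
        (hQ.comp (tendsto_snd (f := (atTop : Filter ℕ)) (g := (atTop : Filter ℕ))))
      rwa [sub_self] at this) hp1 hp F
  rw [tendsto_zero_iff_norm_tendsto_zero] at this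
  exact this.congr fun z => (dist_eq_norm _ _).symm

end Semigroup

/-! ### The generator: domain, range and a dense subspace -/

section Generator

variable {E : Type*} [NormedAddCommGroup E] [NormedSpace ℂ E] {S : ℝ≥0 → E →L[ℂ] E}

/-- The orbit `t ↦ S_t F`, as a function of a real variable. -/
def orbit (S : ℝ≥0 → E →L[ℂ] E) (F : E) (t : ℝ) : E := S t.toNNReal F

lemma orbit_zero (hS : IsStronglyContinuousSemigroup S) (F : E) : orbit S F 0 = F := by
  simp [orbit, hS.map_zero]

lemma continuous_orbit (hS : IsStronglyContinuousSemigroup S) (F : E) : Continuous (orbit S F) :=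
  (hS.continuous F).comp continuous_real_toNNReal

lemma orbit_add (hS : IsStronglyContinuousSemigroup S) (F : E) {s t : ℝ} (hs : 0 ≤ s)
    (ht : 0 ≤ t) : orbit S F (s + t) = S s.toNNReal (orbit S F t) := by
  rw [orbit, Real.toNNReal_add hs ht, hS.map_add]; rfl

lemma norm_orbit_le {C : ℝ} (hC : ∀ t F, ‖S t F‖ ≤ C * ‖F‖) (F : E) (t : ℝ) :
    ‖orbit S F t‖ ≤ C * ‖F‖ := hC _ F

lemma tendsto_negGenerator (F : (negGenerator S).domain) :
    Tendsto (fun t : ℝ => t⁻¹ • (orbit S F t - F)) (𝓝[>] 0) (𝓝 (-(negGenerator S F))) := by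
  have h : Tendsto (fun t : ℝ≥0 => (t : ℝ)⁻¹ • (S t F - F)) (𝓝[>] 0)
      (𝓝 (-(negGenerator S F))) := by
    have := F.2.choose_spec
    have e : -(negGenerator S F) = F.2.choose := by
      change - - F.2.choose = _
      rw [neg_neg]
    rwa [e]
  have ht : Tendsto Real.toNNReal (𝓝[>] 0) (𝓝[>] 0) := by
    refine tendsto_nhdsWithin_iff.2 ⟨?_, ?_⟩
    · have := (continuous_real_toNNReal.tendsto 0).mono_left (nhdsWithin_le_nhds (s := Set.Ioi 0))
      rwa [Real.toNNReal_zero] at this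
    · filter_upwards [self_mem_nhdsWithin] with t ht using Real.toNNReal_pos.2 ht
  refine (h.comp ht).congr' ?_
  filter_upwards [self_mem_nhdsWithin] with t ht
  have ht : 0 < t := ht
  simp only [Function.comp_apply, Real.coe_toNNReal t ht.le, orbit]

lemma exists_negGenerator_eq {F G : E}
    (h : Tendsto (fun t : ℝ => t⁻¹ • (orbit S F t - F)) (𝓝[>] 0) (𝓝 (-G))) :
    ∃ hF : F ∈ (negGenerator S).domain, negGenerator S ⟨F, hF⟩ = G := by
  have ht : Tendsto (fun t : ℝ≥0 => (t : ℝ)) (𝓝[>] 0) (𝓝[>] 0) := by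
    refine tendsto_nhdsWithin_iff.2 ⟨?_, ?_⟩
    · exact (NNReal.continuous_coe.tendsto 0).mono_left nhdsWithin_le_nhds
    · filter_upwards [self_mem_nhdsWithin] with t ht
      exact NNReal.coe_pos.2 ht
  have h' : Tendsto (fun t : ℝ≥0 => (t : ℝ)⁻¹ • (S t F - F)) (𝓝[>] 0) (𝓝 (-G)) := by
    refine (h.comp ht).congr fun t => ?_
    simp [orbit]
  have hF : F ∈ (negGenerator S).domain := ⟨_, h'⟩
  refine ⟨hF, ?_⟩
  have := tendsto_nhds_unique (tendsto_negGenerator ⟨F, hF⟩) h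
  rwa [neg_inj] at this

lemma apply_mem_domain (hS : IsStronglyContinuousSemigroup S) (F : (negGenerator S).domain)
    (t : ℝ≥0) : ∃ h : S t F ∈ (negGenerator S).domain,
      negGenerator S ⟨S t F, h⟩ = S t (negGenerator S F) := by
  refine exists_negGenerator_eq ?_
  rw [← map_neg]
  refine (((S t).continuous.tendsto _).comp (tendsto_negGenerator F)).congr' ?_
  filter_upwards [self_mem_nhdsWithin] with r hr
  rw [Function.comp_apply, ContinuousLinearMap.map_smul_of_tower, map_sub]
  congr 2
  change S t (S _ _) = S _ (S t _)
  rw [← ContinuousLinearMap.comp_apply, ← ContinuousLinearMap.comp_apply, ← hS.map_add,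
    ← hS.map_add, add_comm]

lemma hasDerivWithinAt_orbit (hS : IsStronglyContinuousSemigroup S)
    (F : (negGenerator S).domain) {t : ℝ} (ht : 0 ≤ t) :
    HasDerivWithinAt (orbit S F) (-(S t.toNNReal (negGenerator S F))) (Set.Ici t) t := by
  rw [← hasDerivWithinAt_Ioi_iff_Ici, hasDerivWithinAt_iff_tendsto_slope' (by simp)]
  have h1 : Tendsto (fun x : ℝ => x - t) (𝓝[>] t) (𝓝[>] 0) := by
    refine tendsto_nhdsWithin_iff.2 ⟨?_, ?_⟩
    · have : Tendsto (fun x : ℝ => x - t) (𝓝 t) (𝓝 (t - t)) :=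
        (continuous_id.sub continuous_const).tendsto t
      rw [sub_self] at this
      exact this.mono_left nhdsWithin_le_nhds
    · filter_upwards [self_mem_nhdsWithin] with x hx using sub_pos.2 (show t < x from hx)
  rw [← map_neg]
  refine (((S t.toNNReal).continuous.tendsto _).comp
    ((tendsto_negGenerator F).comp h1)).congr' ?_
  filter_upwards [self_mem_nhdsWithin] with x hx
  have hx : t < x := hx
  rw [Function.comp_apply, Function.comp_apply, ContinuousLinearMap.map_smul_of_tower, map_sub,
    ← orbit_add hS _ ht (by linarith), slope_def_module, add_sub_cancel]
  rfl

variable [CompleteSpace E]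

lemma tendsto_average {f : ℝ → E} (hf : Continuous f) (a : ℝ) :
    Tendsto (fun r : ℝ => r⁻¹ • ∫ t in a..a + r, f t) (𝓝[>] 0) (𝓝 (f a)) := by
  have h := intervalIntegral.integral_hasDerivAt_right (hf.intervalIntegrable a a)
    hf.aestronglyMeasurable.stronglyMeasurableAtFilter hf.continuousAt
  rw [hasDerivAt_iff_tendsto_slope_zero] at h
  have h' := h.mono_left
    (nhdsWithin_mono 0 (s := Set.Ioi 0) (t := {0}ᶜ) fun x hx => (Set.mem_Ioi.1 hx).ne')
  simpa using h'

/-- Shifting the interval of integration leaves only its ends, so the difference quotient is an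
average of the orbit at h minus one at 0. -/
lemma integral_orbit_mem_domain (hS : IsStronglyContinuousSemigroup S) (G : E) {h : ℝ}
    (hh : 0 ≤ h) : ∃ hF : (∫ t in (0 : ℝ)..h, orbit S G t) ∈ (negGenerator S).domain,
      negGenerator S ⟨_, hF⟩ = G - orbit S G h := by
  have hc := continuous_orbit hS G
  refine exists_negGenerator_eq ?_
  have h1 := (tendsto_average hc h).sub (tendsto_average hc 0)
  rw [orbit_zero hS] at h1
  rw [neg_sub]
  refine h1.congr' ?_
  filter_upwards [self_mem_nhdsWithin] with r hr
  have hr : 0 < r := hr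
  rw [← smul_sub]
  congr 1
  have e : orbit S (∫ t in (0 : ℝ)..h, orbit S G t) r = ∫ t in r..h + r, orbit S G t := by
    rw [orbit, ← ContinuousLinearMap.intervalIntegral_comp_comm _ (hc.intervalIntegrable _ _)]
    have := intervalIntegral.integral_comp_add_right (a := 0) (b := h) (orbit S G) r
    rw [zero_add] at this
    rw [← this]
    refine intervalIntegral.integral_congr fun t ht => ?_
    rw [Set.uIcc_of_le hh] at ht
    change S r.toNNReal (orbit S G t) = orbit S G (t + r)
    rw [add_comm, orbit_add hS _ hr.le ht.1]
  rw [e, zero_add]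
  have i := fun a b => hc.intervalIntegrable (μ := volume) a b
  rw [← intervalIntegral.integral_add_adjacent_intervals (i r h) (i h (h + r)),
    ← intervalIntegral.integral_add_adjacent_intervals (i 0 r) (i r h)]
  abel

/-- `G - S_h G` belongs to the range of the generator. -/
lemma sub_orbit_mem_range (hS : IsStronglyContinuousSemigroup S) (G : E) {h : ℝ}
    (hh : 0 ≤ h) : G - orbit S G h ∈ Set.range (negGenerator S) := by
  obtain ⟨hF, e⟩ := integral_orbit_mem_domain hS G hh
  exact ⟨_, e⟩

lemma mem_closure_domain (hS : IsStronglyContinuousSemigroup S) (G : E) :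
    G ∈ closure ((negGenerator S).domain : Set E) := by
  have h := tendsto_average (continuous_orbit hS G) 0
  rw [orbit_zero hS] at h
  refine mem_closure_of_tendsto h ?_
  filter_upwards [self_mem_nhdsWithin] with r hr
  have hr : 0 < r := hr
  rw [zero_add]
  have := (integral_orbit_mem_domain hS G hr.le).choose
  have h2 := (negGenerator S).domain.smul_mem (r⁻¹ : ℂ) this
  have e : (r⁻¹ : ℂ) • (∫ t in (0 : ℝ)..r, orbit S G t) = r⁻¹ • ∫ t in (0 : ℝ)..r, orbit S G t := by
    rw [← Complex.ofReal_inv, Complex.coe_smul]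
  rw [← e]
  exact h2

/-- If the ergodic averages of `S_1` converge, then `Ker(L) + Dom(L) ∩ Ran(L)` is dense. -/
lemma mem_of_ker_of_domain_inter_range (hS : IsStronglyContinuousSemigroup S) {C : ℝ}
    (hC : ∀ t F, ‖S t F‖ ≤ C * ‖F‖)
    (hQ : ∀ F, ∃ Q, Tendsto (fun n => ergodicAverage (S 1) n F) atTop (𝓝 Q))
    (V : Submodule ℂ E) (hV : IsClosed (V : Set E))
    (hker : ∀ F : (negGenerator S).domain, negGenerator S F = 0 → (F : E) ∈ V)
    (hran : ∀ F : (negGenerator S).domain, (F : E) ∈ Set.range (negGenerator S) → (F : E) ∈ V)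
    (F : E) : F ∈ V := by
  -- For G in the domain, G - S_h G lies in Dom(L) ∩ Ran(L); density of the domain and closedness of
  -- V give the general case.
  have hsub : ∀ (h : ℝ), 0 ≤ h → ∀ G, G - orbit S G h ∈ V := by
    intro h hh G
    have hcl : IsClosed {G | G - orbit S G h ∈ V} :=
      hV.preimage (continuous_id.sub (S h.toNNReal).continuous)
    refine (closure_minimal (t := {G | G - orbit S G h ∈ V}) ?_ hcl) (mem_closure_domain hS G)
    intro G hG
    have h1 := (apply_mem_domain hS ⟨G, hG⟩ h.toNNReal).choose
    exact hran ⟨G - orbit S G h, sub_mem hG h1⟩ (sub_orbit_mem_range hS G hh)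
  obtain ⟨Q, hQ⟩ := hQ F
  have orbit1 : ∀ G, orbit S G 1 = S 1 G := fun G => by simp [orbit]
  have hpow : ∀ n : ℕ, S 1 ^ n = S n := by
    intro n
    induction n with
    | zero => simp [hS.map_zero]; rfl
    | succ n ih => rw [pow_succ, ih, Nat.cast_add, Nat.cast_one, hS.map_add]; rfl
  -- the limit is a fixed point
  have hfix : S 1 Q = Q := by
    have h1 := (((S 1).continuous.tendsto _).comp hQ).sub hQ
    have h2 : Tendsto (fun n : ℕ => (n : ℂ)⁻¹ • ((S 1 ^ n) F - F)) atTop (𝓝 0) := by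
      refine squeeze_zero_norm (a := fun n : ℕ => (n : ℝ)⁻¹ * (C * ‖F‖ + ‖F‖)) (fun n => ?_) ?_
      · rw [norm_smul, norm_inv, Complex.norm_natCast]
        gcongr
        refine (norm_sub_le _ _).trans ?_
        rw [hpow]
        gcongr
        exact hC _ _
      · have := tendsto_inv_atTop_nhds_zero_nat (𝕜 := ℝ)
        simpa using this.mul_const (C * ‖F‖ + ‖F‖)
    have h3 := h1.congr (f₂ := fun n : ℕ => (n : ℂ)⁻¹ • ((S 1 ^ n) F - F)) fun n => by
      rw [Function.comp_apply, ergodicAverage_apply, map_smul, ← smul_sub, map_sum,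
        ← Finset.sum_sub_distrib]
      congr 1
      have h4 := Finset.sum_range_sub (fun k => (S 1 ^ k) F) n
      rw [pow_zero, one_apply_eq_self] at h4
      rw [← h4]
      refine Finset.sum_congr rfl fun k _ => ?_
      rw [pow_succ']; rfl
    exact sub_eq_zero.1 (tendsto_nhds_unique h3 h2)
  -- F minus its n-th ergodic average is the mean of the vectors F - S_k F, all in V.
  have hFQ : F - Q ∈ V := by
    refine hV.mem_of_tendsto (tendsto_const_nhds.sub hQ) ?_
    filter_upwards [eventually_gt_atTop 0] with n hn
    have e : F - ergodicAverage (S 1) n F =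
        (n : ℂ)⁻¹ • ∑ k ∈ Finset.range n, (F - orbit S F k) := by
      rw [ergodicAverage_apply, Finset.sum_sub_distrib, smul_sub, Finset.sum_const,
        Finset.card_range, ← Nat.cast_smul_eq_nsmul ℂ, smul_smul,
        inv_mul_cancel₀ (by exact_mod_cast hn.ne'), one_smul]
      congr 2
      refine Finset.sum_congr rfl fun k _ => ?_
      rw [hpow, orbit, Real.toNNReal_natCast]
    rw [e]
    exact V.smul_mem _ (V.sum_mem fun k _ => hsub k (by positivity) F)
  have hc := continuous_orbit hS Q
  -- Q is fixed by S_1 but perhaps not by every S_t. Its mean over one period is in Ker(L), and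
  -- differs from Q by an integral of elements of V.
  have hQ'ker : ∃ hF : (∫ t in (0 : ℝ)..1, orbit S Q t) ∈ (negGenerator S).domain,
      negGenerator S ⟨_, hF⟩ = 0 := by
    obtain ⟨hF, e⟩ := integral_orbit_mem_domain hS Q zero_le_one
    exact ⟨hF, by rw [e, orbit1, hfix, sub_self]⟩
  obtain ⟨hd, hd0⟩ := hQ'ker
  have hQ'V := hker ⟨_, hd⟩ hd0
  have hQQ' : (∫ t in (0 : ℝ)..1, (Q - orbit S Q t)) ∈ V := by
    rw [intervalIntegral.integral_of_le zero_le_one]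
    have : IsProbabilityMeasure (volume.restrict (Set.Ioc (0 : ℝ) 1)) := ⟨by simp⟩
    refine Convex.integral_mem (V.restrictScalars ℝ).convex hV ?_ ?_
    · filter_upwards [ae_restrict_mem measurableSet_Ioc] with t ht
      exact hsub t ht.1.le Q
    · exact ((continuous_const.sub hc).integrableOn_Icc).mono_set Set.Ioc_subset_Icc_self
  rw [intervalIntegral.integral_sub (by simp) (hc.intervalIntegrable _ _)] at hQQ'
  have := V.add_mem hFQ (V.add_mem hQQ' hQ'V)
  simpa using this

end Generator

/-! ### The resolvent as a Laplace transform -/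

section Resolvent

variable {E : Type*} [NormedAddCommGroup E] [NormedSpace ℂ E] {S : ℝ≥0 → E →L[ℂ] E}
  {C : ℝ}

lemma continuous_exp_smul_orbit (hS : IsStronglyContinuousSemigroup S) (s : ℝ) (G : E) :
    Continuous fun t => Real.exp (-s * t) • orbit S G t := by
  have : Continuous fun t => Real.exp (-s * t) := by fun_prop
  exact this.smul (continuous_orbit hS G)

lemma continuous_mul_exp_smul_orbit (hS : IsStronglyContinuousSemigroup S) (s : ℝ) (G : E) :
    Continuous fun t => (t * Real.exp (-s * t)) • orbit S G t := by
  have : Continuous fun t => t * Real.exp (-s * t) := by fun_prop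
  exact this.smul (continuous_orbit hS G)

lemma integrableOn_exp_smul_orbit (hS : IsStronglyContinuousSemigroup S)
    (hC : ∀ t F, ‖S t F‖ ≤ C * ‖F‖) {s : ℝ} (hs : 0 < s) (G : E) :
    IntegrableOn (fun t => Real.exp (-s * t) • orbit S G t) (Set.Ioi 0) := by
  refine Integrable.mono' ((integrableOn_exp_mul_Ioi (neg_lt_zero.2 hs) 0).mul_const (C * ‖G‖))
    ?_ (Eventually.of_forall fun t => ?_)
  · exact (continuous_exp_smul_orbit hS s G).aestronglyMeasurable
  · rw [norm_smul, Real.norm_of_nonneg (Real.exp_pos _).le]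
    exact mul_le_mul_of_nonneg_left (norm_orbit_le hC G t) (Real.exp_pos _).le

lemma integrableOn_mul_exp {s : ℝ} (hs : 0 < s) :
    IntegrableOn (fun t => t * Real.exp (-s * t)) (Set.Ioi 0) := by
  have := integrableOn_rpow_mul_exp_neg_mul_rpow (s := 1) (p := 1) (b := s) (by norm_num) one_pos hs
  simpa using this

lemma integrableOn_mul_exp_smul_orbit (hS : IsStronglyContinuousSemigroup S)
    (hC : ∀ t F, ‖S t F‖ ≤ C * ‖F‖) {s : ℝ} (hs : 0 < s) (G : E) :
    IntegrableOn (fun t => (t * Real.exp (-s * t)) • orbit S G t) (Set.Ioi 0) := by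
  refine Integrable.mono' ((integrableOn_mul_exp hs).mul_const (C * ‖G‖)) ?_ ?_
  · exact (continuous_mul_exp_smul_orbit hS s G).aestronglyMeasurable
  · filter_upwards [ae_restrict_mem measurableSet_Ioi] with t ht
    have ht : 0 < t := ht
    rw [norm_smul, Real.norm_of_nonneg (by positivity)]
    exact mul_le_mul_of_nonneg_left (norm_orbit_le hC G t) (by positivity)

variable [CompleteSpace E]

omit [NormedSpace ℂ E] [CompleteSpace E] in
lemma integral_Ioi_comp_add_right [NormedSpace ℝ E] (g : ℝ → E) (r : ℝ) :
    ∫ t in Set.Ioi (0 : ℝ), g (t + r) = ∫ t in Set.Ioi r, g t := by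
  rw [← integral_indicator measurableSet_Ioi, ← integral_indicator measurableSet_Ioi,
    ← integral_add_right_eq_self ((Set.Ioi r).indicator g) r]
  congr 1
  ext t
  simp [Set.indicator_apply]

lemma orbit_integral_smul_orbit (hS : IsStronglyContinuousSemigroup S) {φ : ℝ → ℝ} {G : E}
    (hφ : IntegrableOn (fun t => φ t • orbit S G t) (Set.Ioi 0)) {r : ℝ} (hr : 0 ≤ r) :
    orbit S (∫ t in Set.Ioi (0 : ℝ), φ t • orbit S G t) r =
      ∫ t in Set.Ioi r, φ (t - r) • orbit S G t := by
  rw [orbit, ← ContinuousLinearMap.integral_comp_comm _ hφ]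
  rw [← integral_Ioi_comp_add_right (fun t => φ (t - r) • orbit S G t) r]
  refine setIntegral_congr_fun measurableSet_Ioi fun t ht => ?_
  have ht : 0 < t := ht
  simp only [add_sub_cancel_right]
  rw [ContinuousLinearMap.map_smul_of_tower, ← orbit_add hS G hr ht.le, add_comm]

omit [CompleteSpace E] in
lemma integral_Ioi_eq_sub {f : ℝ → E} (hf : IntegrableOn f (Set.Ioi 0)) {r : ℝ} (hr : 0 ≤ r) :
    ∫ t in Set.Ioi r, f t = (∫ t in Set.Ioi (0 : ℝ), f t) - ∫ t in (0 : ℝ)..r, f t := by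
  rw [eq_sub_iff_add_eq, add_comm]
  exact intervalIntegral.integral_interval_add_Ioi hf (hf.mono_set (Set.Ioi_subset_Ioi hr))

/-- The Laplace transform of the orbit, `R_s G = ∫_0^∞ e^{-st} S_t G dt`. -/
def laplace (S : ℝ≥0 → E →L[ℂ] E) (s : ℝ) (G : E) : E :=
  ∫ t in Set.Ioi (0 : ℝ), Real.exp (-s * t) • orbit S G t

lemma tendsto_exp_sub_one (s : ℝ) :
    Tendsto (fun r : ℝ => r⁻¹ * (Real.exp (s * r) - 1)) (𝓝[>] 0) (𝓝 s) := by
  have h : HasDerivAt (fun r : ℝ => Real.exp (s * r)) s 0 := by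
    have := ((hasDerivAt_id (0 : ℝ)).const_mul s).exp
    simpa using this
  rw [hasDerivAt_iff_tendsto_slope_zero] at h
  have h' := h.mono_left
    (nhdsWithin_mono 0 (s := Set.Ioi 0) (t := {0}ᶜ) fun x hx => (Set.mem_Ioi.1 hx).ne')
  simpa using h'

lemma tendsto_exp_mul (s : ℝ) :
    Tendsto (fun r : ℝ => Real.exp (s * r)) (𝓝[>] 0) (𝓝 1) := by
  have : Continuous fun r : ℝ => Real.exp (s * r) := by fun_prop
  have := this.tendsto 0
  rw [mul_zero, Real.exp_zero] at this
  exact this.mono_left nhdsWithin_le_nhds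

lemma laplace_mem_domain (hS : IsStronglyContinuousSemigroup S)
    (hC : ∀ t F, ‖S t F‖ ≤ C * ‖F‖) {s : ℝ} (hs : 0 < s) (G : E) :
    ∃ hF : laplace S s G ∈ (negGenerator S).domain,
      negGenerator S ⟨_, hF⟩ = G - s • laplace S s G := by
  have hint := integrableOn_exp_smul_orbit hS hC hs G
  have hcont := continuous_exp_smul_orbit hS s G
  refine exists_negGenerator_eq ?_
  have h1 := ((tendsto_exp_sub_one s).smul_const (laplace S s G)).sub
    ((tendsto_exp_mul s).smul (tendsto_average hcont 0))
  simp only [mul_zero, Real.exp_zero, one_smul, orbit_zero hS, zero_add] at h1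
  rw [neg_sub]
  refine h1.congr' ?_
  filter_upwards [self_mem_nhdsWithin] with r hr
  have hr : 0 < r := hr
  have e : orbit S (laplace S s G) r = Real.exp (s * r) • (laplace S s G -
      ∫ t in (0 : ℝ)..r, Real.exp (-s * t) • orbit S G t) := by
    rw [laplace, orbit_integral_smul_orbit hS hint hr.le, ← integral_Ioi_eq_sub hint hr.le,
      ← integral_smul]
    refine setIntegral_congr_fun measurableSet_Ioi fun t _ => ?_
    simp only [smul_smul, ← Real.exp_add]
    congr 2; ring
  rw [e]
  module

/-- Translation by r turns the weight t e^{-st} into (t - r) e^{-s(t-r)}. Its derivative at r = 0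
shows that s + L maps this integral to the resolvent of G, which identifies the squared resolvent
with no double integral. -/
lemma laplace_deriv_mem_domain (hS : IsStronglyContinuousSemigroup S)
    (hC : ∀ t F, ‖S t F‖ ≤ C * ‖F‖) {s : ℝ} (hs : 0 < s) (G : E) :
    ∃ hF : (∫ t in Set.Ioi (0 : ℝ), (t * Real.exp (-s * t)) • orbit S G t) ∈
        (negGenerator S).domain,
      negGenerator S ⟨_, hF⟩ = laplace S s G -
        s • ∫ t in Set.Ioi (0 : ℝ), (t * Real.exp (-s * t)) • orbit S G t := by
  have hint := integrableOn_exp_smul_orbit hS hC hs G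
  have hint2 := integrableOn_mul_exp_smul_orbit hS hC hs G
  have hcont := continuous_exp_smul_orbit hS s G
  have hcont2 := continuous_mul_exp_smul_orbit hS s G
  set Z := ∫ t in Set.Ioi (0 : ℝ), (t * Real.exp (-s * t)) • orbit S G t with hZ
  refine exists_negGenerator_eq ?_
  have hr0 : Tendsto (fun r : ℝ => r) (𝓝[>] 0) (𝓝 0) := tendsto_id.mono_left nhdsWithin_le_nhds
  have h1 := ((((tendsto_exp_sub_one s).smul_const Z).sub
    ((tendsto_exp_mul s).smul (tendsto_average hcont2 0))).sub
    ((tendsto_exp_mul s).smul_const (laplace S s G))).add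
      (((tendsto_exp_mul s).mul hr0).smul (tendsto_average hcont 0))
  simp only [mul_zero, zero_mul, zero_smul, smul_zero, one_smul, zero_add, sub_zero,
    add_zero] at h1
  rw [neg_sub]
  refine h1.congr' ?_
  filter_upwards [self_mem_nhdsWithin] with r hr
  have hr : 0 < r := hr
  have e : orbit S Z r = Real.exp (s * r) • ((Z -
      ∫ t in (0 : ℝ)..r, (t * Real.exp (-s * t)) • orbit S G t) - r • (laplace S s G -
      ∫ t in (0 : ℝ)..r, Real.exp (-s * t) • orbit S G t)) := by
    rw [hZ, laplace, orbit_integral_smul_orbit hS hint2 hr.le, ← integral_Ioi_eq_sub hint hr.le,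
      ← integral_Ioi_eq_sub hint2 hr.le, ← integral_smul r, ← integral_sub
      (hint2.mono_set (Set.Ioi_subset_Ioi hr.le))
      ((hint.mono_set (Set.Ioi_subset_Ioi hr.le)).fun_smul r), ← integral_smul]
    refine setIntegral_congr_fun measurableSet_Ioi fun t _ => ?_
    simp only [smul_smul, ← sub_smul]
    congr 1
    rw [show -s * (t - r) = s * r + -s * t by ring, Real.exp_add]
    ring
  rw [e]
  have hrr : r⁻¹ * r = 1 := inv_mul_cancel₀ hr.ne'
  generalize (∫ t in (0 : ℝ)..r, (t * Real.exp (-s * t)) • orbit S G t) = a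
  generalize (∫ t in (0 : ℝ)..r, Real.exp (-s * t) • orbit S G t) = b
  have e1 : (Real.exp (s * r) * r) • (r⁻¹ • b) = Real.exp (s * r) • b := by
    rw [smul_smul, mul_assoc, mul_inv_cancel₀ hr.ne', mul_one]
  have e2 : r⁻¹ • (Real.exp (s * r) • ((Z - a) - r • (laplace S s G - b)) - Z) =
      r⁻¹ • (Real.exp (s * r) • (Z - a) - Z) - Real.exp (s * r) • ((r⁻¹ * r) •
        (laplace S s G - b)) := by
    module
  rw [e1, e2, hrr]
  module

/-- The Laplace transform as a bounded operator. -/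
def laplaceCLM (hS : IsStronglyContinuousSemigroup S) (hC : ∀ t F, ‖S t F‖ ≤ C * ‖F‖) {s : ℝ}
    (hs : 0 < s) : E →L[ℂ] E :=
  LinearMap.mkContinuous
    { toFun := laplace S s
      map_add' := fun F G => by
        rw [laplace, laplace, laplace, ← integral_add (integrableOn_exp_smul_orbit hS hC hs F)
          (integrableOn_exp_smul_orbit hS hC hs G)]
        simp [orbit]
      map_smul' := fun c F => by
        rw [laplace, laplace, RingHom.id_apply, ← integral_smul]
        simp only [orbit, map_smul]
        simp_rw [smul_comm c] }
    (∫ t in Set.Ioi (0 : ℝ), Real.exp (-s * t) * C) (fun G => by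
      rw [← integral_mul_const]
      refine norm_integral_le_of_norm_le
        (((integrableOn_exp_mul_Ioi (neg_lt_zero.2 hs) 0).mul_const C).mul_const ‖G‖)
        (Eventually.of_forall fun t => ?_)
      rw [norm_smul, Real.norm_of_nonneg (Real.exp_pos _).le, mul_assoc]
      exact mul_le_mul_of_nonneg_left (norm_orbit_le hC G t) (Real.exp_pos _).le)

omit [CompleteSpace E] in
lemma laplaceCLM_apply (hS : IsStronglyContinuousSemigroup S) (hC : ∀ t F, ‖S t F‖ ≤ C * ‖F‖)
    {s : ℝ} (hs : 0 < s) (G : E) : laplaceCLM hS hC hs G = laplace S s G := rfl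

lemma isResolventAt_laplaceCLM (hS : IsStronglyContinuousSemigroup S)
    (hC : ∀ t F, ‖S t F‖ ≤ C * ‖F‖) {s : ℝ} (hs : 0 < s) :
    IsResolventAt (negGenerator S) s (laplaceCLM hS hC hs) := by
  refine ⟨fun G => ?_, fun F => ?_⟩
  · obtain ⟨hF, e⟩ := laplace_mem_domain hS hC hs G
    refine ⟨⟨_, hF⟩, rfl, ?_⟩
    rw [e, Complex.coe_smul]
    simp
  · obtain ⟨hF, e⟩ := laplace_mem_domain hS hC hs (F : E)
    have h1 := tendsto_negGenerator ⟨_, hF⟩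
    have h2 := ((laplaceCLM hS hC hs).continuous.tendsto _).comp (tendsto_negGenerator F)
    have h3 := tendsto_nhds_unique (h2.congr' (f₂ := fun t : ℝ =>
      t⁻¹ • (orbit S (laplace S s F) t - laplace S s F)) ?_) h1
    · rw [e, map_neg, neg_inj] at h3
      rw [map_add, map_smul, h3, laplaceCLM_apply, Complex.coe_smul]
      abel
    · filter_upwards [self_mem_nhdsWithin] with r hr
      have hr : 0 < r := hr
      rw [Function.comp_apply, ContinuousLinearMap.map_smul_of_tower, map_sub]
      congr 2
      rw [laplaceCLM_apply]
      change laplace S s (S r.toNNReal F) = S r.toNNReal (laplace S s F)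
      rw [laplace, laplace, ← ContinuousLinearMap.integral_comp_comm _
        (integrableOn_exp_smul_orbit hS hC hs (F : E))]
      refine setIntegral_congr_fun measurableSet_Ioi fun t ht => ?_
      have ht : 0 < t := ht
      simp only [ContinuousLinearMap.map_smul_of_tower]
      congr 1
      rw [← orbit_add hS _ hr.le ht.le, add_comm, orbit_add hS _ ht.le hr.le]
      rfl

omit [CompleteSpace E] in
lemma IsResolventAt.unique {A : E →ₗ.[ℂ] E} {s : ℝ} {R R' : E →L[ℂ] E}
    (h : IsResolventAt A s R) (h' : IsResolventAt A s R') : R = R' := by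
  ext1 G
  obtain ⟨F, hF, e⟩ := h'.1 G
  have := h.2 F
  rw [e] at this
  rw [this, hF]

lemma resolventAt_negGenerator (hS : IsStronglyContinuousSemigroup S)
    (hC : ∀ t F, ‖S t F‖ ≤ C * ‖F‖) {s : ℝ} (hs : 0 < s) (G : E) :
    resolventAt (negGenerator S) s G = laplace S s G := by
  have h : ∃ R, IsResolventAt (negGenerator S) s R := ⟨_, isResolventAt_laplaceCLM hS hC hs⟩
  rw [resolventAt, dif_pos h, h.choose_spec.unique (isResolventAt_laplaceCLM hS hC hs)]
  rfl

lemma laplace_laplace (hS : IsStronglyContinuousSemigroup S)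
    (hC : ∀ t F, ‖S t F‖ ≤ C * ‖F‖) {s : ℝ} (hs : 0 < s) (G : E) :
    laplace S s (laplace S s G) = ∫ t in Set.Ioi (0 : ℝ), (t * Real.exp (-s * t)) • orbit S G t := by
  obtain ⟨hF, e⟩ := laplace_deriv_mem_domain hS hC hs G
  have := (isResolventAt_laplaceCLM hS hC hs).2 ⟨_, hF⟩
  rw [e, Complex.coe_smul, add_sub_cancel] at this
  exact this

end Resolvent

/-! ### Decay of Γ on the line Re z = 1 -/

section Gamma

open Complex (I)

lemma Gamma_one_add_I_mul (u : ℝ) :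
    Complex.Gamma (1 + I * u) = starRingEnd ℂ (Complex.Gamma (1 - I * u)) := by
  rw [← Complex.Gamma_conj]
  simp

lemma Gamma_one_sub_I_mul_ne_zero (u : ℝ) : Complex.Gamma (1 - I * u) ≠ 0 :=
  Complex.Gamma_ne_zero_of_re_pos (by simp)

lemma continuous_Gamma_one_sub_I_mul : Continuous fun u : ℝ => Complex.Gamma (1 - I * u) := by
  refine continuous_iff_continuousAt.2 fun u => ?_
  have h := Complex.differentiableAt_Gamma (1 - I * u) fun m h => by
    have := congrArg Complex.re h
    have hm : (0 : ℝ) ≤ m := m.cast_nonneg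
    simp at this
    linarith
  refine ContinuousAt.comp (f := fun u : ℝ => 1 - I * (u : ℂ)) h.continuousAt ?_
  fun_prop

/-- The reflection formula gives |Γ(1 - iu)|² = πu / sinh(πu) for u > 0, and sinh is bounded below
through 1 + 2x ≤ e^{2x}. -/
lemma norm_sq_Gamma_one_sub_I_mul_le (u : ℝ) :
    ‖Complex.Gamma (1 - I * u)‖ ^ 2 ≤ (1 + 2 * Real.pi * |u|) * Real.exp (-(Real.pi * |u|)) := by
  have key : ∀ u : ℝ, 0 < u → ‖Complex.Gamma (1 - I * u)‖ ^ 2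
      ≤ (1 + 2 * Real.pi * u) * Real.exp (-(Real.pi * u)) := by
    intro u hu
    have hu' : I * (u : ℂ) ≠ 0 := mul_ne_zero Complex.I_ne_zero (by exact_mod_cast hu.ne')
    have h1 : Complex.Gamma (1 + I * u) * Complex.Gamma (1 - I * u)
        = ((Real.pi * u / Real.sinh (Real.pi * u) : ℝ) : ℂ) := by
      rw [add_comm, Complex.Gamma_add_one _ hu', mul_assoc, Complex.Gamma_mul_Gamma_one_sub,
        show (Real.pi : ℂ) * (I * u) = (Real.pi * u : ℂ) * I by ring, Complex.sin_mul_I]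
      have : Complex.sinh (Real.pi * u) ≠ 0 := by
        have : Real.sinh (Real.pi * u) ≠ 0 := (Real.sinh_pos_iff.2 (by positivity)).ne'
        exact_mod_cast this
      push_cast
      field_simp
    have h2 : ‖Complex.Gamma (1 - I * u)‖ ^ 2 = Real.pi * u / Real.sinh (Real.pi * u) := by
      rw [Gamma_one_add_I_mul, mul_comm, Complex.mul_conj, Complex.normSq_eq_norm_sq] at h1
      exact_mod_cast h1
    have hpu : 0 < Real.pi * u := by positivity
    rw [h2, div_le_iff₀ (Real.sinh_pos_iff.2 hpu), Real.sinh_eq]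
    have h3 : 1 + 2 * (Real.pi * u) ≤ Real.exp (2 * (Real.pi * u)) := by
      linarith [Real.add_one_le_exp (2 * (Real.pi * u))]
    have h4 : Real.exp (-(Real.pi * u)) * Real.exp (Real.pi * u) = 1 := by
      rw [← Real.exp_add]; simp
    have h5 : Real.exp (2 * (Real.pi * u)) * Real.exp (-(Real.pi * u)) ^ 2 = 1 := by
      rw [← Real.exp_nat_mul, ← Real.exp_add]; simp
    have h6 := mul_le_mul_of_nonneg_right h3 (sq_nonneg (Real.exp (-(Real.pi * u))))
    rw [h5] at h6
    nlinarith
  rcases lt_trichotomy u 0 with hu | rfl | hu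
  · have h := key (-u) (by linarith)
    rw [abs_of_neg hu]
    convert h using 2
    rw [← Complex.norm_conj, ← Gamma_one_add_I_mul]
    simp
  · simp
  · rw [abs_of_pos hu]
    exact key u hu

/-- Exponential decay of the Gamma function on the line `Re z = 1`. -/
lemma exists_norm_Gamma_le {θ : ℝ} (hθ : θ < Real.pi / 2) :
    ∃ C : ℝ, 0 ≤ C ∧ ∀ u : ℝ, ‖Complex.Gamma (1 - I * u)‖ ≤ C * Real.exp (-(θ * |u|)) := by
  have hδ : 0 < Real.pi - 2 * θ := by linarith
  -- Chosen so that 1 + 2π|u| ≤ c e^{(π - 2θ)|u|}; the exponent left over from e^{-π|u|} is then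
  -- -2θ|u|.
  set c := 1 + 2 * Real.pi / (Real.pi - 2 * θ) with hc
  have hc1 : 1 ≤ c := by
    have : 0 ≤ 2 * Real.pi / (Real.pi - 2 * θ) := by positivity
    linarith
  refine ⟨c, by linarith, fun u => ?_⟩
  have hu := abs_nonneg u
  refine (sq_le_sq₀ (norm_nonneg _) (by positivity)).1 ?_
  refine (norm_sq_Gamma_one_sub_I_mul_le u).trans ?_
  have h1 : 1 + 2 * Real.pi * |u| ≤ c * (1 + (Real.pi - 2 * θ) * |u|) := by
    have : c * (1 + (Real.pi - 2 * θ) * |u|) = 1 + 2 * Real.pi * |u|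
        + (2 * Real.pi / (Real.pi - 2 * θ) + (Real.pi - 2 * θ) * |u|) := by
      rw [hc]; field_simp; ring
    rw [this]
    have : 0 ≤ 2 * Real.pi / (Real.pi - 2 * θ) + (Real.pi - 2 * θ) * |u| := by positivity
    linarith
  have h2 : 1 + (Real.pi - 2 * θ) * |u| ≤ Real.exp ((Real.pi - 2 * θ) * |u|) := by
    linarith [Real.add_one_le_exp ((Real.pi - 2 * θ) * |u|)]
  calc (1 + 2 * Real.pi * |u|) * Real.exp (-(Real.pi * |u|))
      ≤ c * Real.exp ((Real.pi - 2 * θ) * |u|) * Real.exp (-(Real.pi * |u|)) := by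
        gcongr
        exact h1.trans (by gcongr)
    _ = c * Real.exp (-(θ * |u|)) ^ 2 := by
        rw [← Real.exp_nat_mul, mul_assoc, ← Real.exp_add]
        congr 2; push_cast; ring
    _ ≤ (c * Real.exp (-(θ * |u|))) ^ 2 := by
        rw [mul_pow]
        gcongr
        nlinarith

end Gamma

/-! ### Uniqueness for the Laplace transform -/

section LaplaceUniqueness

variable {E : Type*} [NormedAddCommGroup E] [NormedSpace ℝ E] [CompleteSpace E]

/-- Turns a test function g(t) into a continuous function of x = e^{-t}. At x = 0 the value is g(0)
= 0, as `Real.log 0 = 0`, and it matches the limit of g at infinity. -/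
lemma continuous_comp_neg_log {g : ℝ → ℝ} (hg : Continuous g) (hgc : HasCompactSupport g)
    (hg0 : tsupport g ⊆ Set.Ioi 0) : Continuous fun x => g (-Real.log x) := by
  refine continuous_iff_continuousAt.2 fun x => ?_
  rcases eq_or_ne x 0 with rfl | hx
  · have h0 : g 0 = 0 := by
      by_contra h
      exact lt_irrefl _ (Set.mem_Ioi.1 (hg0 (subset_tsupport _ h)))
    rw [continuousAt_iff_punctured_nhds]
    simp only [Real.log_zero, neg_zero, h0]
    have h1 : Tendsto g atTop (𝓝 0) :=
      hgc.is_zero_at_infty.mono_left atTop_le_cocompact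
    exact h1.comp (tendsto_neg_atBot_atTop.comp Real.tendsto_log_nhdsNE_zero)
  · exact hg.continuousAt.comp (Real.continuousAt_log hx).neg

/-- Uniqueness for the Laplace transform. -/
lemma eqOn_zero_of_laplace_eq_zero {h : ℝ → E} (hc : ContinuousOn h (Set.Ioi 0))
    (hi : ∀ x : ℝ, 0 < x → IntegrableOn (fun t => Real.exp (-x * t) • h t) (Set.Ioi 0))
    (h0 : ∀ x : ℝ, 0 < x → ∫ t in Set.Ioi (0 : ℝ), Real.exp (-x * t) • h t = 0) :
    Set.EqOn h 0 (Set.Ioi 0) := by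
  -- With the weight e^{-t} absorbed into k, the power (e^{-t})^n corresponds to x = n + 1 > 0. Thus
  -- k is orthogonal to polynomials in e^{-t}, by Weierstrass on [0, 1] to continuous functions of
  -- e^{-t}, and hence to all test functions on (0, ∞).
  set k : ℝ → E := fun t => Real.exp (-1 * t) • h t with hk
  have hki : IntegrableOn k (Set.Ioi 0) := hi 1 one_pos
  have hpow : ∀ (n : ℕ), (fun t => Real.exp (-t) ^ n • k t)
      = fun t => Real.exp (-(n + 1 : ℝ) * t) • h t := by
    intro n
    funext t
    rw [hk]
    simp only
    rw [smul_smul, ← Real.exp_nat_mul, ← Real.exp_add]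
    congr 2; ring
  have hpoly : ∀ q : Polynomial ℝ, ∫ t in Set.Ioi (0 : ℝ), q.eval (Real.exp (-t)) • k t = 0 := by
    intro q
    simp_rw [Polynomial.eval_eq_sum_range, Finset.sum_smul, mul_smul]
    rw [integral_finsetSum]
    · refine Finset.sum_eq_zero fun n _ => ?_
      rw [integral_smul, hpow, h0 _ (by positivity), smul_zero]
    · intro n _
      have : IntegrableOn (fun t => Real.exp (-t) ^ n • k t) (Set.Ioi 0) := by
        rw [hpow]; exact hi _ (by positivity)
      exact this.fun_smul _
  have hcont : ∀ φ : ℝ → ℝ, Continuous φ →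
      ∫ t in Set.Ioi (0 : ℝ), φ (Real.exp (-t)) • k t = 0 := by
    intro φ hφ
    have hmem : ∀ t ∈ Set.Ioi (0 : ℝ), Real.exp (-t) ∈ Set.Icc (0 : ℝ) 1 := fun t ht =>
      ⟨(Real.exp_pos _).le, Real.exp_le_one_iff.2 (by simpa using (Set.mem_Ioi.1 ht).le)⟩
    have hint : ∀ φ : ℝ → ℝ, Continuous φ →
        IntegrableOn (fun t => φ (Real.exp (-t)) • k t) (Set.Ioi 0) := by
      intro φ hφ
      obtain ⟨M, hM⟩ := isCompact_Icc.exists_bound_of_continuousOn (s := Set.Icc (0 : ℝ) 1)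
        hφ.continuousOn
      have h1 : Continuous fun t : ℝ => φ (Real.exp (-t)) := by fun_prop
      refine hki.bdd_smul M h1.aestronglyMeasurable ?_
      filter_upwards [ae_restrict_mem measurableSet_Ioi] with t ht using hM _ (hmem t ht)
    refine norm_le_zero_iff.1 (le_of_forall_pos_le_add fun ε hε => ?_)
    rw [zero_add]
    set J := ∫ t in Set.Ioi (0 : ℝ), ‖k t‖ with hJ
    have hJ0 : 0 ≤ J := integral_nonneg fun _ => norm_nonneg _
    obtain ⟨q, hq⟩ := exists_polynomial_near_of_continuousOn 0 1 φ hφ.continuousOn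
      (ε / (J + 1)) (by positivity)
    have h1 : ∫ t in Set.Ioi (0 : ℝ), φ (Real.exp (-t)) • k t
        = ∫ t in Set.Ioi (0 : ℝ), (φ (Real.exp (-t)) - q.eval (Real.exp (-t))) • k t := by
      simp_rw [sub_smul]
      rw [integral_sub (hint φ hφ) (hint _ q.continuous), hpoly, sub_zero]
    rw [h1]
    calc ‖∫ t in Set.Ioi (0 : ℝ), (φ (Real.exp (-t)) - q.eval (Real.exp (-t))) • k t‖
        ≤ ∫ t in Set.Ioi (0 : ℝ), ε / (J + 1) * ‖k t‖ := by
          refine norm_integral_le_of_norm_le (hki.norm.const_mul _) ?_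
          filter_upwards [ae_restrict_mem measurableSet_Ioi] with t ht
          rw [norm_smul, Real.norm_eq_abs, abs_sub_comm]
          have := (hq _ (hmem t ht)).le
          gcongr
      _ = ε / (J + 1) * J := integral_const_mul _ _
      _ ≤ ε := by
          rw [div_mul_eq_mul_div, div_le_iff₀ (by positivity)]
          nlinarith
  have hkc : ContinuousOn k (Set.Ioi 0) := by
    have : Continuous fun t : ℝ => Real.exp (-1 * t) := by fun_prop
    exact this.continuousOn.smul hc
  have hae : ∀ᵐ t, t ∈ Set.Ioi (0 : ℝ) → k t = 0 := by
    refine isOpen_Ioi.ae_eq_zero_of_integral_contDiff_smul_eq_zero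
      (hkc.locallyIntegrableOn measurableSet_Ioi) fun g hg hgc hgs => ?_
    have h1 := hcont _ (continuous_comp_neg_log hg.continuous hgc hgs)
    simp only [Real.log_exp, neg_neg] at h1
    rw [← h1, setIntegral_eq_integral_of_forall_compl_eq_zero]
    intro t ht
    rw [image_eq_zero_of_notMem_tsupport (fun h => ht (hgs h)), zero_smul]
  have hz : Set.EqOn k 0 (Set.Ioi 0) := by
    refine Measure.eqOn_open_of_ae_eq (μ := volume) ?_ isOpen_Ioi hkc continuousOn_const
    exact (ae_restrict_iff' measurableSet_Ioi).2 hae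
  intro t ht
  have := hz ht
  simpa [hk, Real.exp_ne_zero] using this

end LaplaceUniqueness

lemma integrable_exp_neg_mul_abs {a : ℝ} (ha : 0 < a) :
    Integrable fun u : ℝ => Real.exp (-(a * |u|)) := by
  have h1 : IntegrableOn (fun u : ℝ => Real.exp (-(a * |u|))) (Set.Ioi 0) :=
    (integrableOn_exp_mul_Ioi (neg_lt_zero.2 ha) 0).congr_fun
      (fun u hu => by simp only [abs_of_pos (Set.mem_Ioi.1 hu), neg_mul]) measurableSet_Ioi
  have h2 : IntegrableOn (fun u : ℝ => Real.exp (-(a * |u|))) (Set.Iic 0) := by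
    refine (integrableOn_exp_mul_Iic ha 0).congr_fun
      (fun u hu => by simp [abs_of_nonpos (Set.mem_Iic.1 hu)]) measurableSet_Iic
  have := h2.union h1
  rwa [Set.Iic_union_Ioi, integrableOn_univ] at this

/-! ### Mellin representation of t S_t L F by imaginary powers -/

section Formula

open Complex (I)

variable {E : Type*} [NormedAddCommGroup E] [NormedSpace ℂ E] [CompleteSpace E]
  {S : ℝ≥0 → E →L[ℂ] E} {C : ℝ}

omit [CompleteSpace E] in
lemma norm_laplace_le (hC : ∀ t F, ‖S t F‖ ≤ C * ‖F‖) {s : ℝ} (hs : 0 < s) (G : E) :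
    ‖laplace S s G‖ ≤ C / s * ‖G‖ := by
  have h : ∫ t in Set.Ioi (0 : ℝ), Real.exp (-s * t) * (C * ‖G‖) = C / s * ‖G‖ := by
    rw [integral_mul_const, integral_exp_mul_Ioi (neg_lt_zero.2 hs)]
    simp
    field_simp
  rw [← h]
  refine norm_integral_le_of_norm_le
    ((integrableOn_exp_mul_Ioi (neg_lt_zero.2 hs) 0).mul_const _)
    (Eventually.of_forall fun t => ?_)
  rw [norm_smul, Real.norm_of_nonneg (Real.exp_pos _).le]
  exact mul_le_mul_of_nonneg_left (norm_orbit_le hC G t) (Real.exp_pos _).le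

lemma laplace_negGenerator (hS : IsStronglyContinuousSemigroup S)
    (hC : ∀ t F, ‖S t F‖ ≤ C * ‖F‖) {s : ℝ} (hs : 0 < s) (F : (negGenerator S).domain) :
    laplace S s (negGenerator S F) = F - s • laplace S s F := by
  have h := (isResolventAt_laplaceCLM hS hC hs).2 F
  rw [map_add, map_smul, Complex.coe_smul] at h
  simp only [laplaceCLM_apply] at h
  rw [← h]
  abel_nf
  simp [h]

/-- With R_s the resolvent and F = L G, R_s² L F = (1 - s R_s)² G stays bounded as s → 0; at
infinity ‖R_s‖ ≤ C/s twice gives the decay. Only the first regime needs F in the range. -/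
lemma norm_laplace_laplace_le (hS : IsStronglyContinuousSemigroup S)
    (hC : ∀ t F, ‖S t F‖ ≤ C * ‖F‖) (hC0 : 0 ≤ C) (F G : (negGenerator S).domain)
    (hG : negGenerator S G = F) {s : ℝ} (hs : 0 < s) :
    ‖laplace S s (laplace S s (negGenerator S F))‖
      ≤ ((1 + C) ^ 2 * ‖(G : E)‖ + C ^ 2 * ‖negGenerator S F‖) * (1 + s ^ 2)⁻¹ := by
  set A := negGenerator S F
  have e : ∀ H : E, ‖H - s • laplace S s H‖ ≤ (1 + C) * ‖H‖ := fun H => by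
    refine (norm_sub_le _ _).trans ?_
    rw [norm_smul, Real.norm_of_nonneg hs.le]
    have := mul_le_mul_of_nonneg_left (norm_laplace_le hC hs H) hs.le
    have h2 : s * (C / s * ‖H‖) = C * ‖H‖ := by field_simp
    linarith
  have h1 : ‖laplace S s (laplace S s A)‖ ≤ (1 + C) ^ 2 * ‖(G : E)‖ := by
    have e1 : laplace S s A = F - s • laplace S s F := laplace_negGenerator hS hC hs F
    have e2 : laplace S s F = G - s • laplace S s G := by
      rw [← hG]; exact laplace_negGenerator hS hC hs G
    have e3 : laplace S s (laplace S s A) = laplace S s F - s • laplace S s (laplace S s F) := by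
      rw [e1]
      simp only [← laplaceCLM_apply hS hC hs]
      rw [map_sub, ContinuousLinearMap.map_smul_of_tower]
    rw [e3]
    refine (e _).trans ?_
    rw [pow_two, mul_assoc]
    gcongr
    rw [e2]
    exact e _
  have h2 : s ^ 2 * ‖laplace S s (laplace S s A)‖ ≤ C ^ 2 * ‖A‖ := by
    have := (norm_laplace_le hC hs (laplace S s A)).trans
      (mul_le_mul_of_nonneg_left (norm_laplace_le hC hs A) (by positivity))
    have := mul_le_mul_of_nonneg_left this (sq_nonneg s)
    refine this.trans (le_of_eq ?_)
    field_simp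
  rw [← div_eq_mul_inv, le_div_iff₀ (by positivity)]
  linarith

lemma continuousOn_laplace_laplace (hS : IsStronglyContinuousSemigroup S)
    (hC : ∀ t F, ‖S t F‖ ≤ C * ‖F‖) (G : E) :
    ContinuousOn (fun s => laplace S s (laplace S s G)) (Set.Ioi 0) := by
  have h : ContinuousOn (fun s => ∫ t in Set.Ioi (0 : ℝ), (t * Real.exp (-s * t)) • orbit S G t)
      (Set.Ioi 0) := by
    refine continuousOn_of_forall_continuousAt fun s₀ hs₀ => ?_
    have hs₀ : 0 < s₀ := hs₀
    refine continuousAt_of_dominated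
      (bound := fun t => (t * Real.exp (-(s₀ / 2) * t)) * (C * ‖G‖)) ?_ ?_
      ((integrableOn_mul_exp (half_pos hs₀)).mul_const _) ?_
    · exact Eventually.of_forall fun s =>
        (continuous_mul_exp_smul_orbit hS s G).aestronglyMeasurable
    · filter_upwards [lt_mem_nhds (half_lt_self hs₀)] with s hs
      filter_upwards [ae_restrict_mem measurableSet_Ioi] with t ht
      have ht : 0 < t := ht
      have h1 := (norm_nonneg _).trans (norm_orbit_le hC G t)
      rw [norm_smul, Real.norm_of_nonneg (by positivity)]
      refine mul_le_mul ?_ (norm_orbit_le hC G t) (norm_nonneg _) (by positivity)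
      gcongr
    · refine Eventually.of_forall fun t => ?_
      have : Continuous fun s : ℝ => t * Real.exp (-s * t) := by fun_prop
      exact (this.smul continuous_const).continuousAt
  exact h.congr fun s hs => laplace_laplace hS hC hs G

/-- The function `s ↦ s (s + L)⁻² L F`, whose Mellin transform on the imaginary axis gives the
imaginary powers of `L`. -/
def mellinOrbit (S : ℝ≥0 → E →L[ℂ] E) (A : E) (s : ℝ) : E :=
  (s : ℂ) • laplace S s (laplace S s A)

omit [CompleteSpace E] in
lemma cpow_smul_mellinOrbit (A : E) (y : ℝ) {s : ℝ} (hs : 0 < s) :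
    (s : ℂ) ^ (I * y - 1) • mellinOrbit S A s
      = (s : ℂ) ^ (I * (y : ℂ)) • laplace S s (laplace S s A) := by
  have : (s : ℂ) ≠ 0 := by exact_mod_cast hs.ne'
  rw [mellinOrbit, smul_smul, Complex.cpow_sub _ _ this, Complex.cpow_one, div_mul_cancel₀ _ this]

omit [CompleteSpace E] in
lemma norm_cpow_I_mul (y : ℝ) {s : ℝ} (hs : 0 < s) : ‖(s : ℂ) ^ (I * (y : ℂ))‖ = 1 := by
  rw [Complex.norm_cpow_eq_rpow_re_of_pos hs]; simp

lemma integrableOn_cpow_smul_laplace_laplace (hS : IsStronglyContinuousSemigroup S)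
    (hC : ∀ t F, ‖S t F‖ ≤ C * ‖F‖) (hC0 : 0 ≤ C) (F G : (negGenerator S).domain)
    (hG : negGenerator S G = F) (y : ℝ) :
    IntegrableOn (fun s : ℝ => (s : ℂ) ^ (I * (y : ℂ)) •
      laplace S s (laplace S s (negGenerator S F))) (Set.Ioi 0) := by
  refine Integrable.mono' (integrable_inv_one_add_sq.restrict.const_mul
    ((1 + C) ^ 2 * ‖(G : E)‖ + C ^ 2 * ‖negGenerator S F‖)) ?_ ?_
  · refine AEStronglyMeasurable.smul ?_
      ((continuousOn_laplace_laplace hS hC _).aestronglyMeasurable measurableSet_Ioi)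
    exact (Complex.measurable_ofReal.pow_const _).aestronglyMeasurable
  · filter_upwards [ae_restrict_mem measurableSet_Ioi] with s hs
    rw [norm_smul, norm_cpow_I_mul _ hs, one_mul]
    exact norm_laplace_laplace_le hS hC hC0 F G hG hs

lemma mellinConvergent_mellinOrbit (hS : IsStronglyContinuousSemigroup S)
    (hC : ∀ t F, ‖S t F‖ ≤ C * ‖F‖) (hC0 : 0 ≤ C) (F G : (negGenerator S).domain)
    (hG : negGenerator S G = F) (y : ℝ) :
    MellinConvergent (mellinOrbit S (negGenerator S F)) (I * y) :=
  (integrableOn_cpow_smul_laplace_laplace hS hC hC0 F G hG y).congr_fun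
    (fun _ hs => (cpow_smul_mellinOrbit _ y hs).symm) measurableSet_Ioi

omit [CompleteSpace E] in
lemma mellin_mellinOrbit (A : E) (y : ℝ) : mellin (mellinOrbit S A) (I * y)
    = ∫ s in Set.Ioi (0 : ℝ), (s : ℂ) ^ (I * (y : ℂ)) • laplace S s (laplace S s A) :=
  setIntegral_congr_fun measurableSet_Ioi fun _ hs => cpow_smul_mellinOrbit A y hs

lemma continuous_mellin_mellinOrbit (hS : IsStronglyContinuousSemigroup S)
    (hC : ∀ t F, ‖S t F‖ ≤ C * ‖F‖) (hC0 : 0 ≤ C) (F G : (negGenerator S).domain)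
    (hG : negGenerator S G = F) :
    Continuous fun y : ℝ => mellin (mellinOrbit S (negGenerator S F)) (I * y) := by
  simp_rw [mellin_mellinOrbit]
  refine continuous_of_dominated (bound := fun s =>
    ((1 + C) ^ 2 * ‖(G : E)‖ + C ^ 2 * ‖negGenerator S F‖) * (1 + s ^ 2)⁻¹) ?_ ?_
    (integrable_inv_one_add_sq.restrict.const_mul _) ?_
  · exact fun y =>
      (integrableOn_cpow_smul_laplace_laplace hS hC hC0 F G hG y).aestronglyMeasurable
  · intro y
    filter_upwards [ae_restrict_mem measurableSet_Ioi] with s hs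
    rw [norm_smul, norm_cpow_I_mul _ hs, one_mul]
    exact norm_laplace_laplace_le hS hC hC0 F G hG hs
  · filter_upwards [ae_restrict_mem measurableSet_Ioi] with s hs
    have hs' : (s : ℂ) ≠ 0 := by exact_mod_cast (Set.mem_Ioi.1 hs).ne'
    refine Continuous.smul ?_ continuous_const
    exact Continuous.const_cpow (by fun_prop) (Or.inl hs')

variable {P : ℝ → E →L[ℂ] E} {K ω : ℝ}

/-- The formula defining the imaginary powers is a Mellin transform on the imaginary axis, so it can
be inverted. -/
lemma mellin_eq_imaginaryPower (hS : IsStronglyContinuousSemigroup S)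
    (hC : ∀ t F, ‖S t F‖ ≤ C * ‖F‖)
    (hP : ∀ u, IsImaginaryPower (negGenerator S) u (P u)) (F G : (negGenerator S).domain)
    (hG : negGenerator S G = F) (y : ℝ) :
    mellin (mellinOrbit S (negGenerator S F)) (I * y)
      = (Complex.Gamma (1 - I * y) * Complex.Gamma (1 + I * y)) • P y F := by
  have hne : Complex.Gamma (1 - I * y) * Complex.Gamma (1 + I * y) ≠ 0 := by
    rw [Gamma_one_add_I_mul]
    exact mul_ne_zero (Gamma_one_sub_I_mul_ne_zero y) (by simp [Gamma_one_sub_I_mul_ne_zero y])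
  rw [(hP y).1 F ⟨G, hG⟩, imaginaryPowerFormula, smul_smul, mul_inv_cancel₀ hne, one_smul,
    mellin_mellinOrbit]
  refine setIntegral_congr_fun measurableSet_Ioi fun s hs => ?_
  simp only [resolventAt_negGenerator hS hC hs]

/-- No regularity of P in u is assumed. On Dom(L) ∩ Ran(L) it comes from the Mellin integral,
divided by the nonvanishing Gamma factors. -/
lemma continuous_imaginaryPower (hS : IsStronglyContinuousSemigroup S)
    (hC : ∀ t F, ‖S t F‖ ≤ C * ‖F‖) (hC0 : 0 ≤ C)
    (hP : ∀ u, IsImaginaryPower (negGenerator S) u (P u)) (F G : (negGenerator S).domain)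
    (hG : negGenerator S G = F) : Continuous fun u => P u F := by
  have h1 := continuous_mellin_mellinOrbit hS hC hC0 F G hG
  have hne : ∀ y : ℝ, Complex.Gamma (1 - I * y) * Complex.Gamma (1 + I * y) ≠ 0 := fun y => by
    rw [Gamma_one_add_I_mul]
    exact mul_ne_zero (Gamma_one_sub_I_mul_ne_zero y) (by simp [Gamma_one_sub_I_mul_ne_zero y])
  have h2 : Continuous fun y : ℝ => Complex.Gamma (1 - I * y) * Complex.Gamma (1 + I * y) := by
    simp_rw [Gamma_one_add_I_mul]
    exact continuous_Gamma_one_sub_I_mul.mul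
      (Complex.continuous_conj.comp continuous_Gamma_one_sub_I_mul)
  refine ((h2.inv₀ hne).smul h1).congr fun y => ?_
  simp only [Pi.smul_apply', Pi.inv_apply]
  rw [mellin_eq_imaginaryPower hS hC hP F G hG, smul_smul, inv_mul_cancel₀ (hne y), one_smul]

omit [CompleteSpace E] in
lemma integrable_smul_imaginaryPower (hPK : ∀ u F, ‖P u F‖ ≤ K * Real.exp (ω * |u|) * ‖F‖)
    {k : ℝ → ℂ} (hk : AEStronglyMeasurable k) {c a : ℝ} (ha : ω < a)
    (hb : ∀ u, ‖k u‖ ≤ c * Real.exp (-(a * |u|))) {F : E}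
    (hm : AEStronglyMeasurable fun u => P u F) : Integrable fun u => k u • P u F := by
  refine Integrable.mono' ((integrable_exp_neg_mul_abs (sub_pos.2 ha)).const_mul (c * (K * ‖F‖)))
    (hk.smul hm) (Eventually.of_forall fun u => ?_)
  rw [norm_smul]
  calc ‖k u‖ * ‖P u F‖ ≤ (c * Real.exp (-(a * |u|))) * (K * Real.exp (ω * |u|) * ‖F‖) :=
        mul_le_mul (hb u) (hPK u F) (norm_nonneg _) ((norm_nonneg _).trans (hb u))
    _ = c * (K * ‖F‖) * Real.exp (-((a - ω) * |u|)) := by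
        rw [show -((a - ω) * |u|) = -(a * |u|) + ω * |u| by ring, Real.exp_add]
        ring

lemma norm_exp_I_mul_log (u x : ℝ) : ‖Complex.exp (I * u * Real.log x)‖ = 1 := by
  rw [Complex.norm_exp]; simp

lemma cpow_I_mul_eq_exp (u : ℝ) {t : ℝ} (ht : 0 < t) :
    (t : ℂ) ^ (I * (u : ℂ)) = Complex.exp (I * u * Real.log t) := by
  have : (t : ℂ) ≠ 0 := by exact_mod_cast ht.ne'
  rw [Complex.cpow_def_of_ne_zero this, Complex.ofReal_log ht.le, mul_comm]

/-- The Mellin representation of `t ↦ t S_t L F`, up to the factor `2π`. -/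
def mellinRep (P : ℝ → E →L[ℂ] E) (F : E) (t : ℝ) : E :=
  ∫ u : ℝ, (Complex.exp (I * u * Real.log t) * Complex.Gamma (1 - I * u)) • P u F

omit [CompleteSpace E] in
lemma integrable_Gamma_smul (hPK : ∀ u F, ‖P u F‖ ≤ K * Real.exp (ω * |u|) * ‖F‖)
    (hω : ω < Real.pi / 2) {F : E} (hm : AEStronglyMeasurable fun u => P u F) :
    Integrable fun u : ℝ => Complex.Gamma (1 - I * u) • P u F := by
  obtain ⟨a, ha, ha'⟩ := exists_between hω
  obtain ⟨c, -, hc⟩ := exists_norm_Gamma_le ha'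
  exact integrable_smul_imaginaryPower hPK continuous_Gamma_one_sub_I_mul.aestronglyMeasurable
    ha hc hm

omit [CompleteSpace E] in
lemma norm_mellinRep_integrand (F : E) (u t : ℝ) :
    ‖(Complex.exp (I * u * Real.log t) * Complex.Gamma (1 - I * u)) • P u F‖
      = ‖Complex.Gamma (1 - I * u) • P u F‖ := by
  rw [norm_smul, norm_mul, norm_exp_I_mul_log, one_mul, norm_smul]

omit [CompleteSpace E] in
lemma continuousOn_mellinRep (hPK : ∀ u F, ‖P u F‖ ≤ K * Real.exp (ω * |u|) * ‖F‖)
    (hω : ω < Real.pi / 2) {F : E} (hm : AEStronglyMeasurable fun u => P u F) :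
    ContinuousOn (mellinRep P F) (Set.Ioi 0) := by
  refine continuousOn_of_forall_continuousAt fun t ht => ?_
  refine continuousAt_of_dominated (Eventually.of_forall fun t => ?_)
    (Eventually.of_forall fun t => Eventually.of_forall fun u =>
      (norm_mellinRep_integrand F u t).le) (integrable_Gamma_smul hPK hω hm).norm
    (Eventually.of_forall fun u => ?_)
  · refine AEStronglyMeasurable.smul ?_ hm
    have : Continuous fun u : ℝ => Complex.exp (I * u * Real.log t) := by fun_prop
    exact (this.mul continuous_Gamma_one_sub_I_mul).aestronglyMeasurable
  · refine ContinuousAt.smul (ContinuousAt.mul ?_ continuousAt_const) continuousAt_const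
    refine Complex.continuous_exp.continuousAt.comp ?_
    refine continuousAt_const.mul ?_
    exact Complex.continuous_ofReal.continuousAt.comp
      (Real.continuousAt_log (Set.mem_Ioi.1 ht).ne')

omit [CompleteSpace E] in
lemma norm_mellinRep_le (F : E) (t : ℝ) :
    ‖mellinRep P F t‖ ≤ ∫ u : ℝ, ‖Complex.Gamma (1 - I * u) • P u F‖ := by
  refine (norm_integral_le_integral_norm _).trans (le_of_eq ?_)
  simp_rw [norm_mellinRep_integrand]

omit [CompleteSpace E] in
lemma integrableOn_exp_smul_mellinRep
    (hPK : ∀ u F, ‖P u F‖ ≤ K * Real.exp (ω * |u|) * ‖F‖)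
    (hω : ω < Real.pi / 2) {F : E} (hm : AEStronglyMeasurable fun u => P u F)
    {x : ℝ} (hx : 0 < x) :
    IntegrableOn (fun t => Real.exp (-x * t) • mellinRep P F t) (Set.Ioi 0) := by
  refine (integrableOn_exp_mul_Ioi (neg_lt_zero.2 hx) 0).smul_bdd _
    ((continuousOn_mellinRep hPK hω hm).aestronglyMeasurable measurableSet_Ioi)
    (Eventually.of_forall fun t => norm_mellinRep_le F t)

/-- After Fubini, the Laplace transform of t^{iu} is Γ(1 + iu) x^{-1-iu}; it supplies the second
Gamma factor of the imaginary power formula. -/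
lemma integral_exp_smul_mellinRep
    (hPK : ∀ u F, ‖P u F‖ ≤ K * Real.exp (ω * |u|) * ‖F‖)
    (hω : ω < Real.pi / 2) {F : E} (hm : AEStronglyMeasurable fun u => P u F)
    {x : ℝ} (hx : 0 < x) :
    ∫ t in Set.Ioi (0 : ℝ), Real.exp (-x * t) • mellinRep P F t
      = x⁻¹ • ∫ u : ℝ, (x : ℂ) ^ (-(I * (u : ℂ))) •
        (Complex.Gamma (1 - I * u) * Complex.Gamma (1 + I * u)) • P u F := by
  have h1 : ∀ t : ℝ, Real.exp (-x * t) • mellinRep P F t = ∫ u : ℝ, Real.exp (-x * t) •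
      (Complex.exp (I * u * Real.log t) * Complex.Gamma (1 - I * u)) • P u F := fun t => by
    rw [mellinRep, integral_smul]
  simp_rw [h1]
  rw [integral_integral_swap, ← integral_smul]
  · refine integral_congr_ae (Eventually.of_forall fun u => ?_)
    have h2 := Complex.integral_cpow_mul_exp_neg_mul_Ioi (a := 1 + I * u) (r := x) (by simp) hx
    have h3 : ∫ t in Set.Ioi (0 : ℝ), Real.exp (-x * t) •
        (Complex.exp (I * u * Real.log t) * Complex.Gamma (1 - I * u)) • P u F
        = (∫ t in Set.Ioi (0 : ℝ), (t : ℂ) ^ (1 + I * (u : ℂ) - 1) * Complex.exp (-(x * t))) •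
          Complex.Gamma (1 - I * u) • P u F := by
      rw [← integral_smul_const]
      refine setIntegral_congr_fun measurableSet_Ioi fun t ht => ?_
      rw [add_sub_cancel_left, cpow_I_mul_eq_exp u ht, ← Complex.coe_smul, smul_smul, smul_smul]
      congr 1
      push_cast
      ring_nf
    have hx' : (x : ℂ) ≠ 0 := by exact_mod_cast hx.ne'
    simp only
    rw [h3, h2, ← Complex.coe_smul, smul_smul, smul_smul, smul_smul]
    congr 1
    rw [one_div, Complex.cpow_add _ _ (inv_ne_zero hx'), Complex.cpow_one,
      Complex.inv_cpow _ _ (by rw [Complex.arg_ofReal_of_nonneg hx.le]; exact Real.pi_pos.ne),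
      Complex.cpow_neg]
    push_cast
    ring
  · refine Integrable.mono' ((integrableOn_exp_mul_Ioi (neg_lt_zero.2 hx) 0).mul_prod
      (integrable_Gamma_smul hPK hω hm).norm) ?_ (Eventually.of_forall fun z => ?_)
    · have e1 : Measurable fun z : ℝ × ℝ => Real.exp (-x * z.1) := by fun_prop
      have e2 : Measurable fun z : ℝ × ℝ => Complex.exp (I * z.2 * Real.log z.1) := by fun_prop
      have e3 : Measurable fun z : ℝ × ℝ => Complex.Gamma (1 - I * z.2) :=
        continuous_Gamma_one_sub_I_mul.measurable.comp measurable_snd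
      exact e1.aestronglyMeasurable.smul ((e2.mul e3).aestronglyMeasurable.smul hm.comp_snd)
    · simp only [Function.uncurry]
      rw [norm_smul, norm_mellinRep_integrand, Real.norm_of_nonneg (Real.exp_pos _).le]

/-- For `F` in the domain and the range of `L`, `t S_t L F` is an inverse Mellin transform of the
imaginary powers of `L`. -/
lemma smul_orbit_eq_mellinRep (hS : IsStronglyContinuousSemigroup S)
    (hC : ∀ t F, ‖S t F‖ ≤ C * ‖F‖) (hC0 : 0 ≤ C)
    (hP : ∀ u, IsImaginaryPower (negGenerator S) u (P u))
    (hPK : ∀ u F, ‖P u F‖ ≤ K * Real.exp (ω * |u|) * ‖F‖) (hω0 : 0 ≤ ω)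
    (hω : ω < Real.pi / 2) (F G : (negGenerator S).domain)
    (hG : negGenerator S G = F) {t : ℝ} (ht : 0 < t) :
    t • orbit S (negGenerator S F) t = (1 / (2 * Real.pi)) • mellinRep P F t := by
  set A := negGenerator S F with hA
  have hm : AEStronglyMeasurable fun u => P u F :=
    (continuous_imaginaryPower hS hC hC0 hP F G hG).aestronglyMeasurable
  -- Of the two Gamma factors, one beats e^{ω|u|} and the other need only be bounded.
  have hvert : Complex.VerticalIntegrable (mellin (mellinOrbit S A)) 0 := by
    have h1 : Integrable fun y : ℝ => mellin (mellinOrbit S A) (I * y) := by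
      simp_rw [hA, mellin_eq_imaginaryPower hS hC hP F G hG]
      obtain ⟨a, ha, ha'⟩ := exists_between hω
      obtain ⟨c, hc0, hc⟩ := exists_norm_Gamma_le ha'
      refine integrable_smul_imaginaryPower hPK (c := c * c) ?_ ha (fun u => ?_) hm
      · simp_rw [Gamma_one_add_I_mul]
        exact (continuous_Gamma_one_sub_I_mul.mul (Complex.continuous_conj.comp
          continuous_Gamma_one_sub_I_mul)).aestronglyMeasurable
      · have h0 : 0 ≤ a * |u| := mul_nonneg (hω0.trans ha.le) (abs_nonneg u)
        rw [norm_mul, Gamma_one_add_I_mul, Complex.norm_conj, mul_assoc]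
        refine mul_le_mul ((hc u).trans ?_) (hc u) (norm_nonneg _) hc0
        exact mul_le_of_le_one_right hc0 (Real.exp_le_one_iff.2 (by linarith))
    have e : ∀ y : ℝ, ((0 : ℝ) : ℂ) + y * I = I * y := fun y => by simp [mul_comm]
    simpa only [Complex.VerticalIntegrable, e] using h1
  have hinv : ∀ s : ℝ, 0 < s → mellinOrbit S A s = (1 / (2 * Real.pi)) • ∫ y : ℝ,
      (s : ℂ) ^ (-(I * (y : ℂ))) •
        (Complex.Gamma (1 - I * y) * Complex.Gamma (1 + I * y)) • P y F := by
    intro s hs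
    have h1 := mellinConvergent_mellinOrbit hS hC hC0 F G hG 0
    have h2 : ContinuousAt (mellinOrbit S A) s :=
      Complex.continuous_ofReal.continuousAt.smul
        ((continuousOn_laplace_laplace hS hC A).continuousAt (Ioi_mem_nhds hs))
    rw [← mellinInv_mellin_eq 0 (mellinOrbit S A) hs (by simpa using h1) hvert h2, mellinInv]
    congr 2
    funext y
    rw [← mellin_eq_imaginaryPower hS hC hP F G hG]
    simp [mul_comm, hA]
  -- By inversion the right side is x⁻¹ `mellinOrbit` at x, that is (x + L)⁻² L F, which is also the
  -- Laplace transform of t S_t L F.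
  have hlap : ∀ x : ℝ, 0 < x →
      ∫ t in Set.Ioi (0 : ℝ), Real.exp (-x * t) • t • orbit S A t
        = (1 / (2 * Real.pi)) • ∫ t in Set.Ioi (0 : ℝ), Real.exp (-x * t) • mellinRep P F t := by
    intro x hx
    have h1 := hinv x hx
    rw [integral_exp_smul_mellinRep hPK hω hm hx, smul_comm, ← h1, mellinOrbit,
      laplace_laplace hS hC hx, Complex.coe_smul, smul_smul, inv_mul_cancel₀ hx.ne', one_smul]
    simp_rw [smul_smul, mul_comm]
  have hi1 : ∀ x : ℝ, 0 < x →
      IntegrableOn (fun t => Real.exp (-x * t) • t • orbit S A t) (Set.Ioi 0) := by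
    intro x hx
    have := integrableOn_mul_exp_smul_orbit hS hC hx A
    simp_rw [smul_smul, mul_comm _ (_ : ℝ)]
    simpa only [mul_comm] using this
  have hi2 := fun (x : ℝ) (hx : 0 < x) => (integrableOn_exp_smul_mellinRep hPK hω hm hx).fun_smul
    (1 / (2 * Real.pi))
  have hz := eqOn_zero_of_laplace_eq_zero
    (h := fun t => t • orbit S A t - (1 / (2 * Real.pi)) • mellinRep P F t) ?_ ?_ ?_
  · exact sub_eq_zero.1 (hz ht)
  · refine ContinuousOn.sub ?_ ((continuousOn_mellinRep hPK hω hm).const_smul _)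
    exact (continuous_id.smul (continuous_orbit hS A)).continuousOn
  · intro x hx
    simp_rw [smul_sub, smul_comm _ (1 / (2 * Real.pi))]
    exact (hi1 x hx).sub (hi2 x hx)
  · intro x hx
    simp_rw [smul_sub, smul_comm _ (1 / (2 * Real.pi))]
    rw [integral_sub (hi1 x hx) (hi2 x hx), integral_smul, hlap x hx, sub_self]

end Formula

open Complex (I)

/-! ### Scalar kernels on a strip -/

section Kernel

lemma norm_exp_sub_exp_le {M : ℝ} {a b : ℂ} (ha : a.re ≤ M) (hb : b.re ≤ M) :
    ‖Complex.exp b - Complex.exp a‖ ≤ Real.exp M * ‖b - a‖ := by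
  have hconv : Convex ℝ {z : ℂ | z.re ≤ M} := convex_halfSpace_re_le M
  refine hconv.norm_image_sub_le_of_norm_hasDerivWithin_le (f := Complex.exp) (f' := Complex.exp)
    (fun z _ => (Complex.hasDerivAt_exp z).hasDerivWithinAt) (fun z hz => ?_) ha hb
  rw [Complex.norm_exp]
  exact Real.exp_le_exp.2 hz

lemma norm_exp_sub_one_sub_le (w : ℂ) :
    ‖Complex.exp w - 1 - w‖ ≤ ‖w‖ ^ 2 * Real.exp ‖w‖ := by
  have := Complex.norm_exp_sub_sum_le_norm_mul_exp w 2
  simpa [Finset.sum_range_succ, sub_sub] using this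

lemma re_I_mul_mul_le (u : ℝ) (ζ : ℂ) : (I * u * ζ).re ≤ |ζ.im| * |u| := by
  have : (I * u * ζ).re = -(u * ζ.im) := by simp [mul_comm]
  rw [this, ← abs_mul, mul_comm]
  exact neg_le_abs _

/-- The kernel `Γ(1 - iu) / (2π i u)`. -/
def gammaKernel (u : ℝ) : ℂ := Complex.Gamma (1 - I * u) / (2 * Real.pi * (I * u))

lemma measurable_gammaKernel : Measurable gammaKernel := by
  unfold gammaKernel
  exact continuous_Gamma_one_sub_I_mul.measurable.div (by fun_prop)

lemma mul_gammaKernel {u : ℝ} (hu : u ≠ 0) :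
    I * u * gammaKernel u = (1 / (2 * Real.pi) : ℝ) * Complex.Gamma (1 - I * u) := by
  have : (u : ℂ) ≠ 0 := by exact_mod_cast hu
  have hpi : (Real.pi : ℂ) ≠ 0 := by exact_mod_cast Real.pi_ne_zero
  have := Complex.I_ne_zero
  rw [gammaKernel]
  push_cast
  field_simp

lemma exists_abs_mul_norm_gammaKernel_le {θ : ℝ} (hθ : θ < Real.pi / 2) :
    ∃ c : ℝ, 0 ≤ c ∧ ∀ u : ℝ, |u| * ‖gammaKernel u‖ ≤ c * Real.exp (-(θ * |u|)) := by
  obtain ⟨c, hc0, hc⟩ := exists_norm_Gamma_le hθ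
  refine ⟨1 / (2 * Real.pi) * c, by positivity, fun u => ?_⟩
  rcases eq_or_ne u 0 with rfl | hu
  · simp; positivity
  have h := congrArg norm (mul_gammaKernel hu)
  rw [norm_mul, norm_mul, norm_mul, Complex.norm_I, one_mul, Complex.norm_real, Complex.norm_real,
    Real.norm_eq_abs, Real.norm_of_nonneg (by positivity)] at h
  rw [h, mul_assoc]
  exact mul_le_mul_of_nonneg_left (hc u) (by positivity)

/-- The kernel `(e^{iuζ} - 1) Γ(1 - iu) / (2π i u)`, a primitive in `ζ` of
`e^{iuζ} Γ(1 - iu) / 2π`. -/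
def expKernel (ζ : ℂ) (u : ℝ) : ℂ := (Complex.exp (I * u * ζ) - 1) * gammaKernel u

/-- The weight `e^{φ|u|} |Γ(1 - iu)| / 2π` (which vanishes at `u = 0`). -/
def sectorWeight (φ u : ℝ) : ℝ := Real.exp (φ * |u|) * (|u| * ‖gammaKernel u‖)

lemma sectorWeight_nonneg (φ u : ℝ) : 0 ≤ sectorWeight φ u := by
  unfold sectorWeight; positivity

lemma measurable_sectorWeight (φ : ℝ) : Measurable (sectorWeight φ) := by
  have := measurable_gammaKernel.norm
  unfold sectorWeight
  fun_prop

/-- A Gamma decay rate θ between ω + φ and π/2 still leaves θ - φ > ω after paying for e^{φ|u|}. -/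
lemma exists_sectorWeight_le {ω φ : ℝ} (h : ω + φ < Real.pi / 2) :
    ∃ c a : ℝ, 0 ≤ c ∧ ω < a ∧ ∀ u, sectorWeight φ u ≤ c * Real.exp (-(a * |u|)) := by
  obtain ⟨θ, h1, h2⟩ := exists_between h
  obtain ⟨c, hc0, hc⟩ := exists_abs_mul_norm_gammaKernel_le h2
  refine ⟨c, θ - φ, hc0, by linarith, fun u => ?_⟩
  have := mul_le_mul_of_nonneg_left (hc u) (Real.exp_pos (φ * |u|)).le
  refine this.trans (le_of_eq ?_)
  rw [mul_left_comm, ← Real.exp_add]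
  congr 2; ring

lemma measurable_expKernel (ζ : ℂ) : Measurable (expKernel ζ) := by
  have h1 := measurable_gammaKernel
  have h2 : Measurable fun u : ℝ => Complex.exp (I * u * ζ) - 1 := by fun_prop
  exact h2.mul h1

/-- On the strip |Im ζ| ≤ φ the mean value inequality yields a factor |u| ‖ζ - ζ'‖, and |u| cancels
the pole of `gammaKernel`. With ζ = log z this is the source of every Lipschitz bound below. -/
lemma norm_expKernel_sub_le {φ : ℝ} {ζ ζ' : ℂ} (h : |ζ.im| ≤ φ) (h' : |ζ'.im| ≤ φ) (u : ℝ) :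
    ‖expKernel ζ u - expKernel ζ' u‖ ≤ ‖ζ - ζ'‖ * sectorWeight φ u := by
  have h1 : ∀ {ζ : ℂ}, |ζ.im| ≤ φ → (I * u * ζ).re ≤ φ * |u| := fun {ζ} hζ =>
    (re_I_mul_mul_le u ζ).trans (mul_le_mul_of_nonneg_right hζ (abs_nonneg u))
  have h2 := norm_exp_sub_exp_le (h1 h') (h1 h)
  have h3 : expKernel ζ u - expKernel ζ' u
      = (Complex.exp (I * u * ζ) - Complex.exp (I * u * ζ')) * gammaKernel u := by
    simp only [expKernel]; ring
  have h4 : ‖I * u * ζ - I * u * ζ'‖ = |u| * ‖ζ - ζ'‖ := by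
    rw [← mul_sub, norm_mul, norm_mul, Complex.norm_I, one_mul, Complex.norm_real,
      Real.norm_eq_abs]
  rw [h4] at h2
  rw [h3, norm_mul]
  refine (mul_le_mul_of_nonneg_right h2 (norm_nonneg _)).trans (le_of_eq ?_)
  rw [sectorWeight]; ring

lemma expKernel_zero (u : ℝ) : expKernel 0 u = 0 := by simp [expKernel]

lemma norm_expKernel_le {φ : ℝ} {ζ : ℂ} (h : |ζ.im| ≤ φ) (u : ℝ) :
    ‖expKernel ζ u‖ ≤ ‖ζ‖ * sectorWeight φ u := by
  simpa [expKernel_zero] using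
    norm_expKernel_sub_le h (ζ' := 0) (by simpa using (abs_nonneg _).trans h) u

/-- The derivative in `ζ` of `expKernel`. -/
def expKernelDeriv (ζ : ℂ) (u : ℝ) : ℂ := Complex.exp (I * u * ζ) * (I * u * gammaKernel u)

lemma measurable_expKernelDeriv (ζ : ℂ) : Measurable (expKernelDeriv ζ) := by
  have h1 := measurable_gammaKernel
  have h2 : Measurable fun u : ℝ => Complex.exp (I * u * ζ) := by fun_prop
  have h3 : Measurable fun u : ℝ => I * (u : ℂ) := by fun_prop
  exact h2.mul (h3.mul h1)

lemma norm_expKernelDeriv_le {φ : ℝ} {ζ : ℂ} (h : |ζ.im| ≤ φ) (u : ℝ) :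
    ‖expKernelDeriv ζ u‖ ≤ sectorWeight φ u := by
  rw [expKernelDeriv, sectorWeight, norm_mul, norm_mul, norm_mul, Complex.norm_I, one_mul,
    Complex.norm_real, Real.norm_eq_abs, Complex.norm_exp]
  gcongr
  exact (re_I_mul_mul_le u ζ).trans (mul_le_mul_of_nonneg_right h (abs_nonneg u))

/-- The remainder has a factor u²: one |u| cancels the pole, the other is at most δ⁻¹ e^{δ|u|}.
Hence the margin 2δ, one δ for this and one for e^{|u| ‖h‖}. -/
lemma norm_expKernel_taylor_le {φ δ : ℝ} (hδ : 0 < δ) {ζ h : ℂ} (hζ : |ζ.im| + 2 * δ ≤ φ)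
    (hh : ‖h‖ ≤ δ) (u : ℝ) :
    ‖expKernel (ζ + h) u - expKernel ζ u - h * expKernelDeriv ζ u‖
      ≤ δ⁻¹ * ‖h‖ ^ 2 * sectorWeight φ u := by
  have h1 : expKernel (ζ + h) u - expKernel ζ u - h * expKernelDeriv ζ u
      = Complex.exp (I * u * ζ) * (Complex.exp (I * u * h) - 1 - I * u * h) * gammaKernel u := by
    simp only [expKernel, expKernelDeriv, mul_add, Complex.exp_add]; ring
  have h2 := norm_exp_sub_one_sub_le (I * u * h)
  have h3 : ‖I * u * h‖ = |u| * ‖h‖ := by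
    rw [norm_mul, norm_mul, Complex.norm_I, one_mul, Complex.norm_real, Real.norm_eq_abs]
  rw [h3] at h2
  have hu := abs_nonneg u
  have h4 : |u| ≤ δ⁻¹ * Real.exp (δ * |u|) := by
    rw [inv_mul_eq_div, le_div_iff₀ hδ]
    linarith [Real.add_one_le_exp (δ * |u|)]
  rw [h1, norm_mul, norm_mul, Complex.norm_exp]
  calc Real.exp (I * u * ζ).re * ‖Complex.exp (I * u * h) - 1 - I * u * h‖ * ‖gammaKernel u‖
      ≤ Real.exp (|ζ.im| * |u|) * ((|u| * ‖h‖) ^ 2 * Real.exp (|u| * δ)) * ‖gammaKernel u‖ := by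
        gcongr
        · exact re_I_mul_mul_le u ζ
        · refine h2.trans ?_
          gcongr
    _ = ‖h‖ ^ 2 * (|u| * Real.exp ((|ζ.im| + δ) * |u|)) * (|u| * ‖gammaKernel u‖) := by
        rw [add_mul, Real.exp_add, mul_comm |u| δ]; ring
    _ ≤ ‖h‖ ^ 2 * (δ⁻¹ * Real.exp (φ * |u|)) * (|u| * ‖gammaKernel u‖) := by
        refine mul_le_mul_of_nonneg_right (mul_le_mul_of_nonneg_left ?_ (by positivity))
          (by positivity)
        calc |u| * Real.exp ((|ζ.im| + δ) * |u|)
            ≤ δ⁻¹ * Real.exp (δ * |u|) * Real.exp ((|ζ.im| + δ) * |u|) := by gcongr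
          _ = δ⁻¹ * Real.exp ((|ζ.im| + 2 * δ) * |u|) := by
              rw [mul_assoc, ← Real.exp_add]; congr 2; ring
          _ ≤ δ⁻¹ * Real.exp (φ * |u|) := by gcongr
    _ = δ⁻¹ * ‖h‖ ^ 2 * sectorWeight φ u := by rw [sectorWeight]; ring

end Kernel

/-! ### Operator integrals against an exponentially bounded family -/

section Family

variable {E : Type*} [NormedAddCommGroup E] [NormedSpace ℂ E]

/-- A strongly measurable family of operators with `‖P_u F‖ ≤ K e^{ω|u|} ‖F‖`. -/
structure IsExpBoundedFamily (P : ℝ → E →L[ℂ] E) (K ω : ℝ) : Prop where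
  nonneg : 0 ≤ K
  aestronglyMeasurable : ∀ F, AEStronglyMeasurable fun u => P u F
  norm_apply_le : ∀ u F, ‖P u F‖ ≤ K * Real.exp (ω * |u|) * ‖F‖

open Classical in
/-- The operator `F ↦ ∫ k(u) P_u F du` (`0` if there is none). -/
def weightedIntegral (P : ℝ → E →L[ℂ] E) (k : ℝ → ℂ) : E →L[ℂ] E :=
  if h : ∃ A : E →L[ℂ] E, ∀ F, A F = ∫ u, k u • P u F then h.choose else 0

variable {P : ℝ → E →L[ℂ] E} {K ω : ℝ}

namespace IsExpBoundedFamily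

lemma integrable_smul (hP : IsExpBoundedFamily P K ω) {k : ℝ → ℂ} (hk : Measurable k) {c φ : ℝ}
    (hφ : ω + φ < Real.pi / 2) (hb : ∀ u, ‖k u‖ ≤ c * sectorWeight φ u) (F : E) :
    Integrable fun u => k u • P u F := by
  obtain ⟨c', a, hc', ha, hw⟩ := exists_sectorWeight_le hφ
  refine integrable_smul_imaginaryPower hP.norm_apply_le hk.aestronglyMeasurable ha
    (c := |c| * c') (fun u => ?_) (hP.aestronglyMeasurable F)
  refine (hb u).trans ?_
  have := sectorWeight_nonneg φ u
  calc c * sectorWeight φ u ≤ |c| * sectorWeight φ u := by gcongr; exact le_abs_self c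
    _ ≤ |c| * (c' * Real.exp (-(a * |u|))) := by gcongr; exact hw u
    _ = _ := by ring

lemma integrable_sectorWeight_mul (hP : IsExpBoundedFamily P K ω) {φ : ℝ}
    (hφ : ω + φ < Real.pi / 2) :
    Integrable fun u => sectorWeight φ u * (K * Real.exp (ω * |u|)) := by
  obtain ⟨c, a, hc, ha, hw⟩ := exists_sectorWeight_le hφ
  have hm := measurable_sectorWeight φ
  refine Integrable.mono' ((integrable_exp_neg_mul_abs (sub_pos.2 ha)).const_mul (c * K)) ?_
    (Eventually.of_forall fun u => ?_)
  · have : Measurable fun u => sectorWeight φ u * (K * Real.exp (ω * |u|)) := by fun_prop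
    exact this.aestronglyMeasurable
  · have hK := hP.nonneg
    rw [Real.norm_of_nonneg (mul_nonneg (sectorWeight_nonneg _ _) (by positivity))]
    calc sectorWeight φ u * (K * Real.exp (ω * |u|))
        ≤ c * Real.exp (-(a * |u|)) * (K * Real.exp (ω * |u|)) := by gcongr; exact hw u
      _ = c * K * Real.exp (-((a - ω) * |u|)) := by
        rw [show -((a - ω) * |u|) = -(a * |u|) + ω * |u| by ring, Real.exp_add]
        ring

lemma norm_integral_smul_le (hP : IsExpBoundedFamily P K ω) {k : ℝ → ℂ} {c φ : ℝ}
    (hφ : ω + φ < Real.pi / 2) (hb : ∀ u, ‖k u‖ ≤ c * sectorWeight φ u) (F : E) :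
    ‖∫ u, k u • P u F‖
      ≤ c * (∫ u, sectorWeight φ u * (K * Real.exp (ω * |u|))) * ‖F‖ := by
  rw [← integral_const_mul, ← integral_mul_const]
  refine norm_integral_le_of_norm_le
    (((hP.integrable_sectorWeight_mul hφ).const_mul c).mul_const _) (Eventually.of_forall fun u => ?_)
  rw [norm_smul]
  refine (mul_le_mul (hb u) (hP.norm_apply_le u F) (norm_nonneg _)
    ((norm_nonneg _).trans (hb u))).trans (le_of_eq ?_)
  ring

lemma weightedIntegral_apply (hP : IsExpBoundedFamily P K ω) {k : ℝ → ℂ} (hk : Measurable k)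
    {c φ : ℝ} (hφ : ω + φ < Real.pi / 2) (hb : ∀ u, ‖k u‖ ≤ c * sectorWeight φ u) (F : E) :
    weightedIntegral P k F = ∫ u, k u • P u F := by
  have h : ∃ A : E →L[ℂ] E, ∀ F, A F = ∫ u, k u • P u F := by
    refine ⟨LinearMap.mkContinuous
      { toFun := fun F => ∫ u, k u • P u F
        map_add' := fun F G => ?_
        map_smul' := fun r F => ?_ } _ (hP.norm_integral_smul_le hφ hb), fun F => rfl⟩
    · rw [← integral_add (hP.integrable_smul hk hφ hb F) (hP.integrable_smul hk hφ hb G)]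
      simp
    · rw [RingHom.id_apply, ← integral_smul]
      simp_rw [map_smul, smul_comm r]
  rw [weightedIntegral, dif_pos h]
  exact h.choose_spec F

lemma norm_weightedIntegral_le (hP : IsExpBoundedFamily P K ω) {k : ℝ → ℂ} (hk : Measurable k)
    {c φ : ℝ} (hc : 0 ≤ c) (hφ : ω + φ < Real.pi / 2) (hb : ∀ u, ‖k u‖ ≤ c * sectorWeight φ u) :
    ‖weightedIntegral P k‖ ≤ c * ∫ u, sectorWeight φ u * (K * Real.exp (ω * |u|)) := by
  have hK := hP.nonneg
  refine ContinuousLinearMap.opNorm_le_bound _ (mul_nonneg hc (integral_nonneg fun u =>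
    mul_nonneg (sectorWeight_nonneg _ _) (by positivity))) fun F => ?_
  rw [hP.weightedIntegral_apply hk hφ hb]
  exact hP.norm_integral_smul_le hφ hb F

lemma weightedIntegral_sub (hP : IsExpBoundedFamily P K ω) {k k' : ℝ → ℂ} (hk : Measurable k)
    (hk' : Measurable k') {c c' φ : ℝ} (hφ : ω + φ < Real.pi / 2)
    (hb : ∀ u, ‖k u‖ ≤ c * sectorWeight φ u) (hb' : ∀ u, ‖k' u‖ ≤ c' * sectorWeight φ u) :
    weightedIntegral P (fun u => k u - k' u) = weightedIntegral P k - weightedIntegral P k' := by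
  have hm : Measurable fun u => k u - k' u := hk.sub hk'
  ext F
  rw [sub_apply, hP.weightedIntegral_apply hk hφ hb, hP.weightedIntegral_apply hk' hφ hb',
    ← integral_sub (hP.integrable_smul hk hφ hb F) (hP.integrable_smul hk' hφ hb' F),
    hP.weightedIntegral_apply hm hφ (c := c + c') fun u => ?_]
  · simp_rw [sub_smul]
  · rw [add_mul]
    exact (norm_sub_le _ _).trans (add_le_add (hb u) (hb' u))

lemma weightedIntegral_mul (hP : IsExpBoundedFamily P K ω) {k : ℝ → ℂ} (hk : Measurable k)
    {c φ : ℝ} (hφ : ω + φ < Real.pi / 2) (hb : ∀ u, ‖k u‖ ≤ c * sectorWeight φ u) (r : ℂ) :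
    weightedIntegral P (fun u => r * k u) = r • weightedIntegral P k := by
  ext F
  rw [smul_apply, hP.weightedIntegral_apply hk hφ hb, ← integral_smul,
    hP.weightedIntegral_apply (hk.const_mul r) hφ (c := ‖r‖ * c) fun u => ?_]
  · simp_rw [smul_smul]
  · rw [norm_mul, mul_assoc]
    exact mul_le_mul_of_nonneg_left (hb u) (norm_nonneg r)

lemma norm_weightedIntegral_expKernel_sub_le (hP : IsExpBoundedFamily P K ω) {φ : ℝ}
    (hφ : ω + φ < Real.pi / 2) {ζ ζ' : ℂ} (h : |ζ.im| ≤ φ) (h' : |ζ'.im| ≤ φ) :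
    ‖weightedIntegral P (expKernel ζ) - weightedIntegral P (expKernel ζ')‖
      ≤ ‖ζ - ζ'‖ * ∫ u, sectorWeight φ u * (K * Real.exp (ω * |u|)) := by
  rw [← hP.weightedIntegral_sub (measurable_expKernel _) (measurable_expKernel _) hφ
    (norm_expKernel_le h) (norm_expKernel_le h')]
  exact hP.norm_weightedIntegral_le ((measurable_expKernel _).sub (measurable_expKernel _))
    (norm_nonneg _) hφ (norm_expKernel_sub_le h h')

/-- The second-order estimate for the kernel integrates to an O(h²) bound in operator norm; this
gives analyticity in norm rather than only strongly. -/
lemma hasDerivAt_weightedIntegral_expKernel (hP : IsExpBoundedFamily P K ω) {φ : ℝ}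
    (hφ : ω + φ < Real.pi / 2) {ζ : ℂ} (h : |ζ.im| < φ) :
    HasDerivAt (fun ζ => weightedIntegral P (expKernel ζ))
      (weightedIntegral P (expKernelDeriv ζ)) ζ := by
  set J := ∫ u, sectorWeight φ u * (K * Real.exp (ω * |u|))
  set δ := (φ - |ζ.im|) / 2 with hδ'
  have hδ : 0 < δ := by rw [hδ']; linarith
  have hd : ∀ u, ‖expKernelDeriv ζ u‖ ≤ 1 * sectorWeight φ u := fun u => by
    rw [one_mul]; exact norm_expKernelDeriv_le h.le u
  rw [hasDerivAt_iff_isLittleO_nhds_zero]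
  refine Asymptotics.IsBigO.trans_isLittleO (g := fun h : ℂ => h ^ 2) ?_ ?_
  · refine Asymptotics.IsBigO.of_bound (δ⁻¹ * J) ?_
    filter_upwards [Metric.ball_mem_nhds (0 : ℂ) hδ] with z hz
    have hz : ‖z‖ ≤ δ := by simpa using (Metric.mem_ball.1 hz).le
    have hzi : |(ζ + z).im| ≤ φ := by
      have h1 := (abs_add_le ζ.im z.im).trans (add_le_add_right (Complex.abs_im_le_norm z) _)
      rw [Complex.add_im]
      refine h1.trans ?_
      have : |ζ.im| + 2 * δ = φ := by rw [hδ']; ring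
      linarith
    have hmd := measurable_expKernelDeriv ζ
    have hms : Measurable fun u => expKernel (ζ + z) u - expKernel ζ u :=
      (measurable_expKernel _).sub (measurable_expKernel _)
    rw [← hP.weightedIntegral_sub (measurable_expKernel _) (measurable_expKernel _) hφ
      (norm_expKernel_le hzi) (norm_expKernel_le h.le), ← hP.weightedIntegral_mul hmd hφ hd,
      ← hP.weightedIntegral_sub (c := ‖z‖) (c' := ‖z‖)
        hms (hmd.const_mul z) hφ ?_ ?_]
    · refine (hP.norm_weightedIntegral_le (c := δ⁻¹ * ‖z‖ ^ 2) ?_ (by positivity) hφ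
        (norm_expKernel_taylor_le hδ (by rw [hδ']; linarith) hz)).trans (le_of_eq ?_)
      · exact hms.sub (hmd.const_mul z)
      · rw [norm_pow]; ring
    · intro u
      simpa using norm_expKernel_sub_le hzi h.le u
    · intro u
      rw [norm_mul]
      exact mul_le_mul_of_nonneg_left (norm_expKernelDeriv_le h.le u) (norm_nonneg z)
  · simpa using Asymptotics.isLittleO_pow_pow (m := 1) (n := 2) (𝕜 := ℂ) one_lt_two

end IsExpBoundedFamily

end Family

/-! ### The analytic continuation to the sector -/

section SectorExtension

variable {E : Type*} [NormedAddCommGroup E] [NormedSpace ℂ E]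
  {S : ℝ≥0 → E →L[ℂ] E} {C : ℝ} {P : ℝ → E →L[ℂ] E} {K ω φ : ℝ}

/-- Each P_u comes from a separate existence statement, so measurability in u has to be proved. The
vectors where it holds form a closed subspace containing Ker(L), where P_u vanishes, and Dom(L) ∩
Ran(L). -/
lemma isExpBoundedFamily_of_isImaginaryPower [CompleteSpace E]
    (hS : IsStronglyContinuousSemigroup S)
    (hC : ∀ t F, ‖S t F‖ ≤ C * ‖F‖) (hC0 : 0 ≤ C)
    (hQ : ∀ F, ∃ Q, Tendsto (fun n => ergodicAverage (S 1) n F) atTop (𝓝 Q))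
    (hP : ∀ u, IsImaginaryPower (negGenerator S) u (P u)) (hK : 0 ≤ K)
    (hPK : ∀ u F, ‖P u F‖ ≤ K * Real.exp (ω * |u|) * ‖F‖) : IsExpBoundedFamily P K ω := by
  refine ⟨hK, ?_, hPK⟩
  let V : Submodule ℂ E :=
    { carrier := {F | AEStronglyMeasurable fun u => P u F}
      add_mem' := fun {F G} hF hG => by
        rw [Set.mem_ofPred_eq] at hF hG ⊢
        simpa using! hF.add hG
      zero_mem' := by simpa using aestronglyMeasurable_const
      smul_mem' := fun c F hF => by
        rw [Set.mem_ofPred_eq] at hF ⊢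
        simpa using! hF.const_smul c }
  have hV : IsClosed (V : Set E) := by
    refine IsSeqClosed.isClosed fun F G hF hG => ?_
    exact aestronglyMeasurable_of_tendsto_ae atTop hF
      (Eventually.of_forall fun u => ((P u).continuous.tendsto G).comp hG)
  refine mem_of_ker_of_domain_inter_range hS hC hQ V hV (fun F hF => ?_) (fun F hF => ?_)
  · change AEStronglyMeasurable fun u => P u F
    simp_rw [fun u => (hP u).2 F hF]
    exact aestronglyMeasurable_const
  · obtain ⟨G, hG⟩ := hF
    exact (continuous_imaginaryPower hS hC hC0 hP F G hG).aestronglyMeasurable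

open Classical in
/-- The analytic continuation of the semigroup `S` given by the imaginary powers `P`. -/
def sectorExtension (S : ℝ≥0 → E →L[ℂ] E) (P : ℝ → E →L[ℂ] E) (z : ℂ) : E →L[ℂ] E :=
  if z = 0 then ContinuousLinearMap.id ℂ E
  else S 1 - weightedIntegral P (expKernel (Complex.log z))

lemma sectorExtension_zero : sectorExtension S P 0 = ContinuousLinearMap.id ℂ E := by
  simp [sectorExtension]

lemma sectorExtension_of_ne_zero {z : ℂ} (hz : z ≠ 0) :
    sectorExtension S P z = S 1 - weightedIntegral P (expKernel (Complex.log z)) := by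
  rw [sectorExtension, if_neg hz]

lemma sectorExtension_sub {z z' : ℂ} (hz : z ≠ 0) (hz' : z' ≠ 0) :
    sectorExtension S P z - sectorExtension S P z'
      = weightedIntegral P (expKernel (Complex.log z'))
        - weightedIntegral P (expKernel (Complex.log z)) := by
  rw [sectorExtension_of_ne_zero hz, sectorExtension_of_ne_zero hz']
  abel

lemma differentiableOn_sectorExtension (hP : IsExpBoundedFamily P K ω)
    (hφ : ω + φ < Real.pi / 2) (hφ' : φ ≤ Real.pi) :
    DifferentiableOn ℂ (sectorExtension S P) (sector φ) := by
  have h : DifferentiableOn ℂ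
      (fun z => S 1 - weightedIntegral P (expKernel (Complex.log z))) (sector φ) := by
    rintro z ⟨hz0, hz⟩
    refine DifferentiableAt.differentiableWithinAt (DifferentiableAt.const_sub ?_ _)
    have h1 := (hP.hasDerivAt_weightedIntegral_expKernel hφ
      (by rwa [Complex.log_im] : |(Complex.log z).im| < φ)).differentiableAt
    have h2 : z ∈ Complex.slitPlane := by
      rw [Complex.mem_slitPlane_iff_arg]
      exact ⟨fun h => by rw [h, abs_of_pos Real.pi_pos] at hz; linarith, hz0⟩
    exact h1.comp z (Complex.differentiableAt_log h2)
  exact h.congr fun z hz => sectorExtension_of_ne_zero hz.1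

/-- The integral term has t-derivative t⁻¹ (2π)⁻¹ `mellinRep` = S_t L F, opposite to that of S_t F.
The sum is constant, and at t = 1 the kernel vanishes. -/
lemma apply_eq_self_sub_integral (hS : IsStronglyContinuousSemigroup S)
    (hP : IsExpBoundedFamily P K ω) (hφ0 : 0 < φ) (hφ : ω + φ < Real.pi / 2)
    (F : (negGenerator S).domain)
    (hF : ∀ t : ℝ, 0 < t → t • orbit S (negGenerator S F) t = (1 / (2 * Real.pi)) • mellinRep P F t)
    {t : ℝ} (ht : 0 < t) :
    orbit S F t + weightedIntegral P (expKernel (Real.log t)) F = S 1 F := by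
  set f : ℝ → E := fun t => orbit S F t + weightedIntegral P (expKernel (Real.log t)) F with hf
  have hd : ∀ t : ℝ, 0 < t → HasDerivAt
      (fun t : ℝ => weightedIntegral P (expKernel (Real.log t)) F)
      (orbit S (negGenerator S F) t) t := by
    intro t ht
    have h1 := hP.hasDerivAt_weightedIntegral_expKernel hφ (ζ := Real.log t)
      (by simpa using hφ0)
    have h2 : HasDerivAt (fun ζ => weightedIntegral P (expKernel ζ) F)
        (weightedIntegral P (expKernelDeriv (Real.log t)) F) (Real.log t : ℂ) :=
      ((ContinuousLinearMap.apply ℂ E (F : E)).hasFDerivAt.comp_hasDerivAt _ h1)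
    have h3 := h2.scomp t (Real.hasDerivAt_log ht.ne').ofReal_comp
    have h4 : weightedIntegral P (expKernelDeriv (Real.log t)) F
        = (1 / (2 * Real.pi)) • mellinRep P F t := by
      rw [hP.weightedIntegral_apply (measurable_expKernelDeriv _) hφ (c := 1), mellinRep,
        ← integral_smul]
      · refine integral_congr_ae ?_
        -- At u = 0 division by zero makes the kernel 0 instead of Γ(1)/2π, which matters only on a
        -- null set.
        filter_upwards [Measure.ae_ne volume (0 : ℝ)] with u hu
        rw [expKernelDeriv, mul_gammaKernel hu, ← Complex.coe_smul, smul_smul]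
        congr 1
        ring
      · intro u
        rw [one_mul]
        exact norm_expKernelDeriv_le (by simpa using hφ0.le) u
    rw [h4, ← hF t ht, Complex.coe_smul, smul_smul, inv_mul_cancel₀ ht.ne', one_smul] at h3
    exact h3
  have hc : ∀ a b : ℝ, 0 < a → a ≤ b → f b = f a := by
    intro a b ha hab
    refine constant_of_has_deriv_right_zero (f := f) (a := a) (b := b) (fun x hx => ?_)
      (fun x hx => ?_) b ⟨hab, le_rfl⟩
    · exact ((continuous_orbit hS _).continuousAt.add
        (hd x (ha.trans_le hx.1)).continuousAt).continuousWithinAt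
    · have hx0 := ha.trans_le hx.1
      have := (hasDerivWithinAt_orbit hS F hx0.le).add (hd x hx0).hasDerivWithinAt
      rw [orbit, neg_add_cancel] at this
      exact this
  have h1 : f 1 = S 1 F := by
    have : expKernel ((Real.log 1 : ℝ) : ℂ) = fun _ => 0 := by
      funext u; simp [expKernel]
    simp only [hf, this]
    rw [hP.weightedIntegral_apply measurable_const hφ (c := 0) (by simp)]
    simp [orbit]
  rw [← h1]
  rcases le_total t 1 with h | h
  · exact (hc t 1 ht h).symm
  · exact hc 1 t one_pos h

lemma sectorExtension_ofReal [CompleteSpace E] (hS : IsStronglyContinuousSemigroup S)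
    (hC : ∀ t F, ‖S t F‖ ≤ C * ‖F‖) (hC0 : 0 ≤ C)
    (hQ : ∀ F, ∃ Q, Tendsto (fun n => ergodicAverage (S 1) n F) atTop (𝓝 Q))
    (hIP : ∀ u, IsImaginaryPower (negGenerator S) u (P u)) (hP : IsExpBoundedFamily P K ω)
    (hω : 0 ≤ ω) (hφ0 : 0 < φ) (hφ : ω + φ < Real.pi / 2) (t : ℝ≥0) :
    sectorExtension S P ((t : ℝ) : ℂ) = S t := by
  rcases eq_or_ne t 0 with rfl | ht
  · simp [sectorExtension_zero, hS.map_zero]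
  have ht0 : 0 < (t : ℝ) := by positivity
  rw [sectorExtension_of_ne_zero (by exact_mod_cast ht), ← Complex.ofReal_log ht0.le]
  ext1 F
  refine mem_of_ker_of_domain_inter_range hS hC hQ
    (LinearMap.eqLocus (S 1 - weightedIntegral P (expKernel (Real.log t)) : E →L[ℂ] E).toLinearMap
      (S t).toLinearMap) (isClosed_eq (ContinuousLinearMap.continuous _) (S t).continuous)
    (fun F hF => ?_) (fun F hF => ?_) F
  -- On Ker(L) the Mellin formula is trivial, since L F and all P_u F vanish.
  · have h := apply_eq_self_sub_integral hS hP hφ0 hφ F (fun t ht => ?_) ht0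
    · simp only [orbit, Real.toNNReal_coe] at h
      simp [LinearMap.mem_eqLocus, ← h]
    · simp [mellinRep, hF, (hIP _).2 F hF, orbit]
  · obtain ⟨G, hG⟩ := hF
    have h := apply_eq_self_sub_integral hS hP hφ0 hφ F (fun t ht =>
      smul_orbit_eq_mellinRep hS hC hC0 hIP hP.norm_apply_le hω (by linarith) F G hG ht) ht0
    simp only [orbit, Real.toNNReal_coe] at h
    simp [LinearMap.mem_eqLocus, ← h]

lemma norm_log_sub_log_norm {z : ℂ} : ‖Complex.log ‖z‖ - Complex.log z‖ = |z.arg| := by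
  have : Complex.log ‖z‖ - Complex.log z = -(z.arg * Complex.I) := by
    rw [← Complex.ofReal_log (norm_nonneg z), Complex.log]; ring
  rw [this]
  simp

/-- Uniform boundedness follows by comparing z with |z|, where the operator is S_{|z|}: log z and
log |z| differ by i arg z, whatever |z| is. -/
lemma isBoundedAnalyticContinuation_sectorExtension [CompleteSpace E]
    (hS : IsStronglyContinuousSemigroup S)
    (hC : ∀ t F, ‖S t F‖ ≤ C * ‖F‖) (hC0 : 0 ≤ C)
    (hQ : ∀ F, ∃ Q, Tendsto (fun n => ergodicAverage (S 1) n F) atTop (𝓝 Q))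
    (hIP : ∀ u, IsImaginaryPower (negGenerator S) u (P u)) (hP : IsExpBoundedFamily P K ω)
    (hω : 0 ≤ ω) (hφ0 : 0 < φ) (hφ : ω + φ < Real.pi / 2) :
    IsBoundedAnalyticContinuation S φ (sectorExtension S P) := by
  have hext := sectorExtension_ofReal hS hC hC0 hQ hIP hP hω hφ0 hφ
  refine ⟨hext, differentiableOn_sectorExtension hP hφ (by linarith [Real.pi_pos]), ?_⟩
  refine ⟨C + φ * ∫ u, sectorWeight φ u * (K * Real.exp (ω * |u|)), ?_⟩
  rintro z ⟨hz0, hz⟩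
  have h1 : sectorExtension S P z = S ‖z‖₊ + (sectorExtension S P z - sectorExtension S P ‖z‖) := by
    rw [← coe_nnnorm, hext]; abel
  have hK := hP.nonneg
  have hz' : ((‖z‖ : ℝ) : ℂ) ≠ 0 := by exact_mod_cast norm_ne_zero_iff.2 hz0
  rw [h1, sectorExtension_sub hz0 hz']
  refine (norm_add_le _ _).trans (add_le_add (ContinuousLinearMap.opNorm_le_bound _ hC0 (hC _)) ?_)
  refine (hP.norm_weightedIntegral_expKernel_sub_le hφ ?_ ?_).trans ?_
  · rw [← Complex.ofReal_log (norm_nonneg z), Complex.ofReal_im, abs_zero]; exact hφ0.le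
  · rw [Complex.log_im]; exact hz.le
  · rw [norm_log_sub_log_norm]
    refine mul_le_mul_of_nonneg_right hz.le (integral_nonneg fun u => ?_)
    exact mul_nonneg (sectorWeight_nonneg _ _) (by positivity)

end SectorExtension

/-! ### Pointwise domination of the increments -/

section Domination

variable {X : Type*} [MeasurableSpace X] {μ : Measure X} {p : ℝ≥0∞} [Fact (1 ≤ p)]
  {B : Type*} [NormedAddCommGroup B] [NormedSpace ℂ B]

omit [NormedSpace ℂ B] in
/-- The pairs `(F, g)` with `|F| ≤ g` almost everywhere form a closed set. -/
lemma isClosed_ae_norm_le_pair :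
    IsClosed {z : Lp B p μ × Lp ℝ p μ | ∀ᵐ x ∂μ, ‖z.1 x‖ ≤ z.2 x} := by
  refine IsSeqClosed.isClosed fun f z hf hz => ?_
  have h1 : Tendsto (fun n => (f n).1) atTop (𝓝 z.1) := (continuous_fst.tendsto z).comp hz
  have h2 : Tendsto (fun n => (f n).2) atTop (𝓝 z.2) := (continuous_snd.tendsto z).comp hz
  obtain ⟨ns, hns, h3⟩ := (tendstoInMeasure_of_tendsto_Lp h1).exists_seq_tendsto_ae
  obtain ⟨ms, hms, h4⟩ := (tendstoInMeasure_of_tendsto_Lp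
    (h2.comp hns.tendsto_atTop)).exists_seq_tendsto_ae
  filter_upwards [h3, h4, ae_all_iff.2 hf] with x hx1 hx2 h
  exact le_of_tendsto_of_tendsto' (hx1.comp hms.tendsto_atTop).norm hx2 fun n => h _

/-- `|∫ H| ≤ ∫ g` almost everywhere, if `|H| ≤ g`. -/
lemma ae_norm_integral_le [CompleteSpace B] {H : ℝ → Lp B p μ} {g : ℝ → Lp ℝ p μ}
    (hH : Integrable H) (hg : Integrable g) (h : ∀ u, ∀ᵐ x ∂μ, ‖H u x‖ ≤ g u x) :
    ∀ᵐ x ∂μ, ‖(∫ u, H u) x‖ ≤ (∫ u, g u) x := by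
  -- V is a closed convex cone, and Hahn–Banach keeps the integral inside it. Working with
  -- L^p-valued integrals avoids representatives jointly measurable in u and x.
  set V := {z : Lp B p μ × Lp ℝ p μ | ∀ᵐ x ∂μ, ‖z.1 x‖ ≤ z.2 x} with hV
  have hsmul : ∀ (r : ℝ), 0 ≤ r → ∀ z ∈ V, r • z ∈ V := by
    intro r hr z hz
    simp only [hV, Set.mem_ofPred_eq] at hz ⊢
    filter_upwards [hz, Lp.coeFn_smul r z.1, Lp.coeFn_smul r z.2] with x hx h1 h2
    rw [Prod.smul_fst, Prod.smul_snd, h1, h2, Pi.smul_apply, Pi.smul_apply, norm_smul,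
      Real.norm_of_nonneg hr]
    exact mul_le_mul_of_nonneg_left hx hr
  have hadd : ∀ z ∈ V, ∀ w ∈ V, z + w ∈ V := by
    intro z hz w hw
    simp only [hV, Set.mem_ofPred_eq] at hz hw ⊢
    filter_upwards [hz, hw, Lp.coeFn_add z.1 w.1, Lp.coeFn_add z.2 w.2] with x hx hy h1 h2
    rw [Prod.fst_add, Prod.snd_add, h1, h2, Pi.add_apply, Pi.add_apply]
    exact (norm_add_le _ _).trans (add_le_add hx hy)
  have hconv : Convex ℝ V := fun z hz w hw a b ha hb _ =>
    hadd _ (hsmul a ha z hz) _ (hsmul b hb w hw)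
  suffices hmem : (∫ u, (H u, g u)) ∈ V by
    rw [integral_pair hH hg] at hmem
    exact hmem
  by_contra hn
  -- A functional bounded below on a cone is nonnegative on it, so its value at the integral is
  -- nonnegative, against r < 0.
  obtain ⟨ℓ, r, h1, h2⟩ := geometric_hahn_banach_point_closed hconv isClosed_ae_norm_le_pair hn
  have h0 : (0 : Lp B p μ × Lp ℝ p μ) ∈ V := by
    have := hsmul 0 le_rfl (H 0, g 0) (h 0)
    simpa using this
  have hr : r < 0 := by simpa using h2 0 h0
  have hpos : ∀ z ∈ V, 0 ≤ ℓ z := by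
    intro z hz
    by_contra hneg
    push Not at hneg
    have h3 := h2 _ (hsmul (r / ℓ z) (div_nonneg_of_nonpos hr.le hneg.le) z hz)
    rw [map_smul, smul_eq_mul, div_mul_cancel₀ _ hneg.ne] at h3
    exact lt_irrefl _ h3
  have h4 : ℓ (∫ u, (H u, g u)) = ∫ u, ℓ (H u, g u) :=
    (ContinuousLinearMap.integral_comp_comm _ (hH.prodMk hg)).symm
  have h5 : 0 ≤ ∫ u, ℓ (H u, g u) := integral_nonneg fun u => hpos _ (h u)
  linarith

/-- The function `|F|` as an element of `L^p(X)`. -/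
def lpNorm (F : Lp B p μ) : Lp ℝ p μ := lipschitzWith_one_norm.compLp norm_zero F

omit [NormedSpace ℂ B] [Fact (1 ≤ p)] in
lemma coeFn_lpNorm (F : Lp B p μ) : lpNorm F =ᵐ[μ] fun x => ‖F x‖ :=
  LipschitzWith.coeFn_compLp _ _ F

omit [NormedSpace ℂ B] in
lemma continuous_lpNorm : Continuous (lpNorm : Lp B p μ → Lp ℝ p μ) :=
  lipschitzWith_one_norm.continuous_compLp norm_zero

omit [NormedSpace ℂ B] [Fact (1 ≤ p)] in
lemma norm_lpNorm_le (F : Lp B p μ) : ‖lpNorm F‖ ≤ ‖F‖ :=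
  (lipschitzWith_one_norm.norm_compLp_le norm_zero F).trans_eq (by simp)

variable {P : ℝ → Lp B p μ →L[ℂ] Lp B p μ} {K ω φ : ℝ}

/-- The majorant `∫ w(u) |P_u F| du` with the sector weight
`w(u) = e^{φ|u|} |Γ(1 - iu)| / 2π`. -/
def sectorMajorant (P : ℝ → Lp B p μ →L[ℂ] Lp B p μ) (φ : ℝ) (F : Lp B p μ) : Lp ℝ p μ :=
  ∫ u, sectorWeight φ u • lpNorm (P u F)

lemma IsExpBoundedFamily.norm_sectorWeight_smul_le (hP : IsExpBoundedFamily P K ω) (F : Lp B p μ)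
    (u : ℝ) : ‖sectorWeight φ u • lpNorm (P u F)‖
      ≤ sectorWeight φ u * (K * Real.exp (ω * |u|)) * ‖F‖ := by
  rw [norm_smul, Real.norm_of_nonneg (sectorWeight_nonneg _ _), mul_assoc]
  exact mul_le_mul_of_nonneg_left ((norm_lpNorm_le _).trans (hP.norm_apply_le u F))
    (sectorWeight_nonneg _ _)

lemma IsExpBoundedFamily.integrable_sectorMajorant (hP : IsExpBoundedFamily P K ω)
    (hφ : ω + φ < Real.pi / 2) (F : Lp B p μ) :
    Integrable fun u => sectorWeight φ u • lpNorm (P u F) :=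
  Integrable.mono' ((hP.integrable_sectorWeight_mul hφ).mul_const ‖F‖)
    ((measurable_sectorWeight φ).aestronglyMeasurable.smul
      (continuous_lpNorm.comp_aestronglyMeasurable (hP.aestronglyMeasurable F)))
    (Eventually.of_forall (hP.norm_sectorWeight_smul_le F))

lemma IsExpBoundedFamily.norm_sectorMajorant_le (hP : IsExpBoundedFamily P K ω)
    (hφ : ω + φ < Real.pi / 2) (F : Lp B p μ) :
    ‖sectorMajorant P φ F‖ ≤ (∫ u, sectorWeight φ u * (K * Real.exp (ω * |u|))) * ‖F‖ := by
  rw [← integral_mul_const]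
  exact norm_integral_le_of_norm_le ((hP.integrable_sectorWeight_mul hφ).mul_const ‖F‖)
    (Eventually.of_forall (hP.norm_sectorWeight_smul_le F))

variable {S : ℝ≥0 → Lp B p μ →L[ℂ] Lp B p μ}

/-- The kernel bound is linear in |log z' - log z| with a weight independent of z and z', so a
single function in L^p controls all increments. -/
lemma ae_norm_sectorExtension_sub_le [CompleteSpace B] (hP : IsExpBoundedFamily P K ω)
    (hφ : ω + φ < Real.pi / 2) {z z' : ℂ} (hz : z ≠ 0) (hz' : z' ≠ 0) (h : |z.arg| ≤ φ)
    (h' : |z'.arg| ≤ φ) (F : Lp B p μ) :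
    ∀ᵐ x ∂μ, ‖sectorExtension S P z F x - sectorExtension S P z' F x‖
      ≤ ‖Complex.log z' - Complex.log z‖ * sectorMajorant P φ F x := by
  rw [← Complex.log_im] at h h'
  have hk := norm_expKernel_sub_le h' h
  have hm : Measurable fun u => expKernel (Complex.log z') u - expKernel (Complex.log z) u :=
    (measurable_expKernel _).sub (measurable_expKernel _)
  have h1 : sectorExtension S P z F - sectorExtension S P z' F
      = ∫ u, (expKernel (Complex.log z') u - expKernel (Complex.log z) u) • P u F := by
    rw [← sub_apply, sectorExtension_sub hz hz', ← hP.weightedIntegral_sub (measurable_expKernel _)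
      (measurable_expKernel _) hφ (norm_expKernel_le h') (norm_expKernel_le h),
      hP.weightedIntegral_apply hm hφ hk]
    rfl
  set r := ‖Complex.log z' - Complex.log z‖
  have h2 := ae_norm_integral_le (hP.integrable_smul hm hφ hk F)
    ((hP.integrable_sectorMajorant hφ F).fun_smul r) fun u => by
      filter_upwards [Lp.coeFn_smul (expKernel (Complex.log z') u - expKernel (Complex.log z) u)
        (P u F), Lp.coeFn_smul r (sectorWeight φ u • lpNorm (P u F)),
        Lp.coeFn_smul (sectorWeight φ u) (lpNorm (P u F)), coeFn_lpNorm (P u F)] with x h1 h2 h3 h4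
      rw [h1, h2, Pi.smul_apply, Pi.smul_apply, h3, Pi.smul_apply, h4, norm_smul, smul_eq_mul,
        smul_eq_mul, ← mul_assoc]
      exact mul_le_mul_of_nonneg_right (hk u) (norm_nonneg _)
  rw [← h1, integral_smul] at h2
  filter_upwards [h2, Lp.coeFn_sub (sectorExtension S P z F) (sectorExtension S P z' F),
    Lp.coeFn_smul r (sectorMajorant P φ F)] with x hx hx1 hx2
  rw [hx1, ← sectorMajorant, hx2] at hx
  exact hx

end Domination

/-! ### Reduction of dyadic times to ergodic averages -/

section Discretization

/-- The logarithm of n^n / n! ≤ e^n. -/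
lemma sum_log_sub_log_le (n : ℕ) (hn : 0 < n) :
    ∑ k ∈ Finset.range n, (Real.log n - Real.log (k + 1 : ℕ)) ≤ n := by
  have hn' : (0 : ℝ) < n := by exact_mod_cast hn
  have h1 : ∑ k ∈ Finset.range n, Real.log (k + 1 : ℕ) = Real.log n.factorial := by
    rw [← Finset.prod_range_add_one_eq_factorial, Nat.cast_prod, Real.log_prod]
    intro i _
    positivity
  rw [Finset.sum_sub_distrib, h1, Finset.sum_const, Finset.card_range, nsmul_eq_mul,
    ← Real.log_pow, ← Real.log_div (by positivity) (by positivity)]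
  have h2 := Real.pow_div_factorial_le_exp (n : ℝ) hn'.le n
  have h3 := Real.log_le_log (by positivity) h2
  rwa [Real.log_exp] at h3

variable {X : Type*} [MeasurableSpace X] {μ : Measure X} {p : ℝ≥0∞} [Fact (1 ≤ p)]
  {B : Type*} [NormedAddCommGroup B] [NormedSpace ℂ B] {S : ℝ≥0 → Lp B p μ →L[ℂ] Lp B p μ}

lemma pow_apply_semigroup (hS : IsStronglyContinuousSemigroup S) (δ : ℝ≥0) (k : ℕ)
    (F : Lp B p μ) : (S δ ^ k) (S δ F) = S ((k + 1 : ℕ) * δ) F := by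
  induction k with
  | zero => simp
  | succ k ih =>
    rw [pow_succ', mul_apply_eq_comp, ih, ← ContinuousLinearMap.comp_apply,
      ← hS.map_add]
    congr 2
    push_cast
    ring

/-- S_{nδ} F is compared with the mean of S_{kδ} F for 1 ≤ k ≤ n, at the cost n⁻¹ ∑ log(n/k) ≤ 1
times |g|. Starting the averages from S_δ F avoids k = 0, where the logarithmic distance is
infinite. -/
lemma ae_enorm_le_average_add (hS : IsStronglyContinuousSemigroup S) {F : Lp B p μ}
    {g : Lp ℝ p μ} (h : ∀ s t : ℝ≥0, 0 < s → 0 < t →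
      ∀ᵐ x ∂μ, ‖S s F x - S t F x‖ ≤ |Real.log t - Real.log s| * g x)
    {δ : ℝ≥0} (hδ : 0 < δ) {n : ℕ} (hn : 0 < n) :
    ∀ᵐ x ∂μ, ‖S (n * δ) F x‖ₑ
      ≤ ‖(∑ k ∈ Finset.range n, (S δ ^ k) (S δ F) : Lp B p μ) x‖ₑ / n + ‖g x‖ₑ := by
  have hn' : (0 : ℝ) < n := by exact_mod_cast hn
  have hδ' : (0 : ℝ) < δ := by exact_mod_cast hδ
  have h1 : ∀ᵐ x ∂μ, ∀ k : ℕ, ‖S (n * δ) F x - S ((k + 1 : ℕ) * δ) F x‖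
      ≤ |Real.log (k + 1 : ℕ) - Real.log n| * g x := by
    refine ae_all_iff.2 fun k => ?_
    filter_upwards [h (n * δ) ((k + 1 : ℕ) * δ) (by positivity) (by positivity)] with x hx
    convert hx using 3
    have hk : ((k + 1 : ℕ) : ℝ) ≠ 0 := by positivity
    push_cast
    rw [Real.log_mul (by exact_mod_cast hk) hδ'.ne', Real.log_mul hn'.ne' hδ'.ne']
    ring
  filter_upwards [h1, Lp.coeFn_finsetSum (Finset.range n) fun k => (S δ ^ k) (S δ F)] with x hx hs
  rw [hs, Finset.sum_apply]
  simp_rw [pow_apply_semigroup hS]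
  set a := S (n * δ) F x
  set b : ℕ → B := fun k => S ((k + 1 : ℕ) * δ) F x
  have h2 : (n : ℝ) * ‖a‖ ≤ ‖∑ k ∈ Finset.range n, b k‖ + n * |g x| := by
    calc (n : ℝ) * ‖a‖ = ‖∑ k ∈ Finset.range n, b k + ∑ k ∈ Finset.range n, (a - b k)‖ := by
          rw [Finset.sum_sub_distrib, add_sub_cancel, Finset.sum_const, Finset.card_range,
            ← Nat.cast_smul_eq_nsmul ℝ, norm_smul, Real.norm_of_nonneg hn'.le]
      _ ≤ ‖∑ k ∈ Finset.range n, b k‖ + ∑ k ∈ Finset.range n, ‖a - b k‖ :=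
          (norm_add_le _ _).trans (add_le_add le_rfl (norm_sum_le _ _))
      _ ≤ ‖∑ k ∈ Finset.range n, b k‖
          + ∑ k ∈ Finset.range n, (Real.log n - Real.log (k + 1 : ℕ)) * |g x| := by
          gcongr with k hk
          have hle : Real.log (k + 1 : ℕ) ≤ Real.log n :=
            Real.log_le_log (by positivity) (by exact_mod_cast Finset.mem_range.1 hk)
          refine (hx k).trans ?_
          rw [abs_sub_comm, abs_of_nonneg (sub_nonneg.2 hle)]
          exact mul_le_mul_of_nonneg_left (le_abs_self _) (sub_nonneg.2 hle)
      _ ≤ ‖∑ k ∈ Finset.range n, b k‖ + n * |g x| := by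
          rw [← Finset.sum_mul]
          gcongr
          exact sum_log_sub_log_le n hn
  have h3 : ‖a‖ ≤ ‖∑ k ∈ Finset.range n, b k‖ / n + |g x| := by
    rw [div_add' _ _ _ hn'.ne', le_div_iff₀ hn']
    linarith
  rw [← ofReal_norm, ← ofReal_norm, ← ofReal_norm (g x), Real.norm_eq_abs,
    ← ENNReal.ofReal_natCast n, ← ENNReal.ofReal_div_of_pos hn',
    ← ENNReal.ofReal_add (by positivity) (abs_nonneg _)]
  exact ENNReal.ofReal_le_ofReal h3

/-- The maximal function over the times `2^j`, `|j| ≤ m`. -/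
def dyadicMaximal (S : ℝ≥0 → Lp B p μ →L[ℂ] Lp B p μ) (F : Lp B p μ) (m : ℕ) (x : X) : ℝ≥0∞ :=
  (Finset.Icc (-m : ℤ) m).sup fun j => ‖S ((2 : ℝ≥0) ^ j) F x‖ₑ

lemma aemeasurable_dyadicMaximal (F : Lp B p μ) (m : ℕ) : AEMeasurable (dyadicMaximal S F m) μ := by
  have : dyadicMaximal S F m
      = (Finset.Icc (-m : ℤ) m).sup fun j x => ‖S ((2 : ℝ≥0) ^ j) F x‖ₑ := by
    ext x; rw [Finset.sup_apply]; rfl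
  rw [this]
  exact Finset.sup_induction (p := fun g : X → ℝ≥0∞ => AEMeasurable g μ) aemeasurable_const
    (fun _ h _ h' => h.sup h') fun n _ => (Lp.aestronglyMeasurable _).enorm

lemma dyadicMaximal_mono (F : Lp B p μ) (x : X) : Monotone fun m => dyadicMaximal S F m x :=
  fun m n h => Finset.sup_mono (Finset.Icc_subset_Icc (by simpa using h) (by exact_mod_cast h))

lemma enorm_le_iSup_dyadicMaximal (F : Lp B p μ) (j : ℤ) (x : X) :
    ‖S ((2 : ℝ≥0) ^ j) F x‖ₑ ≤ ⨆ m, dyadicMaximal S F m x := by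
  refine le_iSup_of_le j.natAbs ?_
  exact Finset.le_sup (f := fun j => ‖S ((2 : ℝ≥0) ^ j) F x‖ₑ) (Finset.mem_Icc.2 (by omega))

/-- With step δ = 2^{-m}, each 2^j with |j| ≤ m is nδ for n = 2^{j+m} ≤ 4^m. The ergodic bound does
not see m, so m can tend to infinity. -/
lemma ae_dyadicMaximal_le (hS : IsStronglyContinuousSemigroup S) {F : Lp B p μ}
    {g : Lp ℝ p μ} (h : ∀ s t : ℝ≥0, 0 < s → 0 < t →
      ∀ᵐ x ∂μ, ‖S s F x - S t F x‖ ≤ |Real.log t - Real.log s| * g x) (m : ℕ) :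
    ∀ᵐ x ∂μ, dyadicMaximal S F m x ≤ ergodicMaximal (S ((2 : ℝ≥0) ^ (-m : ℤ)))
      (S ((2 : ℝ≥0) ^ (-m : ℤ)) F) (4 ^ m) x + ‖g x‖ₑ := by
  set δ := (2 : ℝ≥0) ^ (-m : ℤ) with hδ
  have h1 : ∀ᵐ x ∂μ, ∀ n : ℕ, 0 < n → ‖S (n * δ) F x‖ₑ
      ≤ ‖(∑ k ∈ Finset.range n, (S δ ^ k) (S δ F) : Lp B p μ) x‖ₑ / n + ‖g x‖ₑ :=
    ae_all_iff.2 fun n => by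
      by_cases hn : 0 < n
      · filter_upwards [ae_enorm_le_average_add hS h (δ := δ) (by positivity) hn] with x hx _
        exact hx
      · exact Eventually.of_forall fun x h => absurd h hn
  filter_upwards [h1] with x hx
  refine Finset.sup_le fun j hj => ?_
  rw [Finset.mem_Icc] at hj
  obtain ⟨i, hi⟩ := Int.eq_ofNat_of_zero_le (show 0 ≤ j + m by omega)
  have hij : (2 : ℝ≥0) ^ j = (2 ^ i : ℕ) * δ := by
    rw [hδ, Nat.cast_pow, Nat.cast_ofNat, ← zpow_natCast, ← zpow_add₀ two_ne_zero, ← hi]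
    congr 1; ring
  have hle : 2 ^ i ≤ 4 ^ m := by
    rw [show 4 = 2 ^ 2 by norm_num, ← pow_mul]
    exact Nat.pow_le_pow_right (by norm_num) (by omega)
  rw [hij]
  refine (hx (2 ^ i) (by positivity)).trans (add_le_add ?_ le_rfl)
  exact Finset.le_sup (f := fun n : ℕ =>
    ‖(∑ k ∈ Finset.range n, (S δ ^ k) (S δ F) : Lp B p μ) x‖ₑ / n)
    (Finset.mem_Icc.2 ⟨Nat.one_le_two_pow, hle⟩)

omit [Fact (1 ≤ p)] in
lemma eLpNorm_iSup_le {h : ℕ → X → ℝ≥0∞} (hm : ∀ m, AEMeasurable (h m) μ)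
    (hmono : ∀ x, Monotone fun m => h m x) (hp0 : p ≠ 0) (hp : p ≠ ∞) {c : ℝ≥0∞}
    (hc : ∀ m, eLpNorm (h m) p μ ≤ c) : eLpNorm (fun x => ⨆ m, h m x) p μ ≤ c := by
  have hr : 0 < p.toReal := ENNReal.toReal_pos hp0 hp
  have e : ∀ g : X → ℝ≥0∞, eLpNorm g p μ ≤ c ↔ ∫⁻ x, g x ^ p.toReal ∂μ ≤ c ^ p.toReal := by
    intro g
    rw [eLpNorm_eq_lintegral_rpow_enorm_toReal hp0 hp, one_div, ENNReal.rpow_inv_le_iff hr]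
    simp only [enorm_eq_self]
  rw [e]
  have h1 : ∀ x, (⨆ m, h m x) ^ p.toReal = ⨆ m, h m x ^ p.toReal := fun x =>
    (ENNReal.orderIsoRpow p.toReal hr).map_iSup _
  simp_rw [h1]
  rw [lintegral_iSup' (fun m => (hm m).pow_const _)
    (Eventually.of_forall fun x m n hmn => ENNReal.rpow_le_rpow (hmono x hmn) hr.le)]
  exact iSup_le fun m => (e _).1 (hc m)

lemma eLpNorm_iSup_dyadicMaximal_le (hS : IsStronglyContinuousSemigroup S)
    (hSc : ∀ t, IsL1LInftyContraction (S t)) {C : ℝ} (hC0 : 0 ≤ C)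
    (hC : ∀ t F, ‖S t F‖ ≤ C * ‖F‖) (hp1 : 1 < p) (hp : p < ∞) {F : Lp B p μ} {g : Lp ℝ p μ}
    (h : ∀ s t : ℝ≥0, 0 < s → 0 < t →
      ∀ᵐ x ∂μ, ‖S s F x - S t F x‖ ≤ |Real.log t - Real.log s| * g x) :
    eLpNorm (fun x => ⨆ m, dyadicMaximal S F m x) p μ
      ≤ maximalConst p.toReal * (ENNReal.ofReal C * ‖F‖ₑ) + ‖g‖ₑ := by
  refine eLpNorm_iSup_le (aemeasurable_dyadicMaximal F) (dyadicMaximal_mono F)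
    (zero_lt_one.trans hp1).ne' hp.ne fun m => ?_
  set δ := (2 : ℝ≥0) ^ (-m : ℤ)
  calc eLpNorm (dyadicMaximal S F m) p μ
      ≤ eLpNorm (fun x => ergodicMaximal (S δ) (S δ F) (4 ^ m) x + ‖g x‖ₑ) p μ := by
        refine eLpNorm_mono_enorm_ae ?_
        filter_upwards [ae_dyadicMaximal_le hS h m] with x hx
        simpa only [enorm_eq_self] using hx
    _ ≤ eLpNorm (ergodicMaximal (S δ) (S δ F) (4 ^ m)) p μ + eLpNorm (fun x => ‖g x‖ₑ) p μ :=
        eLpNorm_add_le (aemeasurable_ergodicMaximal _ _ _).aestronglyMeasurable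
          (Lp.aestronglyMeasurable g).enorm.aestronglyMeasurable hp1.le
    _ ≤ maximalConst p.toReal * (ENNReal.ofReal C * ‖F‖ₑ) + ‖g‖ₑ := by
        refine add_le_add ((eLpNorm_ergodicMaximal_le (hSc δ) _ _ hp1 hp).trans ?_) ?_
        · gcongr
          rw [← Lp.enorm_def, ← ofReal_norm, ← ofReal_norm, ← ENNReal.ofReal_mul hC0]
          exact ENNReal.ofReal_le_ofReal (hC δ F)
        · rw [eLpNorm_enorm, Lp.enorm_def]

end Discretization

/-! ### The maximal function over the sector -/

section MaximalFunction

variable {X : Type*} [MeasurableSpace X] {μ : Measure X} {p : ℝ≥0∞} [Fact (1 ≤ p)]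
  {B : Type*} [NormedAddCommGroup B] [NormedSpace ℂ B]

omit [NormedSpace ℂ B] in
lemma isClosed_ae_enorm_le (m : X → ℝ≥0∞) :
    IsClosed {F : Lp B p μ | ∀ᵐ x ∂μ, ‖F x‖ₑ ≤ m x} := by
  refine IsSeqClosed.isClosed fun f F hf hF => ?_
  obtain ⟨ns, -, hns⟩ := (tendstoInMeasure_of_tendsto_Lp hF).exists_seq_tendsto_ae
  filter_upwards [hns, ae_all_iff.2 hf] with x hx h1
  exact le_of_tendsto hx.enorm (Eventually.of_forall fun n => h1 _)

omit [NormedSpace ℂ B] [Fact (1 ≤ p)] in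
lemma pointwiseNorm_le_iff (F : Lp B p μ) (M : X →ₘ[μ] ℝ≥0∞) :
    pointwiseNorm F ≤ M ↔ ∀ᵐ x ∂μ, ‖F x‖ₑ ≤ M x := by
  have h : pointwiseNorm F =ᵐ[μ] fun x => ‖F x‖ₑ := AEEqFun.coeFn_comp _ continuous_enorm _
  rw [← AEEqFun.coeFn_le]
  refine ⟨fun h' => ?_, fun h' => ?_⟩
  · filter_upwards [h, h'] with x hx hx'
    rwa [← hx]
  · filter_upwards [h, h'] with x hx hx'
    rwa [hx]

/-- A countable dense set of z suffices, since the functions dominated by a fixed m form a closed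
set in L^p. The point 0 is added by hand, as continuity is assumed only away from it. -/
lemma exists_isMaximalFunction {ψ : ℝ} (hψ : 0 ≤ ψ) {Tz : ℂ → Lp B p μ →L[ℂ] Lp B p μ}
    {F : Lp B p μ} (hT : ContinuousOn (fun z => Tz z F) {z | z ≠ 0 ∧ |z.arg| ≤ ψ}) :
    ∃ M, IsMaximalFunction ψ Tz F M := by
  let Y := {z : ℂ // z ≠ 0 ∧ |z.arg| ≤ ψ}
  have : Nonempty Y := ⟨⟨1, one_ne_zero, by simpa using hψ⟩⟩
  let d : ℕ → Y := TopologicalSpace.denseSeq Y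
  let m : X → ℝ≥0∞ := fun x => ‖Tz 0 F x‖ₑ ⊔ ⨆ i, ‖Tz (d i) F x‖ₑ
  have hm : AEMeasurable m μ :=
    (Lp.aestronglyMeasurable _).enorm.sup
      (AEMeasurable.iSup fun i => (Lp.aestronglyMeasurable _).enorm)
  have hd : ∀ i x, ‖Tz (d i) F x‖ₑ ≤ m x := fun i x =>
    le_sup_of_le_right (le_iSup (fun i => ‖Tz (d i) F x‖ₑ) i)
  have hmk := AEEqFun.coeFn_mk m hm.aestronglyMeasurable
  refine ⟨AEEqFun.mk m hm.aestronglyMeasurable, ?_, fun M hM => ?_⟩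
  · have hY : ∀ y : Y, ∀ᵐ x ∂μ, ‖Tz y F x‖ₑ ≤ m x := fun y =>
      (TopologicalSpace.denseRange_denseSeq Y).induction_on
        (p := fun y : Y => ∀ᵐ x ∂μ, ‖Tz y F x‖ₑ ≤ m x) y
        ((isClosed_ae_enorm_le m).preimage (continuousOn_iff_continuous_domRestrict.1 hT))
        fun i => Eventually.of_forall (hd i)
    rintro _ ⟨z, hz, rfl⟩
    rw [pointwiseNorm_le_iff]
    have h : ∀ᵐ x ∂μ, ‖Tz z F x‖ₑ ≤ m x := by
      by_cases hz0 : z = 0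
      · rw [hz0]
        exact Eventually.of_forall fun x => le_sup_left
      · exact hY ⟨z, hz0, hz.resolve_left hz0⟩
    filter_upwards [h, hmk] with x hx hx0
    rwa [hx0]
  · have h1 : ∀ z ∈ closedSector ψ, ∀ᵐ x ∂μ, ‖Tz z F x‖ₑ ≤ M x := fun z hz =>
      (pointwiseNorm_le_iff _ _).1 (hM ⟨z, hz, rfl⟩)
    rw [← AEEqFun.coeFn_le]
    filter_upwards [hmk, h1 0 (Or.inl rfl),
      ae_all_iff.2 fun i => h1 (d i) (Or.inr (d i).2.2)] with x hx h2 h3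
    rw [hx]
    exact sup_le h2 (iSup_le h3)

/-- Consecutive powers of two have logarithms log 2 < 1 apart. -/
lemma exists_zpow_two_abs_log_sub_le {r : ℝ} (hr : 0 < r) :
    ∃ j : ℤ, |Real.log ((2 : ℝ) ^ j) - Real.log r| ≤ 1 := by
  obtain ⟨j, hj1, hj2⟩ := exists_mem_Ico_zpow hr one_lt_two
  refine ⟨j, ?_⟩
  have h1 := Real.log_le_log (by positivity) hj1
  have h2 := Real.log_le_log hr hj2.le
  rw [zpow_add_one₀ two_ne_zero, Real.log_mul (by positivity) two_ne_zero] at h2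
  have h3 := Real.log_two_lt_d9
  rw [abs_le]
  constructor <;> linarith

variable {S : ℝ≥0 → Lp B p μ →L[ℂ] Lp B p μ} {P : ℝ → Lp B p μ →L[ℂ] Lp B p μ}
  {K ω φ ψ : ℝ}

/-- Moving from z to |z| costs |arg z| ≤ ψ in logarithmic distance, and from |z| to a dyadic time at
most 1. -/
lemma ae_enorm_sectorExtension_le [CompleteSpace B] (hP : IsExpBoundedFamily P K ω)
    (hφ : ω + φ < Real.pi / 2) (hψφ : ψ ≤ φ)
    (hext : ∀ t : ℝ≥0, sectorExtension S P ((t : ℝ) : ℂ) = S t) (F : Lp B p μ) {z : ℂ}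
    (hz : z ≠ 0) (hzψ : |z.arg| ≤ ψ) :
    ∀ᵐ x ∂μ, ‖sectorExtension S P z F x‖ₑ ≤ (⨆ m, dyadicMaximal S F m x)
      + ENNReal.ofReal (1 + ψ) * ‖sectorMajorant P φ F x‖ₑ := by
  obtain ⟨j, hj⟩ := exists_zpow_two_abs_log_sub_le (norm_pos_iff.2 hz)
  set t : ℝ≥0 := 2 ^ j with ht
  have htc : (t : ℝ) = 2 ^ j := by simp [ht]
  have ht0 : (0 : ℝ) < t := by rw [htc]; positivity
  have hψ : 0 ≤ ψ := (abs_nonneg _).trans hzψ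
  have hdist : ‖Complex.log (t : ℝ) - Complex.log z‖ ≤ 1 + ψ := by
    have e : Complex.log (t : ℝ) - Complex.log z
        = (Complex.log (t : ℝ) - Complex.log ‖z‖) + (Complex.log ‖z‖ - Complex.log z) := by ring
    rw [e]
    refine (norm_add_le _ _).trans (add_le_add ?_ (norm_log_sub_log_norm.trans_le hzψ))
    rw [← Complex.ofReal_log ht0.le, ← Complex.ofReal_log (norm_nonneg z), ← Complex.ofReal_sub,
      Complex.norm_real, htc]
    exact hj
  have htarg : |((t : ℝ) : ℂ).arg| ≤ φ := by
    rw [Complex.arg_ofReal_of_nonneg ht0.le, abs_zero]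
    exact hψ.trans hψφ
  filter_upwards [ae_norm_sectorExtension_sub_le (S := S) hP hφ hz
    (by exact_mod_cast ht0.ne' : ((t : ℝ) : ℂ) ≠ 0) (hzψ.trans hψφ) htarg F] with x hx
  rw [hext] at hx
  set g := sectorMajorant P φ F x
  have h1 : ‖sectorExtension S P z F x‖ ≤ ‖S t F x‖ + (1 + ψ) * ‖g‖ := by
    have h2 : ‖sectorExtension S P z F x - S t F x‖ ≤ (1 + ψ) * ‖g‖ :=
      hx.trans ((mul_le_mul_of_nonneg_left (le_abs_self g) (norm_nonneg _)).trans
        (mul_le_mul_of_nonneg_right hdist (norm_nonneg g)))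
    linarith [norm_sub_norm_le (sectorExtension S P z F x) (S t F x)]
  refine le_trans ?_ (add_le_add (enorm_le_iSup_dyadicMaximal F j x) le_rfl)
  rw [← ofReal_norm, ← ofReal_norm, ← ofReal_norm g, ← ENNReal.ofReal_mul (by linarith),
    ← ENNReal.ofReal_add (norm_nonneg _) (by positivity)]
  exact ENNReal.ofReal_le_ofReal h1

/-- The maximal function over a sector is bounded on `L^p`. -/
lemma exists_isMaximalFunction_sectorExtension [CompleteSpace B]
    (hS : IsStronglyContinuousSemigroup S) (hSc : ∀ t, IsL1LInftyContraction (S t)) {C : ℝ}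
    (hC0 : 0 ≤ C) (hC : ∀ t F, ‖S t F‖ ≤ C * ‖F‖) (hp1 : 1 < p) (hp : p < ∞)
    (hP : IsExpBoundedFamily P K ω) (hφ : ω + φ < Real.pi / 2) (hψ : 0 ≤ ψ) (hψφ : ψ < φ)
    (hext : IsBoundedAnalyticContinuation S φ (sectorExtension S P)) :
    ∃ c : ℝ≥0, ∀ F : Lp B p μ, ∃ M : X →ₘ[μ] ℝ≥0∞,
      IsMaximalFunction ψ (sectorExtension S P) F M ∧ eLpNorm M p μ ≤ c * ‖F‖ₑ := by
  set J := ∫ u, sectorWeight φ u * (K * Real.exp (ω * |u|))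
  -- The terms come from the ergodic maximal function, the discretization error g, the passage from
  -- dyadic times to the sector, and the point z = 0, where the operator is the identity.
  set c : ℝ≥0∞ := maximalConst p.toReal * ENNReal.ofReal C + ENNReal.ofReal J
    + ENNReal.ofReal (1 + ψ) * ENNReal.ofReal J + 1 with hc
  have hr : 1 < p.toReal := by
    rw [← ENNReal.toReal_one]; exact (ENNReal.toReal_lt_toReal (by simp) hp.ne).2 hp1
  have hctop : c ≠ ∞ := by
    have := maximalConst_ne_top hr
    finiteness
  refine ⟨c.toNNReal, fun F => ?_⟩
  have hcont : ContinuousOn (fun z => sectorExtension S P z F) {z | z ≠ 0 ∧ |z.arg| ≤ ψ} := by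
    have h1 := hext.analytic.continuousOn.mono (s := sector φ) (t := {z | z ≠ 0 ∧ |z.arg| ≤ ψ})
      fun z hz => ⟨hz.1, hz.2.trans_lt hψφ⟩
    exact h1.clm_apply continuousOn_const
  obtain ⟨M, hM⟩ := exists_isMaximalFunction hψ hcont
  refine ⟨M, hM, ?_⟩
  set g := sectorMajorant P φ F
  have hJ0 : 0 ≤ J := integral_nonneg fun u =>
    mul_nonneg (sectorWeight_nonneg _ _) (mul_nonneg hP.nonneg (Real.exp_pos _).le)
  have hg : ‖g‖ₑ ≤ ENNReal.ofReal J * ‖F‖ₑ := by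
    rw [← ofReal_norm, ← ofReal_norm, ← ENNReal.ofReal_mul hJ0]
    exact ENNReal.ofReal_le_ofReal (hP.norm_sectorMajorant_le hφ F)
  let D : X → ℝ≥0∞ := fun x => ⨆ m, dyadicMaximal S F m x
  let G : X → ℝ≥0∞ := fun x => ENNReal.ofReal (1 + ψ) * ‖g x‖ₑ
  have hDm : AEStronglyMeasurable D μ :=
    (AEMeasurable.iSup fun m => aemeasurable_dyadicMaximal F m).aestronglyMeasurable
  have hGm : AEStronglyMeasurable G μ :=
    ((Lp.aestronglyMeasurable g).enorm.const_mul _).aestronglyMeasurable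
  have hFm : AEStronglyMeasurable (fun x => ‖F x‖ₑ) μ :=
    (Lp.aestronglyMeasurable F).enorm.aestronglyMeasurable
  -- M is a least upper bound, so bounding each z almost everywhere by one fixed function is enough,
  -- even with null sets depending on z.
  have hle : M ≤ AEEqFun.mk (fun x => D x + G x + ‖F x‖ₑ) ((hDm.add hGm).add hFm) := by
    refine hM.2 ?_
    rintro _ ⟨z, hz, rfl⟩
    rw [pointwiseNorm_le_iff]
    have h0 := AEEqFun.coeFn_mk (fun x => D x + G x + ‖F x‖ₑ) ((hDm.add hGm).add hFm)
    by_cases hz0 : z = 0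
    · filter_upwards [h0] with x hx
      rw [hx, hz0, sectorExtension_zero]
      exact le_add_self
    · filter_upwards [h0, ae_enorm_sectorExtension_le hP hφ hψφ.le hext.extends_family F hz0
        (hz.resolve_left hz0)] with x hx h1
      rw [hx]
      exact h1.trans le_self_add
  have hD : eLpNorm D p μ ≤ maximalConst p.toReal * (ENNReal.ofReal C * ‖F‖ₑ) + ‖g‖ₑ := by
    refine eLpNorm_iSup_dyadicMaximal_le hS hSc hC0 hC hp1 hp fun s t hs ht => ?_
    have hs' : (0 : ℝ) < s := hs
    have ht' : (0 : ℝ) < t := ht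
    have harg : ∀ r : ℝ≥0, |((r : ℝ) : ℂ).arg| ≤ φ := fun r => by
      rw [Complex.arg_ofReal_of_nonneg r.coe_nonneg, abs_zero]; linarith
    have h1 := ae_norm_sectorExtension_sub_le (S := S) hP hφ
      (by exact_mod_cast hs'.ne' : ((s : ℝ) : ℂ) ≠ 0)
      (by exact_mod_cast ht'.ne' : ((t : ℝ) : ℂ) ≠ 0) (harg s) (harg t) F
    rwa [hext.extends_family, hext.extends_family, ← Complex.ofReal_log hs'.le,
      ← Complex.ofReal_log ht'.le, ← Complex.ofReal_sub, Complex.norm_real,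
      Real.norm_eq_abs] at h1
  have hG : eLpNorm G p μ ≤ ENNReal.ofReal (1 + ψ) * ‖g‖ₑ := by
    have e : G = fun x => ‖(1 + ψ) • g x‖ₑ := by
      funext x
      rw [enorm_smul, Real.enorm_of_nonneg (by linarith)]
    rw [e, eLpNorm_enorm, Lp.enorm_def, ← Real.enorm_of_nonneg (by linarith : 0 ≤ 1 + ψ)]
    exact (eLpNorm_const_smul (1 + ψ) g p μ).le
  calc eLpNorm M p μ ≤ eLpNorm (fun x => D x + G x + ‖F x‖ₑ) p μ := by
        refine eLpNorm_mono_enorm_ae ?_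
        filter_upwards [AEEqFun.coeFn_le.2 hle,
          AEEqFun.coeFn_mk (fun x => D x + G x + ‖F x‖ₑ) ((hDm.add hGm).add hFm)] with x h1 h2
        rw [← h2]
        simpa only [enorm_eq_self] using h1
    _ ≤ eLpNorm D p μ + eLpNorm G p μ + eLpNorm (fun x => ‖F x‖ₑ) p μ :=
        (eLpNorm_add_le (hDm.add hGm) hFm hp1.le).trans
          (add_le_add (eLpNorm_add_le hDm hGm hp1.le) le_rfl)
    _ ≤ (maximalConst p.toReal * (ENNReal.ofReal C * ‖F‖ₑ) + ENNReal.ofReal J * ‖F‖ₑ)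
        + ENNReal.ofReal (1 + ψ) * (ENNReal.ofReal J * ‖F‖ₑ) + ‖F‖ₑ := by
        refine add_le_add (add_le_add (hD.trans (by gcongr)) (hG.trans (by gcongr))) ?_
        rw [eLpNorm_enorm, Lp.enorm_def]
    _ = c.toNNReal * ‖F‖ₑ := by
        rw [ENNReal.coe_toNNReal hctop, hc]
        ring

end MaximalFunction

end VectorSemigroup

end

/-! ### The main theorem -/

theorem mainTheorem2 {X : Type*} [MeasurableSpace X] (μ : Measure X) [SigmaFinite μ]
    {B : Type*} [NormedAddCommGroup B] [NormedSpace ℂ B] [CompleteSpace B]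
    (p : ℝ≥0∞) [Fact (1 ≤ p)] (hp1 : 1 < p) (hp : p < ∞)
    (T : ℝ≥0 → (Lp ℂ 2 μ →L[ℂ] Lp ℂ 2 μ))
    (hT : VectorSemigroup.IsStronglyContinuousSemigroup T)
    (hTc : VectorSemigroup.HasContractionProperty T)
    (ψ : ℝ) (hψ0 : 0 ≤ ψ) (hψ : ψ < Real.pi / 2)
    (K ω : ℝ) (hK : 0 < K) (hω : ω < Real.pi / 2 - ψ)
    (hBIP : VectorSemigroup.HasBoundedImaginaryPowers
      (VectorSemigroup.negGenerator (VectorSemigroup.vectorExtension p B T)) K ω) :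
    (∀ t : ℝ≥0,
      VectorSemigroup.IsLpExtension (T t) (VectorSemigroup.lpExtension p (T t)) ∧
      VectorSemigroup.IsTensorExtension (VectorSemigroup.lpExtension p (T t))
        (VectorSemigroup.vectorExtension p B T t)) ∧
    ∃ ε : ℝ, 0 < ε ∧ ∃ Tz : ℂ → (Lp B p μ →L[ℂ] Lp B p μ),
      VectorSemigroup.IsBoundedAnalyticContinuation
        (VectorSemigroup.vectorExtension p B T) (ψ + ε) Tz ∧
      ∃ C : ℝ≥0, ∀ F : Lp B p μ, ∃ M : X →ₘ[μ] ℝ≥0∞,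
        VectorSemigroup.IsMaximalFunction ψ Tz F M ∧ eLpNorm M p μ ≤ C * ‖F‖ₑ := by
  refine ⟨fun t => ⟨VectorSemigroup.IsLqContraction.isLpExtension_lpExtension (hTc t) hp1 hp,
    VectorSemigroup.IsLqContraction.isTensorExtension B (hTc t) hp1 hp⟩, ?_⟩
  have hS := VectorSemigroup.isStronglyContinuousSemigroup_vectorExtension B hT hTc hp1 hp
  have hC := VectorSemigroup.norm_vectorExtension_apply_le (B := B) hTc hp1 hp
  have hC0 : 0 ≤ (VectorSemigroup.lpConst p).toReal := ENNReal.toReal_nonneg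
  have hSc := VectorSemigroup.isL1LInftyContraction_vectorExtension (B := B) hTc hp1 hp
  have hQ := VectorSemigroup.exists_tendsto_ergodicAverage (hTc 1)
    (VectorSemigroup.extendsOnIndicators_vectorExtension (B := B) hTc hp1 hp 1) hp1 hp
  choose P hIP hPK using hBIP
  -- ω may be negative. Replacing it by max ω 0 only weakens the bound, and still leaves room below
  -- π/2 - ψ because ψ < π/2.
  obtain ⟨ε, hε, hε'⟩ := exists_between
    (show 0 < Real.pi / 2 - ψ - max ω 0 by
      rcases max_cases ω 0 with h | h <;> linarith)
  have hφ : max ω 0 + (ψ + ε) < Real.pi / 2 := by linarith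
  have hP := VectorSemigroup.isExpBoundedFamily_of_isImaginaryPower (ω := max ω 0) hS hC hC0 hQ
    hIP hK.le fun u F => (hPK u F).trans (by gcongr; exact le_max_left ω 0)
  have hext := VectorSemigroup.isBoundedAnalyticContinuation_sectorExtension hS hC hC0 hQ hIP hP
    (le_max_right ω 0) (by linarith) hφ
  exact ⟨ε, hε, _, hext, VectorSemigroup.exists_isMaximalFunction_sectorExtension hS hSc hC0 hC
    hp1 hp hP hφ hψ0 (by linarith) hext⟩
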